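/- Let $n\ge 3$. For measurable $f:\mathbb R^n\to\mathbb C$ let $f^*(t)=\inf\{\alpha : |\{x : |f(x)|>\alpha\}|\le t\}$ and let $\|f\|_{L^{p,\infty}}=\sup_{t>0}t^{1/p}f^*(t)$ be the weak-$L^p$ quasi-norm, $1\le p\le\infty$ (with $1/\infty=0$, so $L^{\infty,\infty}=L^\infty$). Let $L^{p,\infty}_0(\mathbb R^n)$ be the set of $f$ with $\|f\|_{L^{p,\infty}}<\infty$ and $\lim_{R\to\infty}\|\mathbf 1_{\{|x|\ge R\}}f\|_{L^{p,\infty}}=0$, and put $L^\infty_0=L^{\infty,\infty}_0$. Write $\langle D\rangle^{-s}$ for the Fourier multiplier $(1+|D|^2)^{-s/2}$, $D=-i\nabla$, on $L^2(\mathbb R^n)$. Let $-\Delta$ be the self-adjoint Laplacian on $L^2(\mathbb R^n)$, and let $H_0=-\Delta-\frac{(n-2)^2}{4}|x|^{-2}$ be the non-negative self-adjoint operator on $L^2(\mathbb R^n)$ associated with the closure of the quadratic form $$u\mapsto\int_{\mathbb R^n}\Big(|\nabla u|^2-\tfrac{(n-2)^2}{4}|x|^{-2}|u|^2\Big)\,dx,\qquad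 u\in C_0^\infty(\mathbb R^n).$$ Below, "$wB$ is compact", for a bounded operator $B$ on $L^2(\mathbb R^n)$, means that $w\cdot Bf\in L^2(\mathbb R^n)$ for every $f\in L^2(\mathbb R^n)$ and that $f\mapsto w\cdot Bf$ is a compact operator on $L^2(\mathbb R^n)$. (1) Let $n<p\le\infty$ and $w\in L^{p,\infty}_0(\mathbb R^n)+L^\infty_0(\mathbb R^n)$. Then $w\langle D\rangle^{-s}$ is compact for every real $s>n/p$. In particular, $w(-\Delta+1)^{-1/2}$ and $w(H_0+1)^{-1/2}$ are compact. (2) Let $n/2<p\le\infty$ and let $V\in L^{p,\infty}_0(\mathbb R^n)+L^\infty_0(\mathbb R^n)$ be complex-valued. Then $|V|^{1/2}(-\Delta+1)^{-1/2}$ and $|V|^{1/2}(H_0+1)^{-1/2}$ are compact. -/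

import Mathlib

open MeasureTheory Filter Topology
open scoped ENNReal NNReal ComplexConjugate FourierTransform Laplacian SchwartzMap

noncomputable section

namespace RelFormCompact

/-! ### Weak Lebesgue spaces -/

/-- The decreasing rearrangement `f*(t) = inf {α | |{x : |f x| > α}| ≤ t}`. -/
def decRearr {n : ℕ} (f : EuclideanSpace ℝ (Fin n) → ℂ) (t : ℝ≥0) : ℝ≥0∞ :=
  sInf {α : ℝ≥0∞ | volume {x | α < ‖f x‖ₑ} ≤ t}

/-- The weak-`L^p` (Lorentz `L^{p,∞}`) quasi-norm `sup_{t > 0} t^{1/p} f*(t)`, for `1 ≤ p ≤ ∞`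
(where `1/∞ = 0`, so that for `p = ∞` this is the essential supremum norm). -/
def weakNorm {n : ℕ} (p : ℝ≥0∞) (f : EuclideanSpace ℝ (Fin n) → ℂ) : ℝ≥0∞ :=
  ⨆ (t : ℝ≥0) (_ : 0 < t), (t : ℝ≥0∞) ^ (p⁻¹).toReal * decRearr f t

/-- `f ∈ L^{p,∞}(ℝⁿ)`; for `p = ∞` this is `L^∞(ℝⁿ)`. -/
def MemWeakLp {n : ℕ} (p : ℝ≥0∞) (f : EuclideanSpace ℝ (Fin n) → ℂ) : Prop :=
  AEStronglyMeasurable f volume ∧ weakNorm p f < ∞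

/-- `f ∈ L^{p,∞}_0(ℝⁿ)`: `f ∈ L^{p,∞}` and the `L^{p,∞}` norm of `f` restricted to `{|x| ≥ R}`
tends to `0` as `R → ∞`. For `p = ∞` this is `L^∞_0(ℝⁿ)`. -/
def MemWeakLpZero {n : ℕ} (p : ℝ≥0∞) (f : EuclideanSpace ℝ (Fin n) → ℂ) : Prop :=
  MemWeakLp p f ∧
    Tendsto (fun R : ℝ => weakNorm p ({x | R ≤ ‖x‖}.indicator f)) atTop (𝓝 0)

/-- `f ∈ L^{p,∞}_0(ℝⁿ) + L^∞_0(ℝⁿ)`. -/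
def MemWeakLpZeroAddLinftyZero {n : ℕ} (p : ℝ≥0∞) (f : EuclideanSpace ℝ (Fin n) → ℂ) : Prop :=
  ∃ a b : EuclideanSpace ℝ (Fin n) → ℂ,
    MemWeakLpZero p a ∧ MemWeakLpZero ∞ b ∧ f =ᵐ[volume] a + b

/-! ### Operators on `L²(ℝⁿ)` -/

/-- The complex Hilbert space `L²(ℝⁿ)`. -/
abbrev L2 (n : ℕ) : Type := Lp (α := EuclideanSpace ℝ (Fin n)) ℂ 2

/-- The operator `w(x) B` (first `B`, then multiplication by `w`) is everywhere defined on
`L²(ℝⁿ)`, takes values in `L²(ℝⁿ)`, and is compact there. In particular the range of `B` lies in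
the domain `{f ∈ L² | w f ∈ L²}` of multiplication by `w`. -/
def IsCompactMulComp {n : ℕ} (w : EuclideanSpace ℝ (Fin n) → ℂ) (B : L2 n →L[ℂ] L2 n) : Prop :=
  ∃ K : L2 n →L[ℂ] L2 n, IsCompactOperator K ∧ ∀ f : L2 n, K f =ᵐ[volume] fun x => w x * B f x

/-- The Fourier multiplier `m(D) = 𝓕⁻¹ m 𝓕` on `L²(ℝⁿ)` with symbol `m ∈ L^∞`. Here `𝓕` is the
unitary Fourier transform with kernel `e^{-2πi⟨x, ξ⟩}`, so `m` is a function of the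
frequency `ξ = D / 2π`. -/
def fourierMultiplier {n : ℕ} (m : EuclideanSpace ℝ (Fin n) → ℂ) (hm : MemLp m ∞ volume) :
    L2 n →L[ℂ] L2 n :=
  let F := Lp.fourierTransformₗᵢ (EuclideanSpace ℝ (Fin n)) ℂ
  (F.symm.toContinuousLinearEquiv : L2 n →L[ℂ] L2 n) ∘L
    ((ContinuousLinearMap.mul ℂ ℂ).holderL volume ∞ 2 2 hm.toLp) ∘L
      (F.toContinuousLinearEquiv : L2 n →L[ℂ] L2 n)

/-- The symbol of `⟨D⟩^{-s} = (1 + |D|²)^{-s/2}`, with `D = -i∇ = 2πξ`. -/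
def japaneseSymbol (n : ℕ) (s : ℝ≥0) (ξ : EuclideanSpace ℝ (Fin n)) : ℂ :=
  (((1 + (2 * Real.pi * ‖ξ‖) ^ 2) ^ (-(s : ℝ) / 2) : ℝ) : ℂ)

lemma memLp_japaneseSymbol (n : ℕ) (s : ℝ≥0) : MemLp (japaneseSymbol n s) ∞ volume := by
  have hpos : ∀ ξ : EuclideanSpace ℝ (Fin n), (1 : ℝ) ≤ 1 + (2 * Real.pi * ‖ξ‖) ^ 2 :=
    fun ξ => by nlinarith [sq_nonneg (2 * Real.pi * ‖ξ‖)]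
  refine memLp_top_of_bound (Continuous.aestronglyMeasurable ?_) 1 (ae_of_all _ fun ξ => ?_)
  · refine Complex.continuous_ofReal.comp (Continuous.rpow_const (by fun_prop) fun ξ => ?_)
    exact Or.inl (by linarith [hpos ξ])
  · rw [japaneseSymbol, Complex.norm_real, Real.norm_of_nonneg (by linarith [hpos ξ, Real.rpow_nonneg (by linarith [hpos ξ] : (0 : ℝ) ≤ 1 + (2 * Real.pi * ‖ξ‖) ^ 2) (-(s : ℝ) / 2)])]
    exact Real.rpow_le_one_of_one_le_of_nonpos (hpos ξ) (by
      have := s.2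
      simp only [NNReal.val_eq_coe] at this
      linarith)

/-- The bounded operator `⟨D⟩^{-s}` on `L²(ℝⁿ)`, for `s ≥ 0`. -/
def japaneseD (n : ℕ) (s : ℝ≥0) : L2 n →L[ℂ] L2 n :=
  fourierMultiplier (japaneseSymbol n s) (memLp_japaneseSymbol n s)

/-! ### Unbounded operators, given by their graphs -/

/-- For a non-negative self-adjoint operator `T` with graph `G = {(u, T u) | u ∈ D(T)}`, this says
that `S = (T + 1)^{-1/2}`: `S` is a bounded positive operator whose square is the inverse of
`T + 1`, i.e. `S² f = u` if and only if `u ∈ D(T)` and `T u + u = f`. -/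
def IsInvSqrtAddOne {H : Type*} [NormedAddCommGroup H] [InnerProductSpace ℂ H] [CompleteSpace H]
    (G : Set (H × H)) (S : H →L[ℂ] H) : Prop :=
  S.IsPositive ∧ ∀ f u : H, S (S f) = u ↔ (u, f - u) ∈ G

/-- There is at most one operator `(T + 1)^{-1/2}`. -/
lemma IsInvSqrtAddOne.unique {H : Type*} [NormedAddCommGroup H] [InnerProductSpace ℂ H]
    [CompleteSpace H] {G : Set (H × H)} {S S' : H →L[ℂ] H}
    (h : IsInvSqrtAddOne G S) (h' : IsInvSqrtAddOne G S') : S = S' := by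
  have hS : 0 ≤ S := (ContinuousLinearMap.nonneg_iff_isPositive S).2 h.1
  have hS' : 0 ≤ S' := (ContinuousLinearMap.nonneg_iff_isPositive S').2 h'.1
  have hsq : S * S = S' * S' := by
    ext1 f
    exact (((h'.2 f (S (S f))).2 ((h.2 f _).1 rfl))).symm
  rw [← CFC.sqrt_mul_self S hS, hsq, CFC.sqrt_mul_self S' hS']

/-- For a non-negative self-adjoint operator `T` on `L²(ℝⁿ)` with graph `G`: the operator
`w(x) (T + 1)^{-1/2}` is compact on `L²(ℝⁿ)`. -/
def IsCompactMulInvSqrt {n : ℕ} (w : EuclideanSpace ℝ (Fin n) → ℂ) (G : Set (L2 n × L2 n)) :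
    Prop :=
  ∃ S : L2 n →L[ℂ] L2 n, IsInvSqrtAddOne G S ∧ IsCompactMulComp w S

/-- The graph of the self-adjoint operator `-Δ` on `L²(ℝⁿ)`: the pairs `(u, f)` in `L² × L²` with
`f = -Δu` in the sense of distributions. -/
def negLaplacianGraph (n : ℕ) : Set (L2 n × L2 n) :=
  {p | (Lp.toTemperedDistribution p.2 : 𝓢'(EuclideanSpace ℝ (Fin n), ℂ)) =
    -Δ (Lp.toTemperedDistribution p.1 : 𝓢'(EuclideanSpace ℝ (Fin n), ℂ))}

/-- `φ ∈ C_0^∞(ℝⁿ)`. -/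
def IsTestFun {n : ℕ} (φ : EuclideanSpace ℝ (Fin n) → ℂ) : Prop :=
  ContDiff ℝ (⊤ : ℕ∞) φ ∧ HasCompactSupport φ

/-- The constant `C_H = (n - 2)² / 4` in Hardy's inequality. -/
def hardyConst (n : ℕ) : ℝ := ((n : ℝ) - 2) ^ 2 / 4

/-- The sesquilinear form (conjugate-linear in the first argument)
`q̃₀(φ, ψ) = ∫ (∇φ̄ · ∇ψ - C_H |x|⁻² φ̄ ψ) dx` on `C_0^∞(ℝⁿ)`. -/
def hardyForm {n : ℕ} (φ ψ : EuclideanSpace ℝ (Fin n) → ℂ) : ℂ :=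
  ∫ x, ((∑ i : Fin n, conj (fderiv ℝ φ x (EuclideanSpace.single i 1)) *
      fderiv ℝ ψ x (EuclideanSpace.single i 1)) -
    ((hardyConst n / ‖x‖ ^ 2 : ℝ) : ℂ) * (conj (φ x) * ψ x))

/-- The sequence `φ` of test functions converges to `u` in `L²` and is Cauchy for `q̃₀`. -/
def FormApprox {n : ℕ} (φ : ℕ → EuclideanSpace ℝ (Fin n) → ℂ) (u : L2 n) : Prop :=
  (∀ k, IsTestFun (φ k)) ∧
  Tendsto (fun k => eLpNorm (φ k - ⇑u) 2 volume) atTop (𝓝 0) ∧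
  Tendsto (fun k : ℕ × ℕ => hardyForm (φ k.1 - φ k.2) (φ k.1 - φ k.2)) atTop (𝓝 0)

/-- `u ∈ D(q₀)`, where `q₀` is the closure of the form `q̃₀`. -/
def MemFormDomain {n : ℕ} (u : L2 n) : Prop := ∃ φ, FormApprox φ u

/-- `u, v ∈ D(q₀)` and `q₀(u, v) = c`, where `q₀` is the closure of the form `q̃₀`. -/
def ClosedFormEq {n : ℕ} (u v : L2 n) (c : ℂ) : Prop :=
  ∃ φ ψ, FormApprox φ u ∧ FormApprox ψ v ∧
    Tendsto (fun k => hardyForm (φ k) (ψ k)) atTop (𝓝 c)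

/-- The graph of `H₀ = -Δ - C_H |x|⁻²`, the self-adjoint operator on `L²(ℝⁿ)` associated with
the closed form `q₀`: `u ∈ D(H₀)` and `H₀ u = f` if and only if `u ∈ D(q₀)` and
`q₀(v, u) = ⟨v, f⟩` for all `v ∈ D(q₀)`. -/
def hardyGraph (n : ℕ) : Set (L2 n × L2 n) :=
  {p | MemFormDomain p.1 ∧ ∀ v : L2 n, MemFormDomain v → ClosedFormEq v p.1 (inner ℂ v p.2)}

end RelFormCompact

end

/-! All four assertions reduce to one hypothesis on the weight, `WeakDecay q w`: the sets `{|w| >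
l}` have finite measure for every `l > 0`, and their measure is `O(l^{-q})` for `l ≥ 1`. A weight in
`L^{p,∞}_0 + L^∞_0` satisfies it for every finite positive `q ≤ p`. Passing from `V` to `|V|^{1/2}`
doubles `q`, so part (2) becomes part (1).

For `⟨D⟩^{-s}` with `q > 2` and `n/q < s`, `w` is truncated to `|w| > 2^{-N}` and the symbol to `|ξ|
< 2^N`. Both truncated functions are square integrable, so the truncated operator is
Hilbert–Schmidt, hence compact (`isCompactOperator_mul_fourierMultiplier`). Consecutive truncations
differ by a geometrically small operator: on a dyadic frequency shell of size `2^N`, `w` is split at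
height `L = 2^{Nn/q}`. The part above `L` is estimated in Hilbert–Schmidt norm and the rest by its
supremum, and both are `O(2^{N(n/q-s)})` (`eLpNorm_dyadic_step_le`). A norm limit of compact
operators is compact. The case `s = 1` is the statement for `-Δ`, since `⟨D⟩^{-1} = (-Δ+1)^{-1/2}`.

For `H₀` the Hardy constant is critical, so the form norm does not control the `H¹` norm. With `c =
(n-2)/2`, completing the square writes the form as `∫ |∇φ + c |x|⁻² x φ|²` (`hardyForm_eq`). This
identifies the closed form domain with a closed subspace of `L² ⊕ (L²)ⁿ`, with inclusion `J` into
`L²` such that `(H₀+1)⁻¹ = J J*` (`mem_hardyGraph_iff`). What the critical form loses is recovered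
by a weight vanishing at the origin: with `χ = (|x|²/(1+|x|²))^{ε/2}`, a Hardy inequality with
weight `χ²|x|⁻²` shows that multiplication by `χ` sends the form domain into `H¹`
(`integral_zfun_div_mul_norm_sq_le`, `integral_cutGrad_le`).

Dually, `‖(H₀+1)^{-1/2} χ f‖ ≤ C ‖⟨D⟩^{-1} f‖`, which gives a factorisation `χ (H₀+1)^{-1/2} =
⟨D⟩^{-1} T` with `T` bounded. Therefore `w (H₀+1)^{-1/2} = (w χ⁻¹ ⟨D⟩^{-1}) T`. As `χ⁻¹` is of size
`|x|^{-ε}` at the origin, `w χ⁻¹` still has decay exponent above `n` for small `ε`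
(`WeakDecay.mul`), and the free case applies to it. -/

noncomputable section

namespace RelFormCompact

/-! ### Multiplication operators and Fourier multipliers on `L²` -/

section Multipliers

variable {n : ℕ}

/-- Multiplication by a bounded function on `L²`. -/
def mulL2 (m : EuclideanSpace ℝ (Fin n) → ℂ) (hm : MemLp m ∞ volume) : L2 n →L[ℂ] L2 n :=
  (ContinuousLinearMap.mul ℂ ℂ).holderL volume ∞ 2 2 hm.toLp

lemma coeFn_mulL2 (m : EuclideanSpace ℝ (Fin n) → ℂ) (hm : MemLp m ∞ volume) (f : L2 n) :
    mulL2 m hm f =ᵐ[volume] fun x => m x * f x := by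
  have h := (ContinuousLinearMap.mul ℂ ℂ).coeFn_holder (r := 2) (hm.toLp m) f
  filter_upwards [h, hm.coeFn_toLp] with x hx hx'
  simp only [mulL2, ContinuousLinearMap.holderL_apply_apply]
  rw [hx, hx']
  rfl

lemma fourierMultiplier_apply (m : EuclideanSpace ℝ (Fin n) → ℂ) (hm : MemLp m ∞ volume)
    (f : L2 n) : fourierMultiplier m hm f = 𝓕⁻ (mulL2 m hm (𝓕 f)) := rfl

lemma norm_mulL2_le {m : EuclideanSpace ℝ (Fin n) → ℂ} (hm : MemLp m ∞ volume) {C : ℝ}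
    (hC : ∀ᵐ x, ‖m x‖ ≤ C) (f : L2 n) : ‖mulL2 m hm f‖ ≤ C * ‖f‖ := by
  refine Lp.norm_le_mul_norm_of_ae_le_mul ?_
  filter_upwards [coeFn_mulL2 m hm f, hC] with x hx hx'
  rw [hx, norm_mul]
  gcongr

lemma norm_fourierMultiplier_le {m : EuclideanSpace ℝ (Fin n) → ℂ} (hm : MemLp m ∞ volume)
    {C : ℝ} (hC : ∀ᵐ x, ‖m x‖ ≤ C) (f : L2 n) : ‖fourierMultiplier m hm f‖ ≤ C * ‖f‖ := by
  rw [fourierMultiplier_apply]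
  calc _ = ‖mulL2 m hm (𝓕 f)‖ := (Lp.fourierTransformₗᵢ _ ℂ).symm.norm_map _
    _ ≤ C * ‖𝓕 f‖ := norm_mulL2_le hm hC _
    _ = C * ‖f‖ := by rw [Lp.norm_fourier_eq]

lemma mulL2_sub {m m' : EuclideanSpace ℝ (Fin n) → ℂ} (hm : MemLp m ∞ volume)
    (hm' : MemLp m' ∞ volume) (f : L2 n) :
    mulL2 (m - m') (hm.sub hm') f = mulL2 m hm f - mulL2 m' hm' f := by
  rw [mulL2, mulL2, mulL2, MemLp.toLp_sub hm hm']
  simp only [map_sub, sub_apply]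

lemma fourierMultiplier_sub {m m' : EuclideanSpace ℝ (Fin n) → ℂ} (hm : MemLp m ∞ volume)
    (hm' : MemLp m' ∞ volume) (f : L2 n) :
    fourierMultiplier (m - m') (hm.sub hm') f =
      fourierMultiplier m hm f - fourierMultiplier m' hm' f := by
  rw [fourierMultiplier_apply, mulL2_sub]
  exact (Lp.fourierTransformₗᵢ (EuclideanSpace ℝ (Fin n)) ℂ).symm.map_sub _ _

lemma mulL2_mulL2 {m m' : EuclideanSpace ℝ (Fin n) → ℂ} (hm : MemLp m ∞ volume)
    (hm' : MemLp m' ∞ volume) (hmm' : MemLp (fun x => m x * m' x) ∞ volume) (f : L2 n) :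
    mulL2 m hm (mulL2 m' hm' f) = mulL2 _ hmm' f := by
  apply Lp.ext
  filter_upwards [coeFn_mulL2 m hm (mulL2 m' hm' f), coeFn_mulL2 m' hm' f,
    coeFn_mulL2 _ hmm' f] with x h1 h2 h3
  rw [h1, h2, h3, mul_assoc]

lemma fourierMultiplier_fourierMultiplier {m m' : EuclideanSpace ℝ (Fin n) → ℂ}
    (hm : MemLp m ∞ volume) (hm' : MemLp m' ∞ volume)
    (hmm' : MemLp (fun x => m x * m' x) ∞ volume) (f : L2 n) :
    fourierMultiplier m hm (fourierMultiplier m' hm' f) = fourierMultiplier _ hmm' f := by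
  rw [fourierMultiplier_apply, fourierMultiplier_apply, fourierMultiplier_apply,
    FourierTransform.fourier_fourierInv_eq, mulL2_mulL2 hm hm' hmm']

lemma inner_mulL2_left {m : EuclideanSpace ℝ (Fin n) → ℂ} (hm : MemLp m ∞ volume)
    (hreal : ∀ x, conj (m x) = m x) (f g : L2 n) :
    inner ℂ (mulL2 m hm f) g = inner ℂ f (mulL2 m hm g) := by
  rw [L2.inner_def, L2.inner_def]
  refine integral_congr_ae ?_
  filter_upwards [coeFn_mulL2 m hm f, coeFn_mulL2 m hm g] with x h1 h2
  rw [h1, h2]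
  simp only [RCLike.inner_apply, map_mul, hreal]
  ring

lemma inner_fourierInv_left (f g : L2 n) : inner ℂ (𝓕⁻ f : L2 n) g = inner ℂ f (𝓕 g : L2 n) := by
  have h := Lp.inner_fourier_eq (𝓕⁻ f : L2 n) g
  rwa [FourierTransform.fourier_fourierInv_eq f, eq_comm] at h

lemma inner_fourierInv_right (f g : L2 n) : inner ℂ f (𝓕⁻ g : L2 n) = inner ℂ (𝓕 f : L2 n) g := by
  have h := Lp.inner_fourier_eq f (𝓕⁻ g : L2 n)
  rwa [FourierTransform.fourier_fourierInv_eq g, eq_comm] at h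

lemma inner_fourierMultiplier_left {m : EuclideanSpace ℝ (Fin n) → ℂ} (hm : MemLp m ∞ volume)
    (hreal : ∀ x, conj (m x) = m x) (f g : L2 n) :
    inner ℂ (fourierMultiplier m hm f) g = inner ℂ f (fourierMultiplier m hm g) := by
  rw [fourierMultiplier_apply, fourierMultiplier_apply, inner_fourierInv_left,
    inner_fourierInv_right, inner_mulL2_left hm hreal]

lemma isPositive_fourierMultiplier {m : EuclideanSpace ℝ (Fin n) → ℝ}
    (hm : MemLp (fun ξ => (m ξ : ℂ)) ∞ volume) (hpos : ∀ ξ, 0 ≤ m ξ) :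
    (fourierMultiplier (fun ξ => (m ξ : ℂ)) hm).IsPositive := by
  refine (ContinuousLinearMap.isPositive_def' ).2 ⟨?_, fun f => ?_⟩
  · rw [ContinuousLinearMap.isSelfAdjoint_iff_isSymmetric]
    exact fun f g => inner_fourierMultiplier_left hm (fun x => Complex.conj_ofReal _) f g
  · rw [ContinuousLinearMap.reApplyInnerSelf_apply, fourierMultiplier_apply]
    rw [inner_fourierInv_left, L2.inner_def]
    have : ∫ x, inner ℂ ((mulL2 _ hm (𝓕 f) : L2 n) x) ((𝓕 f : L2 n) x) =
        ((∫ x, m x * ‖(𝓕 f : L2 n) x‖ ^ 2 : ℝ) : ℂ) := by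
      rw [← integral_complex_ofReal]
      refine integral_congr_ae ?_
      filter_upwards [coeFn_mulL2 _ hm (𝓕 f)] with x hx
      rw [hx]
      simp only [RCLike.inner_apply, map_mul, Complex.conj_ofReal]
      push_cast
      rw [← Complex.mul_conj']
      ring
    rw [this]
    exact integral_nonneg fun x => mul_nonneg (hpos x) (sq_nonneg _)

end Multipliers

/-! ### The operator `(-Δ + 1)^{-1/2}` -/

section FreeResolvent

variable {n : ℕ}

lemma toTemperedDistribution_injective :
    Function.Injective (fun f : L2 n =>
      (Lp.toTemperedDistribution f : 𝓢'(EuclideanSpace ℝ (Fin n), ℂ))) := by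
  have h := Lp.ker_toTemperedDistributionCLM_eq_bot (E := EuclideanSpace ℝ (Fin n)) (F := ℂ)
    (μ := volume) (p := 2)
  exact LinearMap.ker_eq_bot.1 h

lemma toTemperedDistribution_mulL2 {m : EuclideanSpace ℝ (Fin n) → ℂ} (hm : MemLp m ∞ volume)
    (hg : m.HasTemperateGrowth) (f : L2 n) :
    (Lp.toTemperedDistribution (mulL2 m hm f) : 𝓢'(EuclideanSpace ℝ (Fin n), ℂ)) =
      TemperedDistribution.smulLeftCLM ℂ m (Lp.toTemperedDistribution f) := by
  ext u
  simp only [Lp.toTemperedDistribution_apply, TemperedDistribution.smulLeftCLM_apply_apply]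
  apply integral_congr_ae
  filter_upwards [coeFn_mulL2 m hm f] with x hx
  simp only [hx, hg, SchwartzMap.smulLeftCLM_apply_apply, smul_eq_mul]
  ring

lemma one_le_japanese (ξ : EuclideanSpace ℝ (Fin n)) : 1 ≤ 1 + (2 * Real.pi * ‖ξ‖) ^ 2 := by
  nlinarith [sq_nonneg (2 * Real.pi * ‖ξ‖)]

lemma japaneseSymbol_mul_self_one (ξ : EuclideanSpace ℝ (Fin n)) :
    japaneseSymbol n 1 ξ * japaneseSymbol n 1 ξ =
      ((1 + (2 * Real.pi * ‖ξ‖) ^ 2 : ℝ) : ℂ)⁻¹ := by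
  have h := one_le_japanese ξ
  rw [japaneseSymbol, ← Complex.ofReal_mul, ← Real.rpow_add (by linarith), ← Complex.ofReal_inv,
    ← Real.rpow_neg_one]
  norm_num

lemma hasTemperateGrowth_one_add :
    (fun ξ : EuclideanSpace ℝ (Fin n) => ((1 + (2 * Real.pi * ‖ξ‖) ^ 2 : ℝ) : ℂ)).HasTemperateGrowth := by
  simp_rw [mul_pow]
  fun_prop

lemma hasTemperateGrowth_japaneseSymbol_mul_self :
    (fun ξ : EuclideanSpace ℝ (Fin n) =>
      japaneseSymbol n 1 ξ * japaneseSymbol n 1 ξ).HasTemperateGrowth := by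
  have h : (fun ξ : EuclideanSpace ℝ (Fin n) => japaneseSymbol n 1 ξ * japaneseSymbol n 1 ξ) =
      fun ξ => (((1 + ‖(2 * Real.pi) • ξ‖ ^ 2) ^ (-1 : ℝ) : ℝ) : ℂ) := by
    ext ξ
    rw [japaneseSymbol_mul_self_one, norm_smul, Real.rpow_neg_one, Complex.ofReal_inv,
      Real.norm_of_nonneg (by positivity)]
  rw [h]
  have h2 : (fun ξ : EuclideanSpace ℝ (Fin n) => (2 * Real.pi) • ξ).HasTemperateGrowth := by
    fun_prop
  exact (Function.HasTemperateGrowth.comp (g := Complex.ofReal) (by fun_prop)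
    (Function.hasTemperateGrowth_one_add_norm_sq_rpow _ (-1))).comp h2

lemma memLp_japaneseSymbol_mul_self : MemLp (fun ξ : EuclideanSpace ℝ (Fin n) =>
      japaneseSymbol n 1 ξ * japaneseSymbol n 1 ξ) ∞ volume :=
  (memLp_japaneseSymbol n 1).mul (p := ∞) (q := ∞) (memLp_japaneseSymbol n 1)

/-- The Fourier transform is injective on tempered distributions and turns `-Δ` into multiplication
by `(2π|ξ|)²`. The right-hand side stays an identity of distributions because the polynomial times
`𝓕 u` is not known in advance to be in `L²`. -/
lemma mem_negLaplacianGraph_iff (f u : L2 n) :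
    (u, f - u) ∈ negLaplacianGraph n ↔
      (Lp.toTemperedDistribution (𝓕 f : L2 n) : 𝓢'(EuclideanSpace ℝ (Fin n), ℂ)) =
      TemperedDistribution.smulLeftCLM ℂ
        (fun ξ => ((1 + (2 * Real.pi * ‖ξ‖) ^ 2 : ℝ) : ℂ))
        (Lp.toTemperedDistribution (𝓕 u : L2 n)) := by
  have hinj : Function.Injective
      (fun T : 𝓢'(EuclideanSpace ℝ (Fin n), ℂ) => (𝓕 T : 𝓢'(EuclideanSpace ℝ (Fin n), ℂ))) :=
    Function.LeftInverse.injective (g := fun T => 𝓕⁻ T)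
      fun T => FourierTransform.fourierInv_fourier_eq T
  have hsub : (Lp.toTemperedDistribution (f - u) : 𝓢'(EuclideanSpace ℝ (Fin n), ℂ)) =
      Lp.toTemperedDistribution f - Lp.toTemperedDistribution u :=
    (Lp.toTemperedDistributionCLM ℂ volume 2).map_sub f u
  have hF : ∀ v : L2 n, (𝓕 (Lp.toTemperedDistribution v) : 𝓢'(EuclideanSpace ℝ (Fin n), ℂ)) =
    Lp.toTemperedDistribution (𝓕 v : L2 n) := Lp.fourier_toTemperedDistribution_eq
  have hsm : TemperedDistribution.smulLeftCLM ℂ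
        (fun ξ : EuclideanSpace ℝ (Fin n) => ((1 + (2 * Real.pi * ‖ξ‖) ^ 2 : ℝ) : ℂ)) =
      1 + ((2 * Real.pi) ^ 2 : ℂ) • TemperedDistribution.smulLeftCLM ℂ
        (fun ξ => ((‖ξ‖ ^ 2 : ℝ) : ℂ)) := by
    have hg : (fun ξ : EuclideanSpace ℝ (Fin n) => ((‖ξ‖ ^ 2 : ℝ) : ℂ)).HasTemperateGrowth := by
      fun_prop
    rw [← TemperedDistribution.smulLeftCLM_smul hg]
    have h1 : (fun ξ : EuclideanSpace ℝ (Fin n) => ((1 + (2 * Real.pi * ‖ξ‖) ^ 2 : ℝ) : ℂ)) =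
        (fun _ => (1 : ℂ)) + ((2 * Real.pi) ^ 2 : ℂ) • (fun ξ => ((‖ξ‖ ^ 2 : ℝ) : ℂ)) := by
      ext ξ
      simp only [Pi.add_apply, Pi.smul_apply, smul_eq_mul]
      push_cast
      ring
    rw [h1, TemperedDistribution.smulLeftCLM_add (by fun_prop) (by fun_prop)]
    congr 1
    ext1 T
    simp
  simp only [negLaplacianGraph, Set.mem_ofPred_eq]
  have hlap : ∀ T : 𝓢'(EuclideanSpace ℝ (Fin n), ℂ), (𝓕 (-Δ T) : 𝓢'(EuclideanSpace ℝ (Fin n), ℂ)) =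
      ((2 * Real.pi) ^ 2 : ℂ) • TemperedDistribution.smulLeftCLM ℂ
        (fun ξ => ((‖ξ‖ ^ 2 : ℝ) : ℂ)) (𝓕 T) := by
    intro T
    rw [TemperedDistribution.laplacian_eq_fourierMultiplierCLM,
      TemperedDistribution.fourierMultiplierCLM_apply, neg_smul, neg_neg, ← Complex.coe_smul,
      FourierTransform.fourier_smul, FourierTransform.fourier_fourierInv_eq]
    push_cast
    rfl
  rw [hsub, sub_eq_iff_eq_add, ← hinj.eq_iff]
  rw [FourierTransform.fourier_add, hlap, hF, hF, hsm, add_comm]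
  rfl

/-- The squared symbol and `1 + (2π|ξ|)²` are mutually inverse and both of temperate growth.
Multiplications by them are therefore inverse to each other on all tempered distributions, and no
separate discussion of the domain is needed. -/
lemma isInvSqrtAddOne_japaneseD : IsInvSqrtAddOne (negLaplacianGraph n) (japaneseD n 1) := by
  refine ⟨isPositive_fourierMultiplier _ fun ξ => ?_, fun f u => ?_⟩
  · have := one_le_japanese ξ
    positivity
  · rw [mem_negLaplacianGraph_iff, japaneseD,
      fourierMultiplier_fourierMultiplier _ _ memLp_japaneseSymbol_mul_self,
      fourierMultiplier_apply]
    have h1 : (fun ξ : EuclideanSpace ℝ (Fin n) => japaneseSymbol n 1 ξ * japaneseSymbol n 1 ξ) *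
        (fun ξ : EuclideanSpace ℝ (Fin n) => ((1 + (2 * Real.pi * ‖ξ‖) ^ 2 : ℝ) : ℂ)) = fun _ => 1 := by
      ext ξ
      have := one_le_japanese ξ
      rw [Pi.mul_apply, japaneseSymbol_mul_self_one]
      exact inv_mul_cancel₀ (by exact_mod_cast (by positivity))
    have hA := hasTemperateGrowth_japaneseSymbol_mul_self (n := n)
    have hB := hasTemperateGrowth_one_add (n := n)
    have e1 : 𝓕⁻ (mulL2 _ memLp_japaneseSymbol_mul_self (𝓕 f : L2 n)) = u ↔
        mulL2 _ memLp_japaneseSymbol_mul_self (𝓕 f : L2 n) = 𝓕 u := by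
      constructor
      · rintro rfl
        rw [FourierTransform.fourier_fourierInv_eq]
      · intro h
        rw [h, FourierTransform.fourierInv_fourier_eq]
    rw [e1, ← toTemperedDistribution_injective.eq_iff, toTemperedDistribution_mulL2 _ hA]
    constructor
    · intro h
      rw [← h, TemperedDistribution.smulLeftCLM_smulLeftCLM_apply hA hB, h1]
      simp
    · intro h
      rw [h, TemperedDistribution.smulLeftCLM_smulLeftCLM_apply hB hA, mul_comm, h1]
      simp

end FreeResolvent

/-! ### Hilbert–Schmidt operators -/

section HilbertSchmidt

variable {ι H H' : Type*} [NormedAddCommGroup H] [InnerProductSpace ℂ H]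
  [NormedAddCommGroup H'] [InnerProductSpace ℂ H'] [CompleteSpace H']

/-- A bounded operator with `∑ ‖T bᵢ‖² < ∞` for some Hilbert basis `b` is compact. -/
theorem isCompactOperator_of_summable_norm_sq (b : HilbertBasis ι ℂ H) (T : H →L[ℂ] H')
    (hs : Summable fun i => ‖T (b i)‖ ^ 2) : IsCompactOperator T := by
  set A : ι → H →L[ℂ] H' := fun i =>
    (ContinuousLinearMap.toSpanSingleton ℂ (T (b i))) ∘L (innerSL ℂ (b i)) with hA
  have hAx : ∀ i x, A i x = inner ℂ (b i) x • T (b i) := fun i x => by simp [hA]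
  have hAc : ∀ i, IsCompactOperator (A i) := fun i =>
    (isCompactOperator_of_locallyCompactSpace_dom (innerSL ℂ (b i))).clm_comp
      (ContinuousLinearMap.toSpanSingleton ℂ (T (b i)))
  -- Cauchy–Schwarz together with Bessel's inequality bounds the operator norm of a finite partial
  -- sum by the `ℓ²` norm of the corresponding `‖T bᵢ‖`. The rank-one operators are thus summable in
  -- norm, and `T` is a norm limit of finite-rank operators.
  have hsum : Summable A := by
    rw [summable_iff_vanishing_norm]
    intro ε hε
    obtain ⟨s, hs'⟩ := summable_iff_vanishing_norm.1 hs ((ε / 2) ^ 2) (by positivity)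
    refine ⟨s, fun t ht => ?_⟩
    have h1 : ∑ i ∈ t, ‖T (b i)‖ ^ 2 ≤ (ε / 2) ^ 2 :=
      (le_abs_self _).trans (hs' t ht).le
    refine lt_of_le_of_lt (ContinuousLinearMap.opNorm_le_bound _ (half_pos hε).le fun x => ?_)
      (half_lt_self hε)
    have h2 : ∑ i ∈ t, ‖inner ℂ (b i) x‖ ^ 2 ≤ ‖x‖ ^ 2 := b.orthonormal.sum_inner_products_le x
    have h3 := Finset.sum_mul_sq_le_sq_mul_sq t (fun i => ‖inner ℂ (b i) x‖) fun i => ‖T (b i)‖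
    have h4 : ‖(∑ i ∈ t, A i) x‖ ≤ ∑ i ∈ t, ‖inner ℂ (b i) x‖ * ‖T (b i)‖ := by
      rw [sum_apply]
      refine (norm_sum_le _ _).trans (Finset.sum_le_sum fun i _ => ?_)
      rw [hAx, norm_smul]
    refine h4.trans (abs_le_of_sq_le_sq' (h3.trans ?_) (by positivity)).2
    calc _ ≤ ‖x‖ ^ 2 * (ε / 2) ^ 2 := by gcongr
      _ = _ := by ring
  have hT : ∑' i, A i = T := by
    ext1 x
    have h1 : HasSum (fun i => A i x) ((∑' i, A i) x) :=
      hsum.hasSum.mapL (ContinuousLinearMap.apply ℂ H' x)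
    have h2 : HasSum (fun i => A i x) (T x) := by
      have := (b.hasSum_repr x).mapL T
      refine this.congr_fun fun i => ?_
      rw [hAx, map_smul, b.repr_apply_apply]
    exact h1.unique h2
  have hs := hsum.hasSum
  rw [hT] at hs
  refine isCompactOperator_of_tendsto hs (Eventually.of_forall fun s => ?_)
  exact Submodule.sum_mem (compactOperator (RingHom.id ℂ) H H') fun i _ => hAc i

end HilbertSchmidt

/-! ### Integral representation of `g(D)` for `g ∈ L² ∩ L^∞`. -/

section Kernel

variable {n : ℕ}

/-- On `L¹ ∩ L²`, the inverse Fourier transform on `L²` is given by the Fourier integral. -/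
lemma fourierInv_ae_eq_of_integrable (u : L2 n) (hu : Integrable u) :
    (𝓕⁻ u : L2 n) =ᵐ[volume] (𝓕⁻ (u : EuclideanSpace ℝ (Fin n) → ℂ)) := by
  have hcont : Continuous (𝓕⁻ (u : EuclideanSpace ℝ (Fin n) → ℂ)) :=
    VectorFourier.fourierIntegral_continuous Real.continuous_fourierChar
      (by exact (continuous_inner (𝕜 := ℝ)).neg) hu
  -- Both sides are locally integrable, so it suffices to pair with test functions. There the
  -- distributional transform and Fubini for the Fourier integral give the same number.
  refine ae_eq_of_integral_contDiff_smul_eq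
    ((Lp.memLp (𝓕⁻ u : L2 n)).locallyIntegrable (by norm_num)) hcont.locallyIntegrable
    fun g hg hgc => ?_
  have hg₁ : HasCompactSupport (Complex.ofRealCLM ∘ g) := hgc.comp_left rfl
  have hg₂ : ContDiff ℝ (⊤ : ℕ∞) (Complex.ofRealCLM ∘ g) := by fun_prop
  set G : 𝓢(EuclideanSpace ℝ (Fin n), ℂ) := hg₁.toSchwartzMap hg₂ with hG
  have hGx : ∀ x, G x = (g x : ℂ) := fun x => rfl
  have h1 : ∫ x, g x • (𝓕⁻ u : L2 n) x =
      (Lp.toTemperedDistribution (𝓕⁻ u : L2 n) : 𝓢'(EuclideanSpace ℝ (Fin n), ℂ)) G := by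
    simp [hGx]
  rw [h1, ← Lp.fourierInv_toTemperedDistribution_eq, TemperedDistribution.fourierInv_apply,
    Lp.toTemperedDistribution_apply, SchwartzMap.fourierInv_coe]
  have h2 := VectorFourier.integral_fourierIntegral_smul_eq_flip (μ := volume) (ν := volume)
    (L := -innerₗ (EuclideanSpace ℝ (Fin n))) (f := G) (g := u) Real.continuous_fourierChar
    (by exact (continuous_inner (𝕜 := ℝ)).neg) G.integrable hu
  refine h2.trans ?_
  have h3 : (-innerₗ (EuclideanSpace ℝ (Fin n))).flip = -innerₗ (EuclideanSpace ℝ (Fin n)) := by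
    ext x y
    simp [real_inner_comm]
  rw [h3]
  rfl

lemma memLp_expKernel {g : EuclideanSpace ℝ (Fin n) → ℂ} (hg : MemLp g 2 volume)
    (x : EuclideanSpace ℝ (Fin n)) :
    MemLp (fun ξ => conj ((Real.fourierChar (inner ℝ ξ x) : ℂ) * g ξ)) 2 volume := by
  refine hg.of_le ?_ (ae_of_all _ fun ξ => by
    rw [RCLike.norm_conj, norm_mul, Circle.norm_coe, one_mul])
  refine Complex.continuous_conj.comp_aestronglyMeasurable (AEStronglyMeasurable.mul ?_ hg.1)
  refine Continuous.aestronglyMeasurable ?_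
  fun_prop

/-- The vector in `L²` with which the frequency side is paired to evaluate `g(D)` at `x`. -/
def expKernel {g : EuclideanSpace ℝ (Fin n) → ℂ} (hg : MemLp g 2 volume)
    (x : EuclideanSpace ℝ (Fin n)) : L2 n := (memLp_expKernel hg x).toLp

/-- The exponential factor has modulus one, so the norm does not depend on `x`. This uniformity
turns square integrability of `w` into Hilbert–Schmidt bounds for `w(x) g(D)`. -/
lemma norm_expKernel {g : EuclideanSpace ℝ (Fin n) → ℂ} (hg : MemLp g 2 volume)
    (x : EuclideanSpace ℝ (Fin n)) : ‖expKernel hg x‖ = (eLpNorm g 2 volume).toReal := by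
  rw [expKernel, Lp.norm_toLp]
  congr 1
  refine eLpNorm_congr_norm_ae (ae_of_all _ fun ξ => by
    rw [RCLike.norm_conj, norm_mul, Circle.norm_coe, one_mul])

/-- As a product of two `L²` functions, `g · 𝓕 f` is integrable, and the `L²` inverse transform is
an honest integral that can be read as a scalar product. -/
lemma fourierMultiplier_ae_eq_inner {g : EuclideanSpace ℝ (Fin n) → ℂ} (hg : MemLp g 2 volume)
    (hm : MemLp g ∞ volume) (f : L2 n) :
    fourierMultiplier g hm f =ᵐ[volume] fun x => inner ℂ (expKernel hg x) (𝓕 f : L2 n) := by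
  have hint : Integrable (mulL2 g hm (𝓕 f : L2 n)) := by
    refine Integrable.congr (hg.integrable_mul (Lp.memLp (𝓕 f : L2 n))) ?_
    exact (coeFn_mulL2 g hm _).symm
  rw [fourierMultiplier_apply]
  filter_upwards [fourierInv_ae_eq_of_integrable _ hint] with x hx
  rw [hx, Real.fourierInv_eq, L2.inner_def]
  refine integral_congr_ae ?_
  filter_upwards [coeFn_mulL2 g hm (𝓕 f : L2 n), (memLp_expKernel hg x).coeFn_toLp] with ξ h1 h2
  rw [h1, expKernel, h2]
  simp [Circle.smul_def]
  ring

end Kernel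

/-! ### Operators `w(x) B` -/

section MulComp

variable {n : ℕ}

lemma norm_sq_eq_integral (f : L2 n) : ‖f‖ ^ 2 = ∫ x, ‖f x‖ ^ 2 := by
  have h : ((‖f‖ ^ 2 : ℝ) : ℂ) = ((∫ x, ‖f x‖ ^ 2 : ℝ) : ℂ) := by
    rw [← integral_complex_ofReal, Complex.ofReal_pow]
    refine (inner_self_eq_norm_sq_to_K (𝕜 := ℂ) f).symm.trans ((L2.inner_def f f).trans ?_)
    refine integral_congr_ae (ae_of_all _ fun x => ?_)
    simp only [Complex.ofReal_pow]
    exact inner_self_eq_norm_sq_to_K (𝕜 := ℂ) (f x)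
  exact_mod_cast h

/-- `w(x) B` is a bounded operator, namely `K`. -/
def IsMulComp (w : EuclideanSpace ℝ (Fin n) → ℂ) (B K : L2 n →L[ℂ] L2 n) : Prop :=
  ∀ f : L2 n, K f =ᵐ[volume] fun x => w x * B f x

lemma exists_isMulComp {w : EuclideanSpace ℝ (Fin n) → ℂ} (hw : AEStronglyMeasurable w volume)
    {B : L2 n →L[ℂ] L2 n} {C : ℝ}
    (h : ∀ f : L2 n, eLpNorm (fun x => w x * B f x) 2 volume ≤ ENNReal.ofReal (C * ‖f‖)) :
    ∃ K, IsMulComp w B K := by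
  have hmem : ∀ f : L2 n, MemLp (fun x => w x * B f x) 2 volume := fun f =>
    ⟨hw.mul (Lp.aestronglyMeasurable _), (h f).trans_lt ENNReal.ofReal_lt_top⟩
  refine ⟨LinearMap.mkContinuous
    { toFun := fun f => (hmem f).toLp
      map_add' := fun f g => ?_
      map_smul' := fun c f => ?_ } (max C 0) fun f => ?_, fun f => (hmem f).coeFn_toLp⟩
  · apply Lp.ext
    filter_upwards [(hmem (f + g)).coeFn_toLp, (hmem f).coeFn_toLp, (hmem g).coeFn_toLp,
      Lp.coeFn_add (hmem f).toLp (hmem g).toLp, Lp.coeFn_add (B f) (B g)] with x h1 h2 h3 h4 h5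
    rw [h1, h4, Pi.add_apply, h2, h3, map_add, h5, Pi.add_apply, mul_add]
  · apply Lp.ext
    filter_upwards [(hmem (c • f)).coeFn_toLp, (hmem f).coeFn_toLp,
      Lp.coeFn_smul c (hmem f).toLp, Lp.coeFn_smul c (B f)] with x h1 h2 h3 h4
    rw [h1, RingHom.id_apply, h3, Pi.smul_apply, h2, map_smul, h4, Pi.smul_apply, smul_eq_mul,
      smul_eq_mul]
    ring
  · change ‖(hmem f).toLp‖ ≤ _
    rw [Lp.norm_toLp]
    refine ENNReal.toReal_le_of_le_ofReal (by positivity) ((h f).trans ?_)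
    gcongr
    exact le_max_left _ _

lemma eLpNorm_mul_le_of_bound {w : EuclideanSpace ℝ (Fin n) → ℂ} {f : L2 n} {C : ℝ}
    (hw : ∀ᵐ x, ‖w x‖ ≤ C) :
    eLpNorm (fun x => w x * f x) 2 volume ≤ ENNReal.ofReal (C * ‖f‖) := by
  have h := eLpNorm_le_mul_eLpNorm_of_ae_le_mul (f := fun x => w x * f x) (g := f) (c := C)
    (μ := volume) (by filter_upwards [hw] with x hx; rw [norm_mul]; gcongr) 2
  refine h.trans (le_of_eq ?_)
  rw [ENNReal.ofReal_mul', Lp.norm_def, ENNReal.ofReal_toReal (Lp.eLpNorm_ne_top f)]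
  exact norm_nonneg f

/-- Cauchy–Schwarz on the frequency side gives `|g(D) f(x)| ≤ ‖g‖₂ ‖f‖₂` for almost every `x`; then
only the `L²` norm of `w` remains. -/
lemma eLpNorm_mul_fourierMultiplier_le {w g : EuclideanSpace ℝ (Fin n) → ℂ}
    (hw : MemLp w 2 volume) (hg : MemLp g 2 volume) (hm : MemLp g ∞ volume) (f : L2 n) :
    eLpNorm (fun x => w x * fourierMultiplier g hm f x) 2 volume ≤
      ENNReal.ofReal ((eLpNorm w 2 volume).toReal * (eLpNorm g 2 volume).toReal * ‖f‖) := by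
  have h := eLpNorm_le_mul_eLpNorm_of_ae_le_mul (f := fun x => w x * fourierMultiplier g hm f x)
    (g := w) (c := (eLpNorm g 2 volume).toReal * ‖f‖) (μ := volume) (by
      filter_upwards [fourierMultiplier_ae_eq_inner hg hm f] with x hx
      rw [hx, norm_mul, mul_comm]
      gcongr
      refine (norm_inner_le_norm _ _).trans ?_
      rw [norm_expKernel, Lp.norm_fourier_eq]) 2
  refine h.trans (le_of_eq ?_)
  rw [mul_comm, mul_assoc (eLpNorm w 2 volume).toReal,
    ENNReal.ofReal_mul (p := (eLpNorm w 2 volume).toReal) ENNReal.toReal_nonneg,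
    ENNReal.ofReal_toReal hw.2.ne]

/-- `w(x) g(D)` is a Hilbert–Schmidt operator for `w, g ∈ L²`. -/
lemma isCompactOperator_mul_fourierMultiplier {w g : EuclideanSpace ℝ (Fin n) → ℂ}
    (hw : MemLp w 2 volume) (hg : MemLp g 2 volume) (hm : MemLp g ∞ volume)
    {K : L2 n →L[ℂ] L2 n} (hK : IsMulComp w (fourierMultiplier g hm) K) :
    IsCompactOperator K := by
  obtain ⟨s, b, -⟩ := exists_hilbertBasis ℂ (L2 n)
  refine isCompactOperator_of_summable_norm_sq b K (summable_of_sum_le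
    (c := ∫ x, ‖w x‖ ^ 2 * (eLpNorm g 2 volume).toReal ^ 2) (fun i => by positivity) fun t => ?_)
  have hb : Orthonormal ℂ (fun i => (𝓕 (b i) : L2 n)) :=
    b.orthonormal.comp_linearIsometry
      (Lp.fourierTransformₗᵢ (EuclideanSpace ℝ (Fin n)) ℂ).toLinearIsometry
  have hint : ∀ i ∈ t, Integrable (fun x => ‖K (b i) x‖ ^ 2) := fun i _ =>
    (Lp.memLp (K (b i))).integrable_norm_pow (by norm_num)
  simp_rw [norm_sq_eq_integral]
  rw [← integral_finsetSum _ hint]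
  refine integral_mono_ae (integrable_finsetSum _ hint)
    ((hw.integrable_norm_pow (by norm_num)).mul_const _) ?_
  have h1 : ∀ᵐ x, ∀ i ∈ t, K (b i) x = w x * inner ℂ (expKernel hg x) (𝓕 (b i) : L2 n) := by
    refine (ae_ball_iff t.countable_toSet).2 fun i _ => ?_
    filter_upwards [hK (b i), fourierMultiplier_ae_eq_inner hg hm (b i)] with x h1 h2
    rw [h1, h2]
  -- For fixed `x`, Bessel's inequality for the orthonormal family `𝓕 bᵢ` bounds the sum by `|w(x)|²
  -- ‖g‖₂²`, uniformly in the finite set `t`.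
  filter_upwards [h1] with x hx
  calc ∑ i ∈ t, ‖K (b i) x‖ ^ 2
      = ‖w x‖ ^ 2 * ∑ i ∈ t, ‖inner ℂ (𝓕 (b i) : L2 n) (expKernel hg x)‖ ^ 2 := by
        rw [Finset.mul_sum]
        refine Finset.sum_congr rfl fun i hi => ?_
        rw [hx i hi, norm_mul, mul_pow, norm_inner_symm]
    _ ≤ _ := by
        gcongr
        rw [← norm_expKernel hg x]
        exact hb.sum_inner_products_le _

/-- Compactness of `w(x) B` from norm convergence of `w_N(x) B_N`. -/
lemma isCompactMulComp_of_cauchySeq {w : EuclideanSpace ℝ (Fin n) → ℂ}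
    {w' : ℕ → EuclideanSpace ℝ (Fin n) → ℂ} {B : L2 n →L[ℂ] L2 n} {B' K : ℕ → L2 n →L[ℂ] L2 n}
    (hw : ∀ x, Tendsto (fun N => w' N x) atTop (𝓝 (w x)))
    (hB : ∀ f, Tendsto (fun N => B' N f) atTop (𝓝 (B f)))
    (hK : ∀ N, IsMulComp (w' N) (B' N) (K N)) (hc : ∀ N, IsCompactOperator (K N))
    (hcau : CauchySeq K) : IsCompactMulComp w B := by
  obtain ⟨K₀, hK₀⟩ := cauchySeq_tendsto_of_complete hcau
  refine ⟨K₀, isCompactOperator_of_tendsto hK₀ (Eventually.of_forall hc), fun f => ?_⟩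
  have h1 : Tendsto (fun N => K N f) atTop (𝓝 (K₀ f)) :=
    ((ContinuousLinearMap.apply ℂ (L2 n) f).continuous.tendsto K₀).comp hK₀
  -- Convergence in `L²` is pointwise almost everywhere only along subsequences. The second one is
  -- extracted from the first, so that `B' N f` and `K N f` converge along the same indices.
  obtain ⟨φ, hφ, hφ'⟩ := (tendstoInMeasure_of_tendsto_Lp (hB f)).exists_seq_tendsto_ae
  have h2 : Tendsto (fun N => K (φ N) f) atTop (𝓝 (K₀ f)) := h1.comp hφ.tendsto_atTop
  obtain ⟨ψ, hψ, hψ'⟩ := (tendstoInMeasure_of_tendsto_Lp h2).exists_seq_tendsto_ae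
  have h3 : ∀ᵐ x, ∀ N, K N f x = w' N x * B' N f x := ae_all_iff.2 fun N => hK N f
  filter_upwards [hφ', hψ', h3] with x h4 h5 h6
  simp_rw [h6] at h5
  refine tendsto_nhds_unique h5 ?_
  have h7 := hφ.tendsto_atTop.comp hψ.tendsto_atTop
  exact ((hw x).comp h7).mul (h4.comp hψ.tendsto_atTop)

end MulComp

/-! ### Functions with power decay of the distribution function -/

section WeakDecay

variable {n : ℕ}

/-- `|{|w| > l}|` is finite for `l > 0` and at most `C l^{-q}` for `l ≥ 1`. -/
structure WeakDecay (q : ℝ) (w : EuclideanSpace ℝ (Fin n) → ℂ) : Prop where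
  meas : AEStronglyMeasurable w volume
  finite : ∀ l : ℝ, 0 < l → volume {x | l < ‖w x‖} < ∞
  tail : ∃ C : ℝ, 0 ≤ C ∧ ∀ l : ℝ, 1 ≤ l → volume {x | l < ‖w x‖} ≤ ENNReal.ofReal (C * l ^ (-q))

/-- The part of `w` where `|w| > l`. -/
def largePart (l : ℝ) (w : EuclideanSpace ℝ (Fin n) → ℂ) : EuclideanSpace ℝ (Fin n) → ℂ :=
  {x | l < ‖w x‖}.indicator w

lemma norm_largePart_sub_le {l l' : ℝ} (hl : 0 ≤ l') (h : l ≤ l')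
    (w : EuclideanSpace ℝ (Fin n) → ℂ) (x : EuclideanSpace ℝ (Fin n)) :
    ‖largePart l w x - largePart l' w x‖ ≤ l' := by
  by_cases h1 : l' < ‖w x‖
  · have h2 : l < ‖w x‖ := h.trans_lt h1
    simp [largePart, h1, h2, hl]
  · by_cases h2 : l < ‖w x‖
    · simpa [largePart, h1, h2] using not_lt.1 h1
    · simp [largePart, h1, h2, hl]

lemma aestronglyMeasurable_largePart {w : EuclideanSpace ℝ (Fin n) → ℂ}
    (hw : AEStronglyMeasurable w volume) (l : ℝ) :
    AEStronglyMeasurable (largePart l w) volume := by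
  refine AEStronglyMeasurable.indicator₀ hw ?_
  exact nullMeasurableSet_lt aemeasurable_const hw.norm.aemeasurable

/-- Dyadic layer decomposition: where `2^j l < |w| ≤ 2^{j+1} l` the integrand is at most `4 · 4^j
l²`, on a set of measure `O((2^j l)^{-q})`. The resulting series is geometric with ratio `2^{2-q} <
1`. -/
lemma WeakDecay.exists_lintegral_largePart_le {q : ℝ} (hq : 2 < q)
    {w : EuclideanSpace ℝ (Fin n) → ℂ} (hw : WeakDecay q w) :
    ∃ C : ℝ, 0 ≤ C ∧ ∀ l : ℝ, 1 ≤ l →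
      ∫⁻ x, ‖largePart l w x‖ₑ ^ 2 ≤ ENNReal.ofReal (C * l ^ (2 - q)) := by
  obtain ⟨C, hC, htail⟩ := hw.tail
  set r : ℝ := 2 ^ (2 - q) with hr
  have hr0 : 0 < r := by positivity
  have hr1 : r < 1 := Real.rpow_lt_one_of_one_lt_of_neg (by norm_num) (by linarith)
  refine ⟨4 * C * (1 - r)⁻¹, by have := sub_pos.2 hr1; positivity, fun l hl => ?_⟩
  have hl0 : 0 < l := by linarith
  have hpt : ∀ x, ‖largePart l w x‖ₑ ^ 2 ≤
      ∑' j : ℕ, {x | 2 ^ j * l < ‖w x‖}.indicator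
        (fun _ => ENNReal.ofReal ((2 ^ (j + 1) * l) ^ 2)) x := fun x => by
    by_cases hx : l < ‖w x‖
    · obtain ⟨k, hk1, hk2⟩ := exists_mem_Ioc_zpow (x := ‖w x‖ / l) (y := (2 : ℝ))
        (div_pos (by linarith) hl0) (by norm_num)
      have hk0 : 0 ≤ k := by
        by_contra hk
        have h1 : (2 : ℝ) ^ (k + 1) ≤ 2 ^ (0 : ℤ) := zpow_le_zpow_right₀ (by norm_num) (by omega)
        have h2 : 1 < ‖w x‖ / l := (one_lt_div hl0).2 hx
        simp only [zpow_zero] at h1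
        linarith
      obtain ⟨j, rfl⟩ := Int.eq_ofNat_of_zero_le hk0
      rw [lt_div_iff₀ hl0] at hk1
      rw [div_le_iff₀ hl0] at hk2
      have hk1' : 2 ^ j * l < ‖w x‖ := by exact_mod_cast hk1
      have hk2' : ‖w x‖ ≤ 2 ^ (j + 1) * l := by exact_mod_cast hk2
      refine le_trans ?_ (ENNReal.le_tsum j)
      rw [Set.indicator_of_mem (by exact hk1'), largePart, Set.indicator_of_mem (by exact hx),
        ENNReal.ofReal_pow (by positivity)]
      gcongr
      rw [← ofReal_norm]
      exact ENNReal.ofReal_le_ofReal hk2'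
    · simp [largePart, hx]
  have hms : ∀ j : ℕ, NullMeasurableSet {x | 2 ^ j * l < ‖w x‖} volume := fun j =>
    nullMeasurableSet_lt aemeasurable_const hw.meas.norm.aemeasurable
  calc ∫⁻ x, ‖largePart l w x‖ₑ ^ 2
      ≤ ∫⁻ x, ∑' j : ℕ, {x | 2 ^ j * l < ‖w x‖}.indicator
        (fun _ => ENNReal.ofReal ((2 ^ (j + 1) * l) ^ 2)) x := lintegral_mono hpt
    _ = ∑' j : ℕ, ENNReal.ofReal ((2 ^ (j + 1) * l) ^ 2) * volume {x | 2 ^ j * l < ‖w x‖} := by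
        rw [lintegral_tsum fun j => aemeasurable_const.indicator₀ (hms j)]
        refine tsum_congr fun j => ?_
        rw [lintegral_indicator₀ (hms j), setLIntegral_const]
    _ ≤ ∑' j : ℕ, ENNReal.ofReal (4 * C * l ^ (2 - q) * r ^ j) := by
        refine ENNReal.tsum_le_tsum fun j => ?_
        have hj : 1 ≤ 2 ^ j * l := one_le_mul_of_one_le_of_one_le (one_le_pow₀ (by norm_num)) hl
        refine (mul_le_mul_right (htail _ hj) _).trans ?_
        rw [← ENNReal.ofReal_mul (by positivity)]
        refine ENNReal.ofReal_le_ofReal (le_of_eq ?_)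
        have e1 : ((2 : ℝ) ^ j * l) ^ (-q) = ((2 : ℝ) ^ j * l) ^ (2 - q) / ((2 : ℝ) ^ j * l) ^ 2 := by
          rw [← Real.rpow_natCast _ 2, ← Real.rpow_sub (by positivity)]
          congr 1
          push_cast
          ring
        have e2 : ((2 : ℝ) ^ j * l) ^ (2 - q) = r ^ j * l ^ (2 - q) := by
          rw [Real.mul_rpow (by positivity) hl0.le, hr, ← Real.rpow_natCast, ← Real.rpow_natCast,
            ← Real.rpow_mul (by norm_num), ← Real.rpow_mul (by norm_num), mul_comm (j : ℝ)]
        rw [e1, e2, pow_succ]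
        have : (2 : ℝ) ^ j * l ≠ 0 := by positivity
        field_simp
        ring
    _ = ENNReal.ofReal (4 * C * (1 - r)⁻¹ * l ^ (2 - q)) := by
        rw [← ENNReal.ofReal_tsum_of_nonneg (fun j => by positivity)
          ((summable_geometric_of_lt_one hr0.le hr1).mul_left _), tsum_mul_left,
          tsum_geometric_of_lt_one hr0.le hr1]
        congr 1
        ring

lemma eLpNorm_two_le {f : EuclideanSpace ℝ (Fin n) → ℂ} {c : ℝ} (hc : 0 ≤ c)
    (h : ∫⁻ x, ‖f x‖ₑ ^ 2 ≤ ENNReal.ofReal (c ^ 2)) : eLpNorm f 2 volume ≤ ENNReal.ofReal c := by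
  rw [eLpNorm_eq_lintegral_rpow_enorm_toReal (by norm_num) (by norm_num)]
  simp only [ENNReal.toReal_ofNat, ENNReal.rpow_ofNat, one_div]
  rw [ENNReal.rpow_inv_le_iff (by norm_num), ENNReal.rpow_ofNat, ← ENNReal.ofReal_pow hc]
  exact h

lemma WeakDecay.exists_eLpNorm_largePart_le {q : ℝ} (hq : 2 < q)
    {w : EuclideanSpace ℝ (Fin n) → ℂ} (hw : WeakDecay q w) :
    ∃ C : ℝ, 0 ≤ C ∧ ∀ l : ℝ, 1 ≤ l →
      eLpNorm (largePart l w) 2 volume ≤ ENNReal.ofReal (C * l ^ (1 - q / 2)) := by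
  obtain ⟨C, hC, h⟩ := hw.exists_lintegral_largePart_le hq
  refine ⟨√C, Real.sqrt_nonneg _, fun l hl => eLpNorm_two_le (by positivity) ?_⟩
  refine (h l hl).trans (le_of_eq ?_)
  rw [mul_pow, Real.sq_sqrt hC, ← Real.rpow_natCast (l ^ _), ← Real.rpow_mul (by linarith)]
  congr 3
  push_cast
  ring

/-- The tail bound handles the values above `1`. Values between `l` and `1` are dominated by the
indicator of `{|w| > l}`, which has finite measure. -/
lemma WeakDecay.memLp_largePart {q : ℝ} (hq : 2 < q)
    {w : EuclideanSpace ℝ (Fin n) → ℂ} (hw : WeakDecay q w) {l : ℝ} (hl : 0 < l) :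
    MemLp (largePart l w) 2 volume := by
  obtain ⟨C, hC, h⟩ := hw.exists_eLpNorm_largePart_le hq
  have h1 : MemLp (largePart 1 w) 2 volume :=
    ⟨aestronglyMeasurable_largePart hw.meas 1, (h 1 le_rfl).trans_lt ENNReal.ofReal_lt_top⟩
  have hms : NullMeasurableSet {x | l < ‖w x‖} volume :=
    nullMeasurableSet_lt aemeasurable_const hw.meas.norm.aemeasurable
  have h2 : MemLp ({x | l < ‖w x‖}.indicator fun _ => (1 : ℝ)) 2 volume := by
    have h3 := memLp_indicator_const (μ := volume) 2 (measurableSet_toMeasurable volume {x | l < ‖w x‖})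
      (1 : ℝ) (Or.inr (by rw [measure_toMeasurable]; exact (hw.finite l hl).ne))
    exact h3.ae_eq (indicator_ae_eq_of_ae_eq_set hms.toMeasurable_ae_eq)
  refine (h1.norm.add h2).of_le (aestronglyMeasurable_largePart hw.meas l)
    (ae_of_all _ fun x => ?_)
  rw [Pi.add_apply]
  refine le_trans ?_ (le_abs_self _)
  by_cases h3 : l < ‖w x‖
  · by_cases h4 : 1 < ‖w x‖
    · simp [largePart, h3, h4]
    · have := not_lt.1 h4
      simp [largePart, h3, h4, this]
  · by_cases h4 : 1 < ‖w x‖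
    · simp [largePart, h3, h4]
    · simp [largePart, h3, h4]

lemma tendsto_largePart (w : EuclideanSpace ℝ (Fin n) → ℂ) (x : EuclideanSpace ℝ (Fin n)) :
    Tendsto (fun N : ℕ => largePart ((1 / 2 : ℝ) ^ N) w x) atTop (𝓝 (w x)) := by
  by_cases hx : w x = 0
  · have : ∀ N : ℕ, largePart ((1 / 2 : ℝ) ^ N) w x = w x := fun N => by
      simp [largePart, hx]
    simp_rw [this]
    exact tendsto_const_nhds
  · have h1 := (tendsto_pow_atTop_nhds_zero_of_lt_one (r := (1 / 2 : ℝ)) (by norm_num)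
      (by norm_num)).eventually_lt_const (norm_pos_iff.2 hx)
    refine tendsto_const_nhds.congr' ?_
    filter_upwards [h1] with N hN
    rw [largePart, Set.indicator_of_mem (by exact hN)]

end WeakDecay

/-! ### Compactness of `w ⟨D⟩^{-s}` -/

section JapaneseCompact

variable {n : ℕ}

lemma norm_japaneseSymbol_le_one (s : ℝ≥0) (ξ : EuclideanSpace ℝ (Fin n)) :
    ‖japaneseSymbol n s ξ‖ ≤ 1 := by
  have h := one_le_japanese ξ
  rw [japaneseSymbol, Complex.norm_real, Real.norm_of_nonneg (by positivity)]
  exact Real.rpow_le_one_of_one_le_of_nonpos h (by have := s.coe_nonneg; linarith)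

lemma norm_japaneseSymbol_le_rpow (s : ℝ≥0) {ξ : EuclideanSpace ℝ (Fin n)} {R : ℝ} (hR : 0 < R)
    (hξ : R ≤ ‖ξ‖) : ‖japaneseSymbol n s ξ‖ ≤ R ^ (-(s : ℝ)) := by
  have h := one_le_japanese ξ
  have hs := s.coe_nonneg
  rw [japaneseSymbol, Complex.norm_real, Real.norm_of_nonneg (by positivity)]
  have h1 : R ^ 2 ≤ 1 + (2 * Real.pi * ‖ξ‖) ^ 2 := by
    have h2 : R ≤ 2 * Real.pi * ‖ξ‖ := by nlinarith [Real.pi_gt_three]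
    nlinarith
  calc (1 + (2 * Real.pi * ‖ξ‖) ^ 2) ^ (-(s : ℝ) / 2) ≤ (R ^ 2) ^ (-(s : ℝ) / 2) :=
        Real.rpow_le_rpow_of_nonpos (by positivity) h1 (by linarith)
    _ = R ^ (-(s : ℝ)) := by
        rw [← Real.rpow_natCast, ← Real.rpow_mul hR.le]
        congr 1
        push_cast
        ring

/-- The symbol of `⟨D⟩^{-s}` cut off to `|ξ| < 2^N`. -/
def cutSymbol (n : ℕ) (s : ℝ≥0) (N : ℕ) : EuclideanSpace ℝ (Fin n) → ℂ :=
  (Metric.ball 0 (2 ^ N)).indicator (japaneseSymbol n s)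

lemma memLp_cutSymbol (s : ℝ≥0) (N : ℕ) : MemLp (cutSymbol n s N) ∞ volume :=
  (memLp_japaneseSymbol n s).indicator measurableSet_ball

lemma memLp_two_cutSymbol (s : ℝ≥0) (N : ℕ) : MemLp (cutSymbol n s N) 2 volume := by
  have h := memLp_indicator_const (μ := volume) 2
    (measurableSet_ball (x := (0 : EuclideanSpace ℝ (Fin n))) (ε := 2 ^ N)) (1 : ℝ)
    (Or.inr measure_ball_lt_top.ne)
  refine h.of_le (memLp_cutSymbol s N).1 (ae_of_all _ fun ξ => ?_)
  by_cases hξ : ξ ∈ Metric.ball (0 : EuclideanSpace ℝ (Fin n)) (2 ^ N)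
  · simpa [cutSymbol, hξ] using norm_japaneseSymbol_le_one s ξ
  · simp [cutSymbol, hξ]

lemma norm_cutSymbol_sub_le (s : ℝ≥0) (N : ℕ) (ξ : EuclideanSpace ℝ (Fin n)) :
    ‖(cutSymbol n s (N + 1) - cutSymbol n s N) ξ‖ ≤
      (Metric.ball (0 : EuclideanSpace ℝ (Fin n)) (2 ^ (N + 1))).indicator
        (fun _ => ((2 : ℝ) ^ N) ^ (-(s : ℝ))) ξ := by
  have hN : (2 : ℝ) ^ N ≤ 2 ^ (N + 1) := pow_le_pow_right₀ (by norm_num) (by omega)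
  have hpos : (0 : ℝ) ≤ ((2 : ℝ) ^ N) ^ (-(s : ℝ)) := by positivity
  rw [Pi.sub_apply, cutSymbol, cutSymbol]
  by_cases h1 : ξ ∈ Metric.ball (0 : EuclideanSpace ℝ (Fin n)) (2 ^ (N + 1))
  · by_cases h2 : ξ ∈ Metric.ball (0 : EuclideanSpace ℝ (Fin n)) (2 ^ N)
    · simp [Set.indicator_of_mem h1, Set.indicator_of_mem h2, hpos]
    · rw [Set.indicator_of_mem h1, Set.indicator_of_notMem h2, Set.indicator_of_mem h1, sub_zero]
      refine norm_japaneseSymbol_le_rpow s (by positivity) ?_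
      simpa using h2
  · have h2 : ξ ∉ Metric.ball (0 : EuclideanSpace ℝ (Fin n)) (2 ^ N) :=
      fun h => h1 (Metric.ball_subset_ball hN h)
    simp [Set.indicator_of_notMem h1, Set.indicator_of_notMem h2]

lemma norm_cutSymbol_sub_le_rpow (s : ℝ≥0) (N : ℕ) (ξ : EuclideanSpace ℝ (Fin n)) :
    ‖(cutSymbol n s (N + 1) - cutSymbol n s N) ξ‖ ≤ ((2 : ℝ) ^ N) ^ (-(s : ℝ)) :=
  (norm_cutSymbol_sub_le s N ξ).trans (Set.indicator_le_self' (fun _ _ => by positivity) ξ)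

/-- The difference has size at most `2^{-Ns}` and is supported in a ball of volume comparable to
`2^{Nn}`. -/
lemma exists_eLpNorm_cutSymbol_sub_le (s : ℝ≥0) : ∃ C : ℝ, 0 ≤ C ∧ ∀ N : ℕ,
    eLpNorm (cutSymbol n s (N + 1) - cutSymbol n s N) 2 volume ≤
      ENNReal.ofReal (C * ((2 : ℝ) ^ N) ^ ((n : ℝ) / 2 - s)) := by
  set v : ℝ := (volume (Metric.ball (0 : EuclideanSpace ℝ (Fin n)) 1)).toReal with hv
  refine ⟨√(2 ^ n * v), Real.sqrt_nonneg _, fun N => eLpNorm_two_le (by positivity) ?_⟩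
  have hvol : volume (Metric.ball (0 : EuclideanSpace ℝ (Fin n)) (2 ^ (N + 1))) =
      ENNReal.ofReal ((2 ^ (N + 1)) ^ n * v) := by
    rw [Measure.addHaar_ball_of_pos _ _ (by positivity), finrank_euclideanSpace_fin,
      ENNReal.ofReal_mul (by positivity), hv, ENNReal.ofReal_toReal measure_ball_lt_top.ne]
  calc ∫⁻ ξ, ‖(cutSymbol n s (N + 1) - cutSymbol n s N) ξ‖ₑ ^ 2
      ≤ ∫⁻ ξ, (Metric.ball (0 : EuclideanSpace ℝ (Fin n)) (2 ^ (N + 1))).indicator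
        (fun _ => ENNReal.ofReal ((((2 : ℝ) ^ N) ^ (-(s : ℝ))) ^ 2)) ξ := by
        refine lintegral_mono fun ξ => ?_
        have h := norm_cutSymbol_sub_le s N ξ
        by_cases h1 : ξ ∈ Metric.ball (0 : EuclideanSpace ℝ (Fin n)) (2 ^ (N + 1))
        · rw [Set.indicator_of_mem h1] at h ⊢
          rw [ENNReal.ofReal_pow (by positivity), ← ofReal_norm]
          gcongr
        · rw [Set.indicator_of_notMem h1] at h ⊢
          have h2 := norm_le_zero_iff.1 h
          simp [h2]
    _ = ENNReal.ofReal ((((2 : ℝ) ^ N) ^ (-(s : ℝ))) ^ 2 * ((2 ^ (N + 1)) ^ n * v)) := by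
        rw [lintegral_indicator measurableSet_ball, setLIntegral_const, hvol,
          ← ENNReal.ofReal_mul (by positivity)]
    _ = _ := by
        congr 1
        rw [mul_pow, Real.sq_sqrt (by positivity), sub_eq_neg_add, Real.rpow_add (by positivity),
          mul_pow, ← Real.rpow_natCast (((2 : ℝ) ^ N) ^ ((n : ℝ) / 2)), ← Real.rpow_mul (by positivity)]
        have : (n : ℝ) / 2 * ((2 : ℕ) : ℝ) = (n : ℕ) := by push_cast; ring
        rw [this, Real.rpow_natCast, pow_succ (2 : ℝ) N, mul_pow]
        ring

lemma tendsto_fourierMultiplier_cutSymbol {s : ℝ≥0} (hs : 0 < s) (f : L2 n) :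
    Tendsto (fun N => fourierMultiplier (cutSymbol n s N) (memLp_cutSymbol s N) f) atTop
      (𝓝 (japaneseD n s f)) := by
  rw [tendsto_iff_norm_sub_tendsto_zero]
  have h0 : Tendsto (fun N : ℕ => ((2 : ℝ) ^ N) ^ (-(s : ℝ)) * ‖f‖) atTop (𝓝 0) := by
    have h1 := (tendsto_rpow_neg_atTop (y := (s : ℝ)) (by exact_mod_cast hs)).comp
      (tendsto_pow_atTop_atTop_of_one_lt (r := (2 : ℝ)) (by norm_num))
    simpa using h1.mul_const ‖f‖
  refine squeeze_zero (fun _ => norm_nonneg _) (fun N => ?_) h0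
  rw [japaneseD, ← fourierMultiplier_sub]
  refine norm_fourierMultiplier_le _ (ae_of_all _ fun ξ => ?_) f
  rw [Pi.sub_apply, cutSymbol]
  by_cases h1 : ξ ∈ Metric.ball (0 : EuclideanSpace ℝ (Fin n)) (2 ^ N)
  · rw [Set.indicator_of_mem h1, sub_self, norm_zero]
    positivity
  · rw [Set.indicator_of_notMem h1, zero_sub, norm_neg]
    exact norm_japaneseSymbol_le_rpow s (by positivity) (by simpa using h1)

/-- One dyadic step in the construction of `w ⟨D⟩^{-s}`. -/
lemma eLpNorm_dyadic_step_le {q : ℝ} (hq : 2 < q) {s : ℝ≥0}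
    {w : EuclideanSpace ℝ (Fin n) → ℂ} (hw : WeakDecay q w) :
    ∃ C : ℝ, 0 ≤ C ∧ ∀ (N : ℕ) (l : ℝ), 0 < l → l ≤ 1 → ∀ f : L2 n,
      eLpNorm (fun x => largePart l w x *
        fourierMultiplier (cutSymbol n s (N + 1) - cutSymbol n s N)
          ((memLp_cutSymbol s (N + 1)).sub (memLp_cutSymbol s N)) f x) 2 volume ≤
      ENNReal.ofReal (C * ((2 : ℝ) ^ ((n : ℝ) / q - s)) ^ N * ‖f‖) := by
  obtain ⟨A, hA, hA'⟩ := hw.exists_eLpNorm_largePart_le hq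
  obtain ⟨D, hD, hD'⟩ := exists_eLpNorm_cutSymbol_sub_le (n := n) s
  refine ⟨A * D + 1, by positivity, fun N l hl hl1 f => ?_⟩
  set d := cutSymbol n s (N + 1) - cutSymbol n s N with hd
  have hd2 : MemLp d 2 volume := (memLp_two_cutSymbol s (N + 1)).sub (memLp_two_cutSymbol s N)
  have hdi : MemLp d ∞ volume := (memLp_cutSymbol s (N + 1)).sub (memLp_cutSymbol s N)
  -- This height balances the two estimates: above it the Hilbert–Schmidt bound is of order
  -- `L^{1-q/2} 2^{N(n/2-s)}`, below it the supremum bound is `L 2^{-Ns}`. Both powers equal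
  -- `2^{N(n/q-s)}`.
  set L : ℝ := ((2 : ℝ) ^ N) ^ ((n : ℝ) / q) with hL
  have h2N : (1 : ℝ) ≤ 2 ^ N := one_le_pow₀ (by norm_num)
  have hL1 : 1 ≤ L := Real.one_le_rpow h2N (by positivity)
  set r : ℝ := ((2 : ℝ) ^ ((n : ℝ) / q - s)) ^ N with hr
  have hr' : r = ((2 : ℝ) ^ N) ^ ((n : ℝ) / q - s) := by
    rw [hr, ← Real.rpow_natCast, ← Real.rpow_natCast, ← Real.rpow_mul (by norm_num),
      ← Real.rpow_mul (by norm_num), mul_comm]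
  have hbig := eLpNorm_mul_fourierMultiplier_le (hw.memLp_largePart hq (by linarith : 0 < L)) hd2
    hdi f
  have hsmall := eLpNorm_mul_le_of_bound (w := fun x => largePart l w x - largePart L w x)
    (f := fourierMultiplier d hdi f) (ae_of_all _ fun x =>
      norm_largePart_sub_le (by linarith) (hl1.trans hL1) w x)
  have hms : AEStronglyMeasurable (fourierMultiplier d hdi f) volume := Lp.aestronglyMeasurable _
  have e0 : (fun x => largePart l w x * fourierMultiplier d hdi f x) =
      (fun x => largePart L w x * fourierMultiplier d hdi f x) +
      fun x => (largePart l w x - largePart L w x) * fourierMultiplier d hdi f x := by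
    ext x
    simp only [Pi.add_apply]
    ring
  rw [e0]
  refine (eLpNorm_add_le ((aestronglyMeasurable_largePart hw.meas L).mul hms)
    (((aestronglyMeasurable_largePart hw.meas l).sub
      (aestronglyMeasurable_largePart hw.meas L)).mul hms) (by norm_num)).trans ?_
  refine (add_le_add hbig hsmall).trans ?_
  rw [← ENNReal.ofReal_add (by positivity) (by positivity)]
  refine ENNReal.ofReal_le_ofReal ?_
  have b1 : (eLpNorm (largePart L w) 2 volume).toReal ≤ A * L ^ (1 - q / 2) :=
    ENNReal.toReal_le_of_le_ofReal (by positivity) (hA' L hL1)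
  have b2 : (eLpNorm d 2 volume).toReal ≤ D * ((2 : ℝ) ^ N) ^ ((n : ℝ) / 2 - s) :=
    ENNReal.toReal_le_of_le_ofReal (by positivity) (hD' N)
  have b3 : ‖fourierMultiplier d hdi f‖ ≤ ((2 : ℝ) ^ N) ^ (-(s : ℝ)) * ‖f‖ :=
    norm_fourierMultiplier_le hdi (ae_of_all _ fun ξ => norm_cutSymbol_sub_le_rpow s N ξ) f
  have e1 : L ^ (1 - q / 2) * ((2 : ℝ) ^ N) ^ ((n : ℝ) / 2 - s) = r := by
    rw [hr', hL, ← Real.rpow_mul (by positivity), ← Real.rpow_add (by positivity)]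
    congr 1
    have : q ≠ 0 := by linarith
    field_simp
    ring
  have e2 : L * ((2 : ℝ) ^ N) ^ (-(s : ℝ)) = r := by
    rw [hr', hL, ← Real.rpow_add (by positivity), sub_eq_add_neg]
  calc _ ≤ A * L ^ (1 - q / 2) * (D * ((2 : ℝ) ^ N) ^ ((n : ℝ) / 2 - s)) * ‖f‖ +
        L * (((2 : ℝ) ^ N) ^ (-(s : ℝ)) * ‖f‖) := by gcongr
    _ = A * D * (L ^ (1 - q / 2) * ((2 : ℝ) ^ N) ^ ((n : ℝ) / 2 - s)) * ‖f‖ +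
        (L * ((2 : ℝ) ^ N) ^ (-(s : ℝ))) * ‖f‖ := by ring
    _ = (A * D + 1) * r * ‖f‖ := by rw [e1, e2]; ring

/-- `w ⟨D⟩^{-s}` is compact if the distribution function of `w` decays like `l^{-q}`, `q > n/s`. -/
theorem isCompactMulComp_japaneseD {q : ℝ} (hq : 2 < q) {s : ℝ≥0} (hs : (n : ℝ) / q < s)
    {w : EuclideanSpace ℝ (Fin n) → ℂ} (hw : WeakDecay q w) :
    IsCompactMulComp w (japaneseD n s) := by
  have hs0 : 0 < s := by
    have : (0 : ℝ) < s := lt_of_le_of_lt (by positivity) hs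
    exact_mod_cast this
  obtain ⟨C, hC, hstep⟩ := eLpNorm_dyadic_step_le hq (s := s) hw
  have hpos : ∀ N : ℕ, (0 : ℝ) < (1 / 2) ^ N := fun N => by positivity
  have hex : ∀ N : ℕ, ∃ K, IsMulComp (largePart ((1 / 2 : ℝ) ^ N) w)
      (fourierMultiplier (cutSymbol n s N) (memLp_cutSymbol s N)) K := fun N =>
    exists_isMulComp (aestronglyMeasurable_largePart hw.meas _) fun f =>
      eLpNorm_mul_fourierMultiplier_le (hw.memLp_largePart hq (hpos N)) (memLp_two_cutSymbol s N)
        (memLp_cutSymbol s N) f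
  choose K hK using hex
  refine isCompactMulComp_of_cauchySeq (tendsto_largePart w)
    (tendsto_fourierMultiplier_cutSymbol hs0) hK (fun N =>
      isCompactOperator_mul_fourierMultiplier (hw.memLp_largePart hq (hpos N))
        (memLp_two_cutSymbol s N) (memLp_cutSymbol s N) (hK N)) ?_
  -- Passing from `N` to `N + 1` adds a new frequency shell, of cost `2^{N(n/q-s)}`, and a new layer
  -- of `w` with values at most `2^{-N}`, of cost `2^{-N}`. The ratio `ρ` dominates both.
  set ρ : ℝ := max (1 / 2) (2 ^ ((n : ℝ) / q - s)) with hρ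
  have hρ1 : ρ < 1 := max_lt (by norm_num)
    (Real.rpow_lt_one_of_one_lt_of_neg (by norm_num) (by linarith))
  have hρ0 : 0 < ρ := lt_of_lt_of_le (by norm_num) (le_max_left _ _)
  refine cauchySeq_of_le_geometric ρ (C + 1) hρ1 fun N => ?_
  rw [dist_comm, dist_eq_norm]
  refine ContinuousLinearMap.opNorm_le_bound _ (by positivity) fun f => ?_
  rw [Lp.norm_def]
  refine ENNReal.toReal_le_of_le_ofReal (by positivity) ?_
  set m := (1 / 2 : ℝ) ^ (N + 1) with hm
  have hm1 : m ≤ (1 / 2) ^ N := pow_le_pow_of_le_one (by norm_num) (by norm_num) (by omega)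
  have hm2 : m ≤ 1 := pow_le_one₀ (by norm_num) (by norm_num)
  have h1 := hstep N m (hpos _) hm2 f
  have h2 := eLpNorm_mul_le_of_bound
    (w := fun x => largePart m w x - largePart ((1 / 2 : ℝ) ^ N) w x)
    (f := fourierMultiplier (cutSymbol n s N) (memLp_cutSymbol s N) f) (ae_of_all _ fun x =>
      norm_largePart_sub_le (by positivity) hm1 w x)
  have h3 : ‖fourierMultiplier (cutSymbol n s N) (memLp_cutSymbol s N) f‖ ≤ 1 * ‖f‖ := by
    refine norm_fourierMultiplier_le _ (ae_of_all _ fun ξ => ?_) f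
    exact (norm_indicator_le_norm_self _ _).trans (norm_japaneseSymbol_le_one s ξ)
  have h4 : (K (N + 1) - K N) f =ᵐ[volume]
      (fun x => largePart m w x *
        fourierMultiplier (cutSymbol n s (N + 1) - cutSymbol n s N)
          ((memLp_cutSymbol s (N + 1)).sub (memLp_cutSymbol s N)) f x) +
      fun x => (largePart m w x - largePart ((1 / 2 : ℝ) ^ N) w x) *
        fourierMultiplier (cutSymbol n s N) (memLp_cutSymbol s N) f x := by
    rw [fourierMultiplier_sub (memLp_cutSymbol s (N + 1)) (memLp_cutSymbol s N), sub_apply]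
    filter_upwards [hK (N + 1) f, hK N f, Lp.coeFn_sub (K (N + 1) f) (K N f),
      Lp.coeFn_sub (fourierMultiplier _ (memLp_cutSymbol s (N + 1)) f)
        (fourierMultiplier _ (memLp_cutSymbol s N) f)] with x g1 g2 g3 g4
    rw [g3, Pi.sub_apply, g1, g2, Pi.add_apply, g4, Pi.sub_apply]
    ring
  have hms : ∀ l, AEStronglyMeasurable (largePart l w) volume := fun l =>
    aestronglyMeasurable_largePart hw.meas l
  rw [eLpNorm_congr_ae h4]
  refine (eLpNorm_add_le ((hms _).mul (Lp.aestronglyMeasurable _))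
    (((hms _).sub (hms _)).mul (Lp.aestronglyMeasurable _)) (by norm_num)).trans
    ((add_le_add h1 h2).trans ?_)
  rw [← ENNReal.ofReal_add (by positivity) (by positivity)]
  refine ENNReal.ofReal_le_ofReal ?_
  have b1 : ((2 : ℝ) ^ ((n : ℝ) / q - s)) ^ N ≤ ρ ^ N :=
    pow_le_pow_left₀ (by positivity) (le_max_right _ _) N
  have b2 : ((1 : ℝ) / 2) ^ N ≤ ρ ^ N := pow_le_pow_left₀ (by positivity) (le_max_left _ _) N
  rw [one_mul] at h3
  calc _ ≤ C * ρ ^ N * ‖f‖ + ρ ^ N * ‖f‖ := by gcongr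
    _ = _ := by ring

end JapaneseCompact

/-! ### Weak Lebesgue spaces and decay of the distribution function -/

section WeakLp

variable {n : ℕ}

lemma volume_le_of_weakNorm_lt {p A : ℝ≥0∞} {f : EuclideanSpace ℝ (Fin n) → ℂ}
    (hA : weakNorm p f ≤ A) {t : ℝ≥0} (ht : 0 < t) {l : ℝ}
    (h : A < (t : ℝ≥0∞) ^ (p⁻¹).toReal * ENNReal.ofReal l) : volume {x | l < ‖f x‖} ≤ t := by
  have h1 : (t : ℝ≥0∞) ^ (p⁻¹).toReal * decRearr f t ≤ A := by
    refine le_trans ?_ hA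
    exact le_iSup₂ (f := fun (t : ℝ≥0) (_ : 0 < t) =>
      (t : ℝ≥0∞) ^ (p⁻¹).toReal * decRearr f t) t ht
  have h2 : decRearr f t < ENNReal.ofReal l := by
    by_contra hcon
    exact absurd (h.trans_le ((mul_le_mul_right (not_lt.1 hcon) _).trans h1)) (lt_irrefl _)
  obtain ⟨α, hα, hαl⟩ := sInf_lt_iff.1 h2
  refine (measure_mono fun x hx => ?_).trans hα
  have hx' : l < ‖f x‖ := hx
  have h3 : ENNReal.ofReal l ≤ ‖f x‖ₑ := by
    rw [← ofReal_norm]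
    exact ENNReal.ofReal_le_ofReal hx'.le
  exact hαl.trans_le h3

/-- This is the usual equivalence of rearrangement and distribution function: a value of `t` with
`t^{1/p} l > A` forces `f*(t) < l`. -/
lemma volume_le_rpow_of_weakNorm_le {p : ℝ≥0∞} (hp0 : p ≠ 0) (hp : p ≠ ∞)
    {f : EuclideanSpace ℝ (Fin n) → ℂ}
    {A : ℝ} (hA0 : 0 ≤ A) (hA : weakNorm p f ≤ ENNReal.ofReal A) {l : ℝ} (hl : 0 < l) :
    volume {x | l < ‖f x‖} ≤ ENNReal.ofReal (A ^ p.toReal * l ^ (-p.toReal)) := by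
  have hP : 0 < p.toReal := ENNReal.toReal_pos hp0 hp
  -- The infimum defining `f*` need not be attained at `l`, so `t` is taken strictly above the
  -- claimed bound and then lowered to it.
  refine le_of_forall_gt fun b hb => ?_
  obtain ⟨t, ht1, ht2⟩ := ENNReal.lt_iff_exists_nnreal_btwn.1 hb
  refine lt_of_le_of_lt (volume_le_of_weakNorm_lt hA (t := t) ?_ ?_) ht2
  · have := lt_of_le_of_lt (zero_le) ht1
    exact_mod_cast this
  · have h1 : A ^ p.toReal * l ^ (-p.toReal) < (t : ℝ) := by
      rw [← ENNReal.ofReal_coe_nnreal] at ht1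
      exact (ENNReal.ofReal_lt_ofReal_iff_of_nonneg (by positivity)).1 ht1
    have h2 : A / l < (t : ℝ) ^ (p.toReal)⁻¹ := by
      rw [Real.lt_rpow_inv_iff_of_pos (by positivity) (by positivity) hP,
        Real.div_rpow hA0 hl.le, div_eq_mul_inv, ← Real.rpow_neg hl.le]
      exact h1
    rw [ENNReal.toReal_inv, ← ENNReal.ofReal_coe_nnreal, ENNReal.ofReal_rpow_of_nonneg t.coe_nonneg (by positivity),
      ← ENNReal.ofReal_mul (by positivity)]
    refine (ENNReal.ofReal_lt_ofReal_iff_of_nonneg hA0).2 ?_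
    rwa [div_lt_iff₀ hl] at h2

lemma volume_eq_zero_of_weakNorm_top_lt {f : EuclideanSpace ℝ (Fin n) → ℂ}
    {l : ℝ} (hA : weakNorm ∞ f < ENNReal.ofReal l) :
    volume {x | l < ‖f x‖} = 0 := by
  refine le_antisymm (le_of_forall_gt fun b hb => ?_) (zero_le)
  obtain ⟨t, ht1, ht2⟩ := ENNReal.lt_iff_exists_nnreal_btwn.1 hb
  refine lt_of_le_of_lt (volume_le_of_weakNorm_lt (p := ∞) le_rfl (t := t)
    (by exact_mod_cast ht1) ?_) ht2
  simpa using hA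

/-- Only large `l` matter: for `1 ≤ l < M` the measure is at most `|{|w| > 1}|`, and the factor
`(max M 1)^q l^{-q} ≥ 1` absorbs it into the constant. -/
lemma WeakDecay.of_tail {q : ℝ} (hq : 0 ≤ q) {w : EuclideanSpace ℝ (Fin n) → ℂ}
    (hm : AEStronglyMeasurable w volume) (hf : ∀ l : ℝ, 0 < l → volume {x | l < ‖w x‖} < ∞)
    {M C : ℝ} (hC : 0 ≤ C)
    (ht : ∀ l : ℝ, M ≤ l → 1 ≤ l → volume {x | l < ‖w x‖} ≤ ENNReal.ofReal (C * l ^ (-q))) :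
    WeakDecay q w := by
  refine ⟨hm, hf, max C ((volume {x | 1 < ‖w x‖}).toReal * (max M 1) ^ q),
    le_max_of_le_left hC, fun l hl => ?_⟩
  have hl0 : 0 < l := by linarith
  by_cases h : M ≤ l
  · refine (ht l h hl).trans (ENNReal.ofReal_le_ofReal ?_)
    gcongr
    exact le_max_left _ _
  · have h1 : volume {x | l < ‖w x‖} ≤ volume {x | 1 < ‖w x‖} :=
      measure_mono fun x hx => lt_of_le_of_lt hl hx
    refine h1.trans ((ENNReal.ofReal_toReal (hf 1 one_pos).ne).ge.trans
      (ENNReal.ofReal_le_ofReal ?_))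
    calc (volume {x | 1 < ‖w x‖}).toReal
        ≤ (volume {x | 1 < ‖w x‖}).toReal * ((max M 1) ^ q * l ^ (-q)) := by
          refine le_mul_of_one_le_right ENNReal.toReal_nonneg ?_
          rw [Real.rpow_neg hl0.le, ← div_eq_mul_inv, one_le_div (by positivity)]
          exact Real.rpow_le_rpow hl0.le ((not_le.1 h).le.trans (le_max_left _ _)) hq
      _ = (volume {x | 1 < ‖w x‖}).toReal * (max M 1) ^ q * l ^ (-q) := by ring
      _ ≤ _ := mul_le_mul_of_nonneg_right (le_max_right C _) (by positivity)

/-- For `p = ∞` the level sets above the essential supremum are null, and smallness outside a large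
ball makes every other level set finite in measure. For `p < ∞` the weak norm gives `O(l^{-p})`,
which for `l ≥ 1` is `O(l^{-q})`. -/
lemma MemWeakLpZero.weakDecay {p : ℝ≥0∞} {q : ℝ} (hq : 0 < q) (hqp : ENNReal.ofReal q ≤ p)
    {w : EuclideanSpace ℝ (Fin n) → ℂ} (hw : MemWeakLpZero p w) : WeakDecay q w := by
  obtain ⟨⟨hm, hA⟩, hR⟩ := hw
  rcases eq_or_ne p ∞ with rfl | hp
  · refine WeakDecay.of_tail hq.le hm (fun l hl => ?_) (M := (weakNorm ∞ w).toReal + 1)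
      (le_refl 0) fun l hl h1 => ?_
    · obtain ⟨R, hR'⟩ := (hR.eventually_lt_const (ENNReal.ofReal_pos.2 hl)).exists
      have h0 := volume_eq_zero_of_weakNorm_top_lt hR'
      have hsub : {x | l < ‖w x‖} ⊆ {x | l < ‖{x | R ≤ ‖x‖}.indicator w x‖} ∪ Metric.ball 0 R := by
        intro x hx
        by_cases h : R ≤ ‖x‖
        · left
          have hx' : l < ‖w x‖ := hx
          change l < ‖{x | R ≤ ‖x‖}.indicator w x‖
          rw [Set.indicator_of_mem (by exact h)]
          exact hx'
        · right
          simpa using h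
      refine (measure_mono hsub).trans_lt ((measure_union_le _ _).trans_lt ?_)
      rw [h0, zero_add]
      exact measure_ball_lt_top
    · rw [volume_eq_zero_of_weakNorm_top_lt]
      · exact zero_le
      · rw [← ENNReal.ofReal_toReal hA.ne]
        exact (ENNReal.ofReal_lt_ofReal_iff (by linarith)).2 (by linarith)
  · have hp0 : p ≠ 0 := (lt_of_lt_of_le (ENNReal.ofReal_pos.2 hq) hqp).ne'
    have key := fun (l : ℝ) (hl : 0 < l) => volume_le_rpow_of_weakNorm_le hp0 hp
      ENNReal.toReal_nonneg (ENNReal.ofReal_toReal hA.ne).ge hl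
    refine ⟨hm, fun l hl => (key l hl).trans_lt ENNReal.ofReal_lt_top,
      (weakNorm p w).toReal ^ p.toReal, by positivity, fun l hl => (key l (by linarith)).trans ?_⟩
    refine ENNReal.ofReal_le_ofReal ?_
    gcongr
    exact (ENNReal.ofReal_le_iff_le_toReal hp).1 hqp

lemma WeakDecay.congr {q : ℝ} {v w : EuclideanSpace ℝ (Fin n) → ℂ} (hv : WeakDecay q v)
    (h : v =ᵐ[volume] w) : WeakDecay q w := by
  have h1 : ∀ l : ℝ, volume {x | l < ‖w x‖} = volume {x | l < ‖v x‖} := fun l => by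
    refine measure_congr ?_
    filter_upwards [h] with x hx
    change (l < ‖w x‖) = (l < ‖v x‖)
    rw [hx]
  obtain ⟨C, hC, ht⟩ := hv.tail
  exact ⟨hv.meas.congr h, fun l hl => (h1 l).trans_lt (hv.finite l hl), C, hC,
    fun l hl => (h1 l).trans_le (ht l hl)⟩

lemma WeakDecay.add {q : ℝ} (hq : 0 ≤ q) {v w : EuclideanSpace ℝ (Fin n) → ℂ}
    (hv : WeakDecay q v) (hw : WeakDecay q w) : WeakDecay q (v + w) := by
  have hsub : ∀ l : ℝ, volume {x | l < ‖(v + w) x‖} ≤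
      volume {x | l / 2 < ‖v x‖} + volume {x | l / 2 < ‖w x‖} := fun l => by
    refine (measure_mono fun x hx => ?_).trans (measure_union_le _ _)
    have hx' : l < ‖(v + w) x‖ := hx
    by_contra hcon
    simp only [Set.mem_union, Set.mem_ofPred_eq, not_or, not_lt] at hcon
    have := norm_add_le (v x) (w x)
    rw [Pi.add_apply] at hx'
    linarith [hcon.1, hcon.2]
  obtain ⟨C, hC, hCt⟩ := hv.tail
  obtain ⟨D, hD, hDt⟩ := hw.tail
  refine WeakDecay.of_tail hq (hv.meas.add hw.meas) (fun l hl => (hsub l).trans_lt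
    (ENNReal.add_lt_top.2 ⟨hv.finite _ (half_pos hl), hw.finite _ (half_pos hl)⟩)) (M := 2)
    (C := (C + D) * (1 / 2) ^ (-q)) (by positivity) fun l hl h1 => (hsub l).trans ?_
  refine (add_le_add (hCt (l / 2) (by linarith)) (hDt (l / 2) (by linarith))).trans (le_of_eq ?_)
  rw [← ENNReal.ofReal_add (by positivity) (by positivity)]
  congr 1
  rw [div_eq_mul_one_div l 2, Real.mul_rpow (by linarith) (by norm_num)]
  ring

lemma MemWeakLpZeroAddLinftyZero.weakDecay {p : ℝ≥0∞} {q : ℝ} (hq : 0 < q)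
    (hqp : ENNReal.ofReal q ≤ p) {w : EuclideanSpace ℝ (Fin n) → ℂ}
    (hw : MemWeakLpZeroAddLinftyZero p w) : WeakDecay q w := by
  obtain ⟨a, b, ha, hb, h⟩ := hw
  exact ((ha.weakDecay hq hqp).add hq.le (hb.weakDecay hq le_top)).congr h.symm

/-- Since `|V|^{1/2} > l` means `|V| > l²`, the exponent doubles; this trades the threshold `n/2`
for `n`. -/
lemma WeakDecay.sqrt_norm {q : ℝ} {V : EuclideanSpace ℝ (Fin n) → ℂ} (hV : WeakDecay q V) :
    WeakDecay (2 * q) (fun x => ((√‖V x‖ : ℝ) : ℂ)) := by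
  have h1 : ∀ l : ℝ, 0 < l → {x | l < ‖((√‖V x‖ : ℝ) : ℂ)‖} = {x | l ^ 2 < ‖V x‖} := fun l hl => by
    ext x
    simp only [Set.mem_ofPred_eq]
    rw [Complex.norm_real, Real.norm_of_nonneg (Real.sqrt_nonneg _), Real.lt_sqrt hl.le]
  obtain ⟨C, hC, hCt⟩ := hV.tail
  refine ⟨?_, fun l hl => ?_, C, hC, fun l hl => ?_⟩
  · exact (Complex.continuous_ofReal.comp Real.continuous_sqrt).comp_aestronglyMeasurable
      hV.meas.norm
  · rw [h1 l hl]
    exact hV.finite _ (by positivity)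
  · rw [h1 l (by linarith)]
    refine (hCt (l ^ 2) (one_le_pow₀ hl)).trans (le_of_eq ?_)
    rw [← Real.rpow_natCast, ← Real.rpow_mul (by linarith)]
    congr 3
    push_cast
    ring

/-- If `|w v| > l` then `|w| > l^α` or `|v| > l^{1-α}`. With `α = q'/q` the first event has measure
`O(l^{-q'})`, and `hQ` says that the decay `Q` of `v` is strong enough for the second. -/
lemma WeakDecay.mul {q q' Q M C : ℝ} (hq' : 0 < q') (hqq' : q' < q)
    (hQ : q' ≤ Q * (1 - q' / q)) (hM : 1 ≤ M) (hC : 0 ≤ C)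
    {w v : EuclideanSpace ℝ (Fin n) → ℂ} (hw : WeakDecay q w) (hv : AEStronglyMeasurable v volume)
    (hvt : ∀ l : ℝ, M ≤ l → volume {x | l < ‖v x‖} ≤ ENNReal.ofReal (C * l ^ (-Q))) :
    WeakDecay q' (fun x => w x * v x) := by
  have hq : 0 < q := hq'.trans hqq'
  have hsub : ∀ a b : ℝ, 0 < a → 0 < b → volume {x | a * b < ‖w x * v x‖} ≤
      volume {x | a < ‖w x‖} + volume {x | b < ‖v x‖} := fun a b ha hb => by
    refine (measure_mono fun x hx => ?_).trans (measure_union_le _ _)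
    have hx' : a * b < ‖w x * v x‖ := hx
    by_contra hcon
    simp only [Set.mem_union, Set.mem_ofPred_eq, not_or, not_lt] at hcon
    rw [norm_mul] at hx'
    have := mul_le_mul hcon.1 hcon.2 (norm_nonneg _) ha.le
    linarith
  set α := q' / q with hα
  have hα0 : 0 < α := by positivity
  have hα1 : α < 1 := (div_lt_one hq).2 hqq'
  obtain ⟨D, hD, hDt⟩ := hw.tail
  refine WeakDecay.of_tail hq'.le (hw.meas.mul hv) (fun l hl => ?_) (M := M ^ (1 - α)⁻¹)
    (C := D + C) (by positivity) fun l hl h1 => ?_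
  · have hM0 : 0 < M := by linarith
    -- For finiteness at small `l` the split keeps `v` at height `M`, the lowest one at which `hvt`
    -- applies.
    have h := hsub (l / M) M (by positivity) hM0
    rw [div_mul_cancel₀ _ hM0.ne'] at h
    exact h.trans_lt (ENNReal.add_lt_top.2 ⟨hw.finite _ (by positivity),
      (hvt M le_rfl).trans_lt ENNReal.ofReal_lt_top⟩)
  · have hl0 : 0 < l := by linarith
    have h := hsub (l ^ α) (l ^ (1 - α)) (by positivity) (by positivity)
    rw [← Real.rpow_add hl0, add_sub_cancel, Real.rpow_one] at h
    have hb : M ≤ l ^ (1 - α) := by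
      rw [← Real.rpow_inv_le_iff_of_pos (by linarith) hl0.le (by linarith)]
      exact hl
    refine h.trans ((add_le_add (hDt _ (Real.one_le_rpow h1 hα0.le)) (hvt _ hb)).trans ?_)
    rw [← ENNReal.ofReal_add (by positivity) (by positivity)]
    refine ENNReal.ofReal_le_ofReal ?_
    rw [add_mul, ← Real.rpow_mul hl0.le, ← Real.rpow_mul hl0.le]
    have e1 : α * -q = -q' := by rw [hα]; field_simp
    rw [e1]
    gcongr
    nlinarith

end WeakLp

/-! ### Radial integration by parts -/

section RadialIBP

variable {n : ℕ}

/-- The singularity `|x|⁻²` is locally integrable because `n > 2`. This function is the common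
majorant in the limits near the origin below. -/
lemma integrable_inv_norm_sq_mul (hn : 3 ≤ n) {G : EuclideanSpace ℝ (Fin n) → ℂ}
    (hG : Continuous G) (hGc : HasCompactSupport G) :
    Integrable (fun x => (‖x‖ ^ 2)⁻¹ * ‖G x‖) volume := by
  obtain ⟨C, hC⟩ := hGc.exists_bound_of_continuous hG
  obtain ⟨R, hR⟩ := hGc.isCompact.isBounded.subset_ball (0 : EuclideanSpace ℝ (Fin n))
  have hms : Measurable fun x : EuclideanSpace ℝ (Fin n) => (‖x‖ ^ 2)⁻¹ * ‖G x‖ := by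
    have := hG.measurable
    fun_prop
  rw [← integrableOn_iff_integrable_of_support_subset (s := Metric.ball 0 R)]
  · refine integrableOn_ball_of_norm_le_rpow (C := C) (α := 2) ?_ ?_ ?_ ?_
    · simp; omega
    · rw [finrank_euclideanSpace_fin]
      have : (3 : ℝ) ≤ n := by exact_mod_cast hn
      linarith
    · refine ae_of_all _ fun x => ?_
      rw [norm_mul, norm_norm, norm_inv, norm_pow, norm_norm, mul_comm,
        Real.rpow_neg (norm_nonneg _), Real.rpow_ofNat]
      gcongr
      exact hC x
    · exact hms.aestronglyMeasurable
  · intro x hx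
    apply hR
    apply subset_tsupport
    intro h0
    apply hx
    simp [h0]

lemma ae_ne_zero (hn : 3 ≤ n) : ∀ᵐ x : EuclideanSpace ℝ (Fin n), x ≠ 0 := by
  have : Nonempty (Fin n) := ⟨⟨0, by omega⟩⟩
  exact Measure.ae_ne volume 0

lemma integrable_smul_of_le_inv_norm_sq (hn : 3 ≤ n) {G : EuclideanSpace ℝ (Fin n) → ℂ}
    (hG : Continuous G) (hGc : HasCompactSupport G) {k : EuclideanSpace ℝ (Fin n) → ℝ}
    (hk : Measurable k) {M : ℝ} (hM : ∀ x ≠ 0, |k x| ≤ M * (‖x‖ ^ 2)⁻¹) :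
    Integrable (fun x => k x • G x) volume := by
  refine ((integrable_inv_norm_sq_mul hn hG hGc).const_mul M).mono'
    (hk.aestronglyMeasurable.smul hG.aestronglyMeasurable) ?_
  filter_upwards [ae_ne_zero hn] with x hx
  rw [norm_smul, ← mul_assoc]
  exact mul_le_mul_of_nonneg_right (hM x hx) (norm_nonneg _)

lemma tendsto_integral_smul_of_le_inv_norm_sq (hn : 3 ≤ n) {G : EuclideanSpace ℝ (Fin n) → ℂ}
    (hG : Continuous G) (hGc : HasCompactSupport G) {k : EuclideanSpace ℝ (Fin n) → ℝ}
    {k' : ℕ → EuclideanSpace ℝ (Fin n) → ℝ} (hk' : ∀ j, Measurable (k' j)) {M : ℝ}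
    (hM : ∀ j, ∀ x ≠ 0, |k' j x| ≤ M * (‖x‖ ^ 2)⁻¹)
    (hlim : ∀ x ≠ 0, Tendsto (fun j => k' j x) atTop (𝓝 (k x))) :
    Tendsto (fun j => ∫ x, k' j x • G x) atTop (𝓝 (∫ x, k x • G x)) := by
  refine tendsto_integral_of_dominated_convergence (fun x => M * ((‖x‖ ^ 2)⁻¹ * ‖G x‖))
    (fun j => (hk' j).aestronglyMeasurable.smul hG.aestronglyMeasurable)
    ((integrable_inv_norm_sq_mul hn hG hGc).const_mul M) (fun j => ?_) ?_
  · filter_upwards [ae_ne_zero hn] with x hx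
    rw [norm_smul, ← mul_assoc]
    exact mul_le_mul_of_nonneg_right (hM j x hx) (norm_nonneg _)
  · filter_upwards [ae_ne_zero hn] with x hx
    exact (hlim x hx).smul_const _

/-- The function `t ↦ (t / (1 + t))^ε`. -/
def zfun (ε t : ℝ) : ℝ := (t / (1 + t)) ^ ε

lemma zfun_nonneg {ε t : ℝ} (ht : 0 ≤ t) : 0 ≤ zfun ε t := by
  unfold zfun; positivity

lemma zfun_pos {ε t : ℝ} (ht : 0 < t) : 0 < zfun ε t := by
  unfold zfun; positivity

lemma zfun_le_one {ε t : ℝ} (hε : 0 ≤ ε) (ht : 0 ≤ t) : zfun ε t ≤ 1 :=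
  Real.rpow_le_one (by positivity) ((div_le_one (by positivity)).2 (by linarith)) hε

lemma measurable_zfun (ε : ℝ) : Measurable (zfun ε) := by
  unfold zfun; fun_prop

lemma hasDerivAt_zfun (ε : ℝ) {t : ℝ} (ht : 0 < t) :
    HasDerivAt (zfun ε) (ε * zfun ε t / (t * (1 + t))) t := by
  have h1 : HasDerivAt (fun t : ℝ => t / (1 + t)) (1 / (1 + t) ^ 2) t := by
    refine ((hasDerivAt_id' t).fun_div ((hasDerivAt_id' t).const_add 1)
      (by positivity)).congr_deriv ?_
    congr 1
    ring
  have h2 := h1.rpow_const (p := ε) (Or.inl (by positivity))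
  refine h2.congr_deriv ?_
  rw [Real.rpow_sub_one (by positivity)]
  unfold zfun
  field_simp

lemma contDiffAt_zfun (ε : ℝ) {t : ℝ} (ht : 0 < t) : ContDiffAt ℝ (⊤ : ℕ∞) (zfun ε) t := by
  unfold zfun
  refine ContDiffAt.rpow_const_of_ne ?_ (by positivity)
  exact contDiffAt_id.div (contDiffAt_const.add contDiffAt_id) (by positivity)

lemma hasDerivAt_zfun_div (ε : ℝ) {t : ℝ} (ht : 0 < t) :
    HasDerivAt (fun t => zfun ε t / t) (zfun ε t / t * (ε / (t * (1 + t)) - 1 / t)) t := by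
  refine ((hasDerivAt_zfun ε ht).fun_div (hasDerivAt_id' t) ht.ne').congr_deriv ?_
  field_simp

lemma fderiv_apply_self (F : EuclideanSpace ℝ (Fin n) → ℂ) (x : EuclideanSpace ℝ (Fin n)) :
    fderiv ℝ F x x = ∑ i, x i • fderiv ℝ F x (EuclideanSpace.single i 1) := by
  have h := congrArg (fderiv ℝ F x) ((EuclideanSpace.basisFun (Fin n) ℝ).sum_repr x)
  rw [map_sum] at h
  rw [← h]
  exact Finset.sum_congr rfl fun i _ => by rw [map_smul]; simp

lemma IsTestFun.continuous {F : EuclideanSpace ℝ (Fin n) → ℂ} (hF : IsTestFun F) :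
    Continuous F := hF.1.continuous

lemma IsTestFun.differentiable {F : EuclideanSpace ℝ (Fin n) → ℂ} (hF : IsTestFun F) :
    Differentiable ℝ F := hF.1.differentiable (by simp)

lemma IsTestFun.fderiv_apply {F : EuclideanSpace ℝ (Fin n) → ℂ} (hF : IsTestFun F)
    (v : EuclideanSpace ℝ (Fin n)) : IsTestFun (fun x => fderiv ℝ F x v) :=
  ⟨(hF.1.fderiv_right (by simp)).clm_apply contDiff_const, hF.2.fderiv_apply ℝ v⟩

/-- Integration by parts against `x g(|x|² + δ)`. -/
lemma integral_radial_ibp_aux (ε : ℝ) {δ : ℝ} (hδ : 0 < δ) {F : EuclideanSpace ℝ (Fin n) → ℂ}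
    (hF : IsTestFun F) :
    ∫ x, (zfun ε (‖x‖ ^ 2 + δ) / (‖x‖ ^ 2 + δ)) • fderiv ℝ F x x =
      -∫ x, ((zfun ε (‖x‖ ^ 2 + δ) / (‖x‖ ^ 2 + δ)) * (n + 2 * ‖x‖ ^ 2 *
        (ε / ((‖x‖ ^ 2 + δ) * (1 + (‖x‖ ^ 2 + δ))) - 1 / (‖x‖ ^ 2 + δ)))) • F x := by
  set h : EuclideanSpace ℝ (Fin n) → ℝ := fun x => zfun ε (‖x‖ ^ 2 + δ) / (‖x‖ ^ 2 + δ) with hh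
  set h' : EuclideanSpace ℝ (Fin n) → ℝ := fun x => h x *
    (ε / ((‖x‖ ^ 2 + δ) * (1 + (‖x‖ ^ 2 + δ))) - 1 / (‖x‖ ^ 2 + δ)) with hh'
  have hρ : ∀ x : EuclideanSpace ℝ (Fin n), 0 < ‖x‖ ^ 2 + δ := fun x => by positivity
  have hd : ∀ x, HasFDerivAt h (h' x • (2 • (innerSL ℝ x))) x := fun x => by
    have h1 : HasFDerivAt (fun x : EuclideanSpace ℝ (Fin n) => ‖x‖ ^ 2 + δ)
        (2 • (innerSL ℝ x)) x := (hasStrictFDerivAt_norm_sq x).hasFDerivAt.add_const δ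
    exact (hasDerivAt_zfun_div ε (hρ x)).comp_hasFDerivAt x h1
  have hhc : Continuous h := continuous_iff_continuousAt.2 fun x => (hd x).continuousAt
  have hhc' : Continuous h' := by
    refine hhc.mul (Continuous.sub ?_ ?_)
    · exact continuous_const.div (by fun_prop) fun x => by have := hρ x; positivity
    · exact continuous_const.div (by fun_prop) fun x => (hρ x).ne'
  have hfi : ∀ (i : Fin n) x, HasFDerivAt (fun x : EuclideanSpace ℝ (Fin n) => x i * h x)
      (x i • (h' x • (2 • (innerSL ℝ x))) + h x • EuclideanSpace.proj i) x := fun i x =>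
    (EuclideanSpace.proj (𝕜 := ℝ) i).hasFDerivAt.mul (hd x)
  have hfi' : ∀ (i : Fin n) x, fderiv ℝ (fun x : EuclideanSpace ℝ (Fin n) => x i * h x) x
      (EuclideanSpace.single i 1) = h x + 2 * (x i) ^ 2 * h' x := fun i x => by
    have h1 : inner ℝ x (EuclideanSpace.single i (1 : ℝ)) = x i := by
      simp [EuclideanSpace.inner_single_right]
    rw [(hfi i x).fderiv]
    simp [h1]
    ring
  have hcoord : ∀ i : Fin n, Continuous fun x : EuclideanSpace ℝ (Fin n) => x i := fun i =>
    (EuclideanSpace.proj (𝕜 := ℝ) i).continuous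
  have hI : ∀ (k : EuclideanSpace ℝ (Fin n) → ℝ) (G : EuclideanSpace ℝ (Fin n) → ℂ),
      Continuous k → IsTestFun G → Integrable (fun x => k x • G x) := fun k G hk hG =>
    (hk.smul hG.continuous).integrable_of_hasCompactSupport hG.2.smul_left
  have key : ∀ i : Fin n, ∫ x : EuclideanSpace ℝ (Fin n), (x i * h x) •
      fderiv ℝ F x (EuclideanSpace.single i 1) =
      -∫ x : EuclideanSpace ℝ (Fin n), (h x + 2 * (x i) ^ 2 * h' x) • F x := fun i => by
    rw [integral_smul_fderiv_eq_neg_fderiv_smul_of_integrable]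
    · simp_rw [hfi']
    · simp_rw [hfi']
      exact hI _ _ (by have := hcoord i; fun_prop) hF
    · exact hI _ _ ((hcoord i).mul hhc) (hF.fderiv_apply _)
    · exact hI _ _ ((hcoord i).mul hhc) hF
    · exact fun x _ => (hfi i x).differentiableAt
    · exact fun x _ => hF.differentiable x
  -- Summing the coordinate identities produces the divergence `n h + 2|x|² h'` of the field `x h`.
  have hsum := Finset.sum_congr (rfl : (Finset.univ : Finset (Fin n)) = Finset.univ)
    fun i _ => key i
  rw [Finset.sum_neg_distrib, ← integral_finsetSum, ← integral_finsetSum] at hsum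
  · convert hsum using 1
    · refine integral_congr_ae (ae_of_all _ fun x => ?_)
      simp only [fderiv_apply_self F x, Finset.smul_sum, smul_smul]
      exact Finset.sum_congr rfl fun i _ => by rw [mul_comm]
    · congr 1
      refine integral_congr_ae (ae_of_all _ fun x => ?_)
      simp only [← Finset.sum_smul]
      congr 1
      rw [Finset.sum_add_distrib, ← Finset.sum_mul, ← Finset.mul_sum, ← EuclideanSpace.real_norm_sq_eq]
      simp [hh']
      ring
  · exact fun i _ => hI _ _ (by have := hcoord i; fun_prop) hF
  · exact fun i _ => hI _ _ ((hcoord i).mul hhc) (hF.fderiv_apply _)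

/-- Integration by parts against the singular radial field `x g(|x|²)`,
`g(t) = (t / (1 + t))^ε / t`. -/
lemma integral_radial_ibp (hn : 3 ≤ n) {ε : ℝ} (hε : 0 ≤ ε) {F : EuclideanSpace ℝ (Fin n) → ℂ}
    (hF : IsTestFun F) :
    ∫ x, (zfun ε (‖x‖ ^ 2) / ‖x‖ ^ 2) • fderiv ℝ F x x =
      -∫ x, ((zfun ε (‖x‖ ^ 2) / ‖x‖ ^ 2) * (n - 2 + 2 * ε / (1 + ‖x‖ ^ 2))) • F x := by
  have hcont : Continuous fun x => fderiv ℝ F x x :=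
    (hF.1.continuous_fderiv (by simp)).clm_apply continuous_id
  have hcs : HasCompactSupport fun x => fderiv ℝ F x x := by
    refine (hF.2.fderiv ℝ).mono fun x hx h0 => hx ?_
    simp [h0]
  -- Replacing `|x|²` by `|x|² + δ` makes the field smooth. Both integrands stay dominated by
  -- multiples of `|x|⁻²` times a compactly supported function, uniformly in `δ`, so `δ → 0` is
  -- dominated convergence.
  set δ : ℕ → ℝ := fun j => 1 / ((j : ℝ) + 1) with hδ
  have hδ0 : ∀ j, 0 < δ j := fun j => by positivity
  have hδlim : Tendsto δ atTop (𝓝 0) := tendsto_one_div_add_atTop_nhds_zero_nat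
  have hρlim : ∀ x : EuclideanSpace ℝ (Fin n), Tendsto (fun j => ‖x‖ ^ 2 + δ j) atTop (𝓝 (‖x‖ ^ 2)) :=
    fun x => by simpa using hδlim.const_add (‖x‖ ^ 2)
  have hzm := measurable_zfun ε
  have hle : ∀ (j : ℕ) (x : EuclideanSpace ℝ (Fin n)), x ≠ 0 →
      |zfun ε (‖x‖ ^ 2 + δ j) / (‖x‖ ^ 2 + δ j)| ≤ (‖x‖ ^ 2)⁻¹ := fun j x hx => by
    have h1 : 0 < ‖x‖ ^ 2 := by positivity
    have h2 := hδ0 j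
    rw [abs_of_nonneg (div_nonneg (zfun_nonneg (by positivity)) (by positivity)), inv_eq_one_div]
    exact div_le_div₀ (by norm_num) (zfun_le_one hε (by positivity)) h1 (by linarith)
  have hlim : ∀ x : EuclideanSpace ℝ (Fin n), x ≠ 0 → Tendsto (fun j => zfun ε (‖x‖ ^ 2 + δ j) / (‖x‖ ^ 2 + δ j)) atTop
      (𝓝 (zfun ε (‖x‖ ^ 2) / ‖x‖ ^ 2)) := fun x hx =>
    ((hasDerivAt_zfun_div ε (by positivity)).continuousAt.tendsto).comp (hρlim x)
  have L1 := tendsto_integral_smul_of_le_inv_norm_sq hn hcont hcs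
    (k' := fun j x => zfun ε (‖x‖ ^ 2 + δ j) / (‖x‖ ^ 2 + δ j))
    (k := fun x => zfun ε (‖x‖ ^ 2) / ‖x‖ ^ 2) (fun j => by fun_prop) (M := 1)
    (fun j x hx => by simpa using hle j x hx) hlim
  have L2 := tendsto_integral_smul_of_le_inv_norm_sq hn hF.continuous hF.2
    (k' := fun j x => (zfun ε (‖x‖ ^ 2 + δ j) / (‖x‖ ^ 2 + δ j)) * (n + 2 * ‖x‖ ^ 2 *
        (ε / ((‖x‖ ^ 2 + δ j) * (1 + (‖x‖ ^ 2 + δ j))) - 1 / (‖x‖ ^ 2 + δ j))))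
    (k := fun x => (zfun ε (‖x‖ ^ 2) / ‖x‖ ^ 2) * (n - 2 + 2 * ε / (1 + ‖x‖ ^ 2)))
    (fun j => by fun_prop) (M := n + 2 * ε + 2) (fun j x hx => by
      rw [abs_mul, mul_comm]
      refine mul_le_mul ?_ (hle j x hx) (abs_nonneg _) (by positivity)
      have h1 : 0 < ‖x‖ ^ 2 := by positivity
      have h2 := hδ0 j
      set t := ‖x‖ ^ 2 with ht
      have e1 : 2 * t * (ε / ((t + δ j) * (1 + (t + δ j))) - 1 / (t + δ j)) =
        (t / (t + δ j)) * (2 * ε / (1 + (t + δ j)) - 2) := by field_simp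
      have e2 : t / (t + δ j) ≤ 1 := (div_le_one (by positivity)).2 (by linarith)
      have e3 : 0 ≤ t / (t + δ j) := by positivity
      have e4 : 2 * ε / (1 + (t + δ j)) ≤ 2 * ε := div_le_self (by positivity) (by linarith)
      have e5 : 0 ≤ 2 * ε / (1 + (t + δ j)) := by positivity
      have e6 : (0 : ℝ) ≤ n := by positivity
      rw [e1, abs_le]
      constructor <;> nlinarith) (fun x hx => by
      refine (hlim x hx).mul ?_
      have h1 : 0 < ‖x‖ ^ 2 := by positivity
      have h3 : Tendsto (fun j => (n : ℝ) + 2 * ‖x‖ ^ 2 *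
        (ε / ((‖x‖ ^ 2 + δ j) * (1 + (‖x‖ ^ 2 + δ j))) - 1 / (‖x‖ ^ 2 + δ j))) atTop
        (𝓝 ((n : ℝ) + 2 * ‖x‖ ^ 2 *
        (ε / (‖x‖ ^ 2 * (1 + ‖x‖ ^ 2)) - 1 / ‖x‖ ^ 2))) := by
        have h4 := hρlim x
        refine Tendsto.const_add _ (Tendsto.const_mul _ (Tendsto.sub ?_ ?_))
        · exact tendsto_const_nhds.div (h4.mul (h4.const_add 1)) (by positivity)
        · exact tendsto_const_nhds.div h4 (by positivity)
      convert h3 using 2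
      field_simp
      ring)
  refine tendsto_nhds_unique L1 ?_
  simp_rw [integral_radial_ibp_aux ε (hδ0 _) hF]
  exact L2.neg

end RadialIBP

/-! ### Hardy's identity -/

section HardyIdentity

variable {n : ℕ}

lemma IsTestFun.add {φ ψ : EuclideanSpace ℝ (Fin n) → ℂ} (hφ : IsTestFun φ) (hψ : IsTestFun ψ) :
    IsTestFun (φ + ψ) := ⟨hφ.1.add hψ.1, hφ.2.add hψ.2⟩

lemma IsTestFun.const_smul {φ : EuclideanSpace ℝ (Fin n) → ℂ} (c : ℂ) (hφ : IsTestFun φ) :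
    IsTestFun (c • φ) := ⟨contDiff_const.smul hφ.1, hφ.2.smul_left (f := fun _ => c)⟩

lemma IsTestFun.sub {φ ψ : EuclideanSpace ℝ (Fin n) → ℂ} (hφ : IsTestFun φ) (hψ : IsTestFun ψ) :
    IsTestFun (φ - ψ) := ⟨hφ.1.sub hψ.1, hφ.2.sub hψ.2⟩

lemma IsTestFun.mul_left {a φ : EuclideanSpace ℝ (Fin n) → ℂ} (ha : ContDiff ℝ (⊤ : ℕ∞) a)
    (hφ : IsTestFun φ) : IsTestFun (fun x => a x * φ x) := ⟨ha.mul hφ.1, hφ.2.mul_left⟩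

lemma IsTestFun.conj {φ : EuclideanSpace ℝ (Fin n) → ℂ} (hφ : IsTestFun φ) :
    IsTestFun (fun x => conj (φ x)) :=
  ⟨Complex.conjCLE.contDiff.comp hφ.1, hφ.2.comp_left (g := conj) (map_zero _)⟩

lemma IsTestFun.conj_mul {φ ψ : EuclideanSpace ℝ (Fin n) → ℂ} (hφ : IsTestFun φ)
    (hψ : IsTestFun ψ) : IsTestFun (fun x => conj (φ x) * ψ x) := hψ.mul_left hφ.conj.1

lemma IsTestFun.memLp {φ : EuclideanSpace ℝ (Fin n) → ℂ} (hφ : IsTestFun φ) (p : ℝ≥0∞) :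
    MemLp φ p volume := hφ.continuous.memLp_of_hasCompactSupport hφ.2

lemma IsTestFun.integrable {φ : EuclideanSpace ℝ (Fin n) → ℂ} (hφ : IsTestFun φ) :
    Integrable φ := hφ.continuous.integrable_of_hasCompactSupport hφ.2

lemma IsTestFun.fderiv_conj {φ : EuclideanSpace ℝ (Fin n) → ℂ} (hφ : IsTestFun φ)
    (x v : EuclideanSpace ℝ (Fin n)) :
    fderiv ℝ (fun x => conj (φ x)) x v = conj (fderiv ℝ φ x v) := by
  have h := (Complex.conjCLE.toContinuousLinearMap.hasFDerivAt (x := φ x)).comp x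
    (hφ.differentiable x).hasFDerivAt
  have h2 : fderiv ℝ (fun x => conj (φ x)) x = _ := h.fderiv
  rw [h2]
  simp

lemma IsTestFun.fderiv_conj_mul {φ ψ : EuclideanSpace ℝ (Fin n) → ℂ} (hφ : IsTestFun φ)
    (hψ : IsTestFun ψ) (x v : EuclideanSpace ℝ (Fin n)) :
    fderiv ℝ (fun x => conj (φ x) * ψ x) x v =
      conj (fderiv ℝ φ x v) * ψ x + conj (φ x) * fderiv ℝ ψ x v := by
  rw [fderiv_fun_mul (hφ.conj.differentiable x) (hψ.differentiable x)]
  simp only [add_apply, smul_apply, smul_eq_mul, hφ.fderiv_conj]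
  ring

/-- The constant `(n - 2) / 2`. -/
def hardyC (n : ℕ) : ℝ := ((n : ℝ) - 2) / 2

/-- The components of `∇φ + (n - 2) / 2 |x|⁻² x φ`. -/
def hardyGrad (φ : EuclideanSpace ℝ (Fin n) → ℂ) (i : Fin n) (x : EuclideanSpace ℝ (Fin n)) : ℂ :=
  fderiv ℝ φ x (EuclideanSpace.single i 1) + ((hardyC n * x i / ‖x‖ ^ 2 : ℝ) : ℂ) * φ x

lemma measurable_coord (i : Fin n) : Measurable fun x : EuclideanSpace ℝ (Fin n) => x i :=
  (EuclideanSpace.proj (𝕜 := ℝ) i).continuous.measurable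

lemma abs_coord_le (x : EuclideanSpace ℝ (Fin n)) (i : Fin n) : |x i| ≤ ‖x‖ :=
  PiLp.norm_apply_le x i

/-- From `|xᵢ| ≤ |x|` the square of the singular term is at most a multiple of `|x|⁻² |φ|²`, which
is integrable for `n ≥ 3`. -/
lemma memLp_hardyGrad (hn : 3 ≤ n) {φ : EuclideanSpace ℝ (Fin n) → ℂ} (hφ : IsTestFun φ)
    (i : Fin n) : MemLp (hardyGrad φ i) 2 volume := by
  refine MemLp.add ((hφ.fderiv_apply _).memLp 2) ?_
  have hms : AEStronglyMeasurable (fun x : EuclideanSpace ℝ (Fin n) =>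
      ((hardyC n * x i / ‖x‖ ^ 2 : ℝ) : ℂ) * φ x) volume := by
    have := measurable_coord (n := n) i
    have h2 := hφ.continuous.measurable
    refine Measurable.aestronglyMeasurable ?_
    fun_prop
  rw [memLp_two_iff_integrable_sq_norm hms]
  have hG := hφ.conj_mul hφ
  refine ((integrable_inv_norm_sq_mul hn hG.continuous hG.2).const_mul (hardyC n ^ 2)).mono'
    (hms.norm.pow 2) ?_
  filter_upwards [ae_ne_zero hn] with x hx
  have h1 : 0 < ‖x‖ := norm_pos_iff.2 hx
  rw [Real.norm_of_nonneg (by positivity), norm_mul, Complex.norm_real, norm_mul, RCLike.norm_conj,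
    Real.norm_eq_abs, mul_pow, sq_abs]
  have h2 : (x i) ^ 2 ≤ ‖x‖ ^ 2 := by
    rw [← sq_abs]
    have := abs_coord_le x i
    gcongr
  calc (hardyC n * x i / ‖x‖ ^ 2) ^ 2 * ‖φ x‖ ^ 2
      = hardyC n ^ 2 * ((x i) ^ 2 * ((‖x‖ ^ 2)⁻¹ * (‖x‖ ^ 2)⁻¹) * (‖φ x‖ * ‖φ x‖)) := by
        field_simp
    _ ≤ hardyC n ^ 2 * (‖x‖ ^ 2 * ((‖x‖ ^ 2)⁻¹ * (‖x‖ ^ 2)⁻¹) * (‖φ x‖ * ‖φ x‖)) := by gcongr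
    _ = _ := by field_simp

lemma integral_div_norm_sq_fderiv (hn : 3 ≤ n) {F : EuclideanSpace ℝ (Fin n) → ℂ}
    (hF : IsTestFun F) :
    ∫ x, (1 / ‖x‖ ^ 2) • fderiv ℝ F x x = -∫ x, (1 / ‖x‖ ^ 2 * ((n : ℝ) - 2)) • F x := by
  have h := integral_radial_ibp hn le_rfl hF
  simpa [zfun] using h

lemma integrable_mul_of_memLp {f g : EuclideanSpace ℝ (Fin n) → ℂ} (hf : MemLp f 2 volume)
    (hg : MemLp g 2 volume) : Integrable (fun x => conj (f x) * g x) :=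
  (hf.star).integrable_mul hg

/-- Completing the square. With `c = (n-2)/2`, the cross terms form `c |x|⁻² x·∇(φ̄ψ)`, whose
integral is `-2c² ∫ |x|⁻² φ̄ψ`. Together with the square term `c² |x|⁻² φ̄ψ` this leaves `-c²`,
which is minus the Hardy constant. -/
lemma hardyForm_eq (hn : 3 ≤ n) {φ ψ : EuclideanSpace ℝ (Fin n) → ℂ} (hφ : IsTestFun φ)
    (hψ : IsTestFun ψ) :
    hardyForm φ ψ = ∑ i, ∫ x, conj (hardyGrad φ i x) * hardyGrad ψ i x := by
  set F : EuclideanSpace ℝ (Fin n) → ℂ := fun x => conj (φ x) * ψ x with hFdef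
  have hF : IsTestFun F := hφ.conj_mul hψ
  have hcont : Continuous fun x => fderiv ℝ F x x :=
    (hF.1.continuous_fderiv (by simp)).clm_apply continuous_id
  have hcs : HasCompactSupport fun x => fderiv ℝ F x x := by
    refine (hF.2.fderiv ℝ).mono fun x hx h0 => hx ?_
    simp [h0]
  have hint1 : Integrable fun x => (1 / ‖x‖ ^ 2) • fderiv ℝ F x x :=
    integrable_smul_of_le_inv_norm_sq hn hcont hcs (by fun_prop) (M := 1) fun x hx => by
      rw [abs_of_nonneg (by positivity)]; simp
  have hint2 : Integrable fun x => (1 / ‖x‖ ^ 2 * ((n : ℝ) - 2)) • F x :=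
    integrable_smul_of_le_inv_norm_sq hn hF.continuous hF.2 (by fun_prop) (M := |(n : ℝ) - 2|)
      fun x hx => by
        rw [abs_mul, abs_of_nonneg (by positivity)]; simp [mul_comm]
  have hL := integral_div_norm_sq_fderiv hn hF
  have hzero : ∫ x, ((hardyC n) • ((1 / ‖x‖ ^ 2) • fderiv ℝ F x x +
      (1 / ‖x‖ ^ 2 * ((n : ℝ) - 2)) • F x)) = 0 := by
    rw [integral_smul, integral_add hint1 hint2, hL]
    simp
  have hint3 : Integrable (fun x => ((hardyC n) • ((1 / ‖x‖ ^ 2) • fderiv ℝ F x x +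
      (1 / ‖x‖ ^ 2 * ((n : ℝ) - 2)) • F x))) :=
    (hint1.add hint2).smul (hardyC n)
  have hint4 : ∀ i ∈ Finset.univ, Integrable (fun x => conj (hardyGrad φ i x) * hardyGrad ψ i x) :=
    fun i _ => integrable_mul_of_memLp (memLp_hardyGrad hn hφ i) (memLp_hardyGrad hn hψ i)
  rw [← integral_finsetSum _ hint4, ← sub_zero (∫ x, _), ← hzero,
    ← integral_sub (integrable_finsetSum _ hint4) hint3, hardyForm]
  refine integral_congr_ae ?_
  filter_upwards [ae_ne_zero hn] with x hx
  have h1 : (‖x‖ : ℂ) ≠ 0 := by simpa using hx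
  have h2 : ∑ i, ((x i : ℂ)) ^ 2 = (‖x‖ : ℂ) ^ 2 := by
    have := EuclideanSpace.real_norm_sq_eq x
    exact_mod_cast this.symm
  have h3 : fderiv ℝ F x x = ∑ i, (x i : ℂ) * (conj (fderiv ℝ φ x (EuclideanSpace.single i 1)) * ψ x
      + conj (φ x) * fderiv ℝ ψ x (EuclideanSpace.single i 1)) := by
    rw [fderiv_apply_self]
    refine Finset.sum_congr rfl fun i _ => ?_
    rw [hφ.fderiv_conj_mul hψ, Complex.real_smul]
  have h4 : ∑ i, conj (hardyGrad φ i x) * hardyGrad ψ i x =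
      (∑ i, conj (fderiv ℝ φ x (EuclideanSpace.single i 1)) *
        fderiv ℝ ψ x (EuclideanSpace.single i 1)) +
      (hardyC n / (‖x‖ : ℂ) ^ 2) * fderiv ℝ F x x +
      (hardyC n ^ 2 / ((‖x‖ : ℂ) ^ 2) ^ 2) * F x * ∑ i, ((x i : ℂ)) ^ 2 := by
    rw [h3, Finset.mul_sum, Finset.mul_sum, ← Finset.sum_add_distrib, ← Finset.sum_add_distrib]
    refine Finset.sum_congr rfl fun i _ => ?_
    simp only [hardyGrad, hFdef, map_add, map_mul, Complex.conj_ofReal]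
    push_cast
    ring
  rw [h4, h2]
  simp only [Complex.real_smul, hardyConst, hardyC, hFdef]
  push_cast
  field_simp
  ring

end HardyIdentity

/-! ### The closed form and its operator -/

section FormSpace

variable {n : ℕ}

/-- `L² ⊕ (L²)ⁿ`. -/
abbrev GraphSpace (n : ℕ) : Type := PiLp 2 (fun _ : Option (Fin n) => L2 n)

/-- The pair `(φ, ∇φ + (n - 2) / 2 |x|⁻² x φ)`. -/
def formEmb (hn : 3 ≤ n) {φ : EuclideanSpace ℝ (Fin n) → ℂ} (hφ : IsTestFun φ) : GraphSpace n :=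
  WithLp.toLp 2 fun o => match o with
    | none => (hφ.memLp 2).toLp
    | some i => (memLp_hardyGrad hn hφ i).toLp

lemma formEmb_none (hn : 3 ≤ n) {φ : EuclideanSpace ℝ (Fin n) → ℂ} (hφ : IsTestFun φ) :
    formEmb hn hφ none = (hφ.memLp 2).toLp := rfl

lemma formEmb_some (hn : 3 ≤ n) {φ : EuclideanSpace ℝ (Fin n) → ℂ} (hφ : IsTestFun φ) (i : Fin n) :
    formEmb hn hφ (some i) = (memLp_hardyGrad hn hφ i).toLp := rfl

lemma hardyGrad_add {φ ψ : EuclideanSpace ℝ (Fin n) → ℂ} (hφ : IsTestFun φ) (hψ : IsTestFun ψ)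
    (i : Fin n) : hardyGrad (φ + ψ) i = hardyGrad φ i + hardyGrad ψ i := by
  ext x
  simp only [hardyGrad, Pi.add_apply]
  rw [fderiv_add (hφ.differentiable x) (hψ.differentiable x), add_apply]
  ring

lemma hardyGrad_const_smul {φ : EuclideanSpace ℝ (Fin n) → ℂ} (hφ : IsTestFun φ) (c : ℂ)
    (i : Fin n) : hardyGrad (c • φ) i = c • hardyGrad φ i := by
  ext x
  simp only [hardyGrad, Pi.smul_apply, smul_eq_mul]
  rw [fderiv_const_smul (hφ.differentiable x), smul_apply, smul_eq_mul]
  ring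

lemma formEmb_add (hn : 3 ≤ n) {φ ψ : EuclideanSpace ℝ (Fin n) → ℂ} (hφ : IsTestFun φ)
    (hψ : IsTestFun ψ) : formEmb hn (hφ.add hψ) = formEmb hn hφ + formEmb hn hψ := by
  ext1 o
  rcases o with _ | i
  · exact MemLp.toLp_add (hφ.memLp 2) (hψ.memLp 2)
  · exact (MemLp.toLp_congr (memLp_hardyGrad hn (hφ.add hψ) i)
      ((memLp_hardyGrad hn hφ i).add (memLp_hardyGrad hn hψ i))
      (ae_of_all _ fun x => congrFun (hardyGrad_add hφ hψ i) x)).trans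
      (MemLp.toLp_add (memLp_hardyGrad hn hφ i) (memLp_hardyGrad hn hψ i))

lemma formEmb_const_smul (hn : 3 ≤ n) {φ : EuclideanSpace ℝ (Fin n) → ℂ} (hφ : IsTestFun φ)
    (c : ℂ) : formEmb hn (hφ.const_smul c) = c • formEmb hn hφ := by
  ext1 o
  rcases o with _ | i
  · exact MemLp.toLp_const_smul c (hφ.memLp 2)
  · exact (MemLp.toLp_congr (memLp_hardyGrad hn (hφ.const_smul c) i)
      ((memLp_hardyGrad hn hφ i).const_smul c)
      (ae_of_all _ fun x => congrFun (hardyGrad_const_smul hφ c i) x)).trans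
      (MemLp.toLp_const_smul c (memLp_hardyGrad hn hφ i))

lemma formEmb_sub (hn : 3 ≤ n) {φ ψ : EuclideanSpace ℝ (Fin n) → ℂ} (hφ : IsTestFun φ)
    (hψ : IsTestFun ψ) : formEmb hn (hφ.sub hψ) = formEmb hn hφ - formEmb hn hψ := by
  have h : formEmb hn (hφ.sub hψ) + formEmb hn hψ = formEmb hn hφ := by
    rw [← formEmb_add]
    congr 1
    exact sub_add_cancel φ ψ
  rw [← h, add_sub_cancel_right]

lemma inner_toLp_toLp {f g : EuclideanSpace ℝ (Fin n) → ℂ} (hf : MemLp f 2 volume)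
    (hg : MemLp g 2 volume) :
    inner ℂ (hf.toLp : L2 n) hg.toLp = ∫ x, conj (f x) * g x := by
  rw [L2.inner_def]
  refine integral_congr_ae ?_
  filter_upwards [hf.coeFn_toLp, hg.coeFn_toLp] with x h1 h2
  rw [h1, h2, RCLike.inner_apply, mul_comm]

/-- By the completed square the embedding is isometric for the form norm, so closing the form
amounts to closing a subspace of a Hilbert space. -/
lemma inner_formEmb (hn : 3 ≤ n) {φ ψ : EuclideanSpace ℝ (Fin n) → ℂ} (hφ : IsTestFun φ)
    (hψ : IsTestFun ψ) : inner ℂ (formEmb hn hφ) (formEmb hn hψ) =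
      inner ℂ (formEmb hn hφ none) (formEmb hn hψ none) + hardyForm φ ψ := by
  rw [PiLp.inner_apply, Fintype.sum_option, hardyForm_eq hn hφ hψ]
  congr 1
  exact Finset.sum_congr rfl fun i _ => inner_toLp_toLp (memLp_hardyGrad hn hφ i)
    (memLp_hardyGrad hn hψ i)

/-- The subspace of pairs coming from test functions. -/
def testSubmodule (hn : 3 ≤ n) : Submodule ℂ (GraphSpace n) where
  carrier := {g | ∃ (φ : EuclideanSpace ℝ (Fin n) → ℂ) (hφ : IsTestFun φ), formEmb hn hφ = g}
  add_mem' := by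
    rintro _ _ ⟨φ, hφ, rfl⟩ ⟨ψ, hψ, rfl⟩
    exact ⟨_, hφ.add hψ, formEmb_add hn hφ hψ⟩
  zero_mem' := by
    have h0 : IsTestFun (0 : EuclideanSpace ℝ (Fin n) → ℂ) := ⟨contDiff_const, HasCompactSupport.zero⟩
    refine ⟨_, h0.const_smul 0, ?_⟩
    rw [formEmb_const_smul hn h0, zero_smul]
  smul_mem' := by
    rintro c _ ⟨φ, hφ, rfl⟩
    exact ⟨_, hφ.const_smul c, formEmb_const_smul hn hφ c⟩

/-- The form domain with the form norm, as a closed subspace of `L² ⊕ (L²)ⁿ`. -/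
abbrev formSpace (hn : 3 ≤ n) : Submodule ℂ (GraphSpace n) := (testSubmodule hn).topologicalClosure

lemma formEmb_mem (hn : 3 ≤ n) {φ : EuclideanSpace ℝ (Fin n) → ℂ} (hφ : IsTestFun φ) :
    formEmb hn hφ ∈ formSpace hn :=
  Submodule.le_topologicalClosure _ ⟨φ, hφ, rfl⟩

instance (hn : 3 ≤ n) : CompleteSpace (formSpace hn) :=
  (Submodule.isClosed_topologicalClosure _).completeSpace_coe

/-- The inclusion of the form domain into `L²`. -/
def formIncl (hn : 3 ≤ n) : formSpace hn →L[ℂ] L2 n :=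
  (PiLp.proj 2 (fun _ : Option (Fin n) => L2 n) none : GraphSpace n →L[ℂ] L2 n) ∘L
    (formSpace hn).subtypeL

lemma formIncl_apply (hn : 3 ≤ n) (g : formSpace hn) : formIncl hn g = (g : GraphSpace n) none := rfl

lemma exists_tendsto_formEmb (hn : 3 ≤ n) (g : formSpace hn) :
    ∃ (φ : ℕ → EuclideanSpace ℝ (Fin n) → ℂ) (hφ : ∀ k, IsTestFun (φ k)),
      Tendsto (fun k => formEmb hn (hφ k)) atTop (𝓝 (g : GraphSpace n)) := by
  obtain ⟨x, hx, hlim⟩ := mem_closure_iff_seq_limit.1 g.2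
  choose φ hφ hφx using hx
  exact ⟨φ, hφ, by simpa only [hφx] using hlim⟩

lemma tendsto_none {ι : Type*} {l : Filter ι} {x : ι → GraphSpace n} {g : GraphSpace n}
    (h : Tendsto x l (𝓝 g)) (o : Option (Fin n)) : Tendsto (fun k => x k o) l (𝓝 (g o)) :=
  ((PiLp.proj 2 (fun _ : Option (Fin n) => L2 n) o : GraphSpace n →L[ℂ] L2 n).continuous.tendsto
    g).comp h

lemma toLp_tendsto_iff {φ : ℕ → EuclideanSpace ℝ (Fin n) → ℂ} (hφ : ∀ k, IsTestFun (φ k))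
    (u : L2 n) : Tendsto (fun k => (((hφ k).memLp 2).toLp : L2 n)) atTop (𝓝 u) ↔
      Tendsto (fun k => eLpNorm (φ k - ⇑u) 2 volume) atTop (𝓝 0) := by
  refine (Lp.tendsto_Lp_iff_tendsto_eLpNorm' _ _).trans (tendsto_congr fun k =>
    eLpNorm_congr_ae ?_)
  filter_upwards [((hφ k).memLp 2).coeFn_toLp] with x hx
  rw [Pi.sub_apply, Pi.sub_apply, hx]

lemma tendsto_hardyForm (hn : 3 ≤ n) {ι : Type*} {l : Filter ι}
    {φ ψ : ι → EuclideanSpace ℝ (Fin n) → ℂ}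
    (hφ : ∀ k, IsTestFun (φ k)) (hψ : ∀ k, IsTestFun (ψ k)) {g h : GraphSpace n}
    (hg : Tendsto (fun k => formEmb hn (hφ k)) l (𝓝 g))
    (hh : Tendsto (fun k => formEmb hn (hψ k)) l (𝓝 h)) :
    Tendsto (fun k => hardyForm (φ k) (ψ k)) l (𝓝 (inner ℂ g h - inner ℂ (g none) (h none))) := by
  have h1 : ∀ k, hardyForm (φ k) (ψ k) = inner ℂ (formEmb hn (hφ k)) (formEmb hn (hψ k)) -
      inner ℂ (formEmb hn (hφ k) none) (formEmb hn (hψ k) none) := fun k => by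
    rw [inner_formEmb, add_sub_cancel_left]
  simp_rw [h1]
  exact (hg.inner hh).sub ((tendsto_none hg none).inner (tendsto_none hh none))

lemma formApprox_of_tendsto (hn : 3 ≤ n) {φ : ℕ → EuclideanSpace ℝ (Fin n) → ℂ}
    (hφ : ∀ k, IsTestFun (φ k)) {g : GraphSpace n}
    (hg : Tendsto (fun k => formEmb hn (hφ k)) atTop (𝓝 g)) : FormApprox φ (g none) := by
  refine ⟨hφ, (toLp_tendsto_iff hφ _).1 (tendsto_none hg none), ?_⟩
  have h1 : Tendsto (fun k : ℕ × ℕ => formEmb hn ((hφ k.1).sub (hφ k.2))) atTop (𝓝 0) := by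
    have h2 := (hg.comp tendsto_fst).sub (hg.comp (tendsto_snd (f := atTop (α := ℕ))))
    rw [sub_self, prod_atTop_atTop_eq] at h2
    exact h2.congr fun k => (formEmb_sub hn (hφ k.1) (hφ k.2)).symm
  have h2 := tendsto_hardyForm hn (fun k : ℕ × ℕ => (hφ k.1).sub (hφ k.2))
    (fun k : ℕ × ℕ => (hφ k.1).sub (hφ k.2)) h1 h1
  rwa [inner_zero_left, PiLp.zero_apply, inner_zero_left, sub_zero] at h2

lemma norm_sq_formEmb (hn : 3 ≤ n) {φ : EuclideanSpace ℝ (Fin n) → ℂ} (hφ : IsTestFun φ) :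
    ‖formEmb hn hφ‖ ^ 2 = ‖formEmb hn hφ none‖ ^ 2 + (hardyForm φ φ).re := by
  have h := congrArg Complex.re (inner_formEmb hn hφ hφ)
  rw [Complex.add_re] at h
  rw [← inner_self_eq_norm_sq (𝕜 := ℂ) (formEmb hn hφ), ← inner_self_eq_norm_sq (𝕜 := ℂ)]
  exact h

/-- Being Cauchy in `L²` and for the form is being Cauchy in `GraphSpace n`, and `formSpace hn` is
complete. -/
lemma FormApprox.exists_tendsto (hn : 3 ≤ n) {φ : ℕ → EuclideanSpace ℝ (Fin n) → ℂ} {u : L2 n}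
    (h : FormApprox φ u) : ∃ g : formSpace hn, formIncl hn g = u ∧
      Tendsto (fun k => formEmb hn (h.1 k)) atTop (𝓝 (g : GraphSpace n)) := by
  obtain ⟨hφ, h1, h2⟩ := h
  have hu := (toLp_tendsto_iff hφ u).2 h1
  have hcau : CauchySeq fun k => formEmb hn (hφ k) := by
    rw [cauchySeq_iff_tendsto_dist_atTop_0]
    have h3 := cauchySeq_iff_tendsto_dist_atTop_0.1 hu.cauchySeq
    have h4 : ∀ k : ℕ × ℕ, dist (formEmb hn (hφ k.1)) (formEmb hn (hφ k.2)) =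
        √(dist (((hφ k.1).memLp 2).toLp : L2 n) ((hφ k.2).memLp 2).toLp ^ 2 +
          (hardyForm (φ k.1 - φ k.2) (φ k.1 - φ k.2)).re) := fun k => by
      rw [dist_eq_norm, dist_eq_norm, ← formEmb_sub, ← MemLp.toLp_sub,
        ← Real.sqrt_sq (norm_nonneg (formEmb hn _)), norm_sq_formEmb]
      rfl
    simp_rw [h4]
    have h5 := ((h3.pow 2).add ((Complex.continuous_re.tendsto _).comp h2)).sqrt
    simpa using h5
  obtain ⟨g, hg⟩ := cauchySeq_tendsto_of_complete hcau
  refine ⟨⟨g, (Submodule.isClosed_topologicalClosure _).mem_of_tendsto hg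
    (Eventually.of_forall fun k => formEmb_mem hn (hφ k))⟩, ?_, hg⟩
  exact tendsto_nhds_unique (tendsto_none hg none) hu

/-- The form is closable. -/
lemma formIncl_injective (hn : 3 ≤ n) : Function.Injective (formIncl hn) := by
  rw [injective_iff_map_eq_zero]
  intro g hg
  have hi : ∀ i : Fin n, (g : GraphSpace n) (some i) = 0 := fun i => by
    have hG : LocallyIntegrable ((g : GraphSpace n) (some i)) :=
      (Lp.memLp ((g : GraphSpace n) (some i))).locallyIntegrable (by norm_num)
    have hcs : Continuous fun x : EuclideanSpace ℝ (Fin n) => ‖x‖ ^ 2 := by fun_prop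
    have h0 := ae_eq_zero_of_integral_contDiff_smul_eq_zero (hG.continuous_smul hcs)
      fun η hη hηc => by
        set χ : EuclideanSpace ℝ (Fin n) → ℂ := fun x => (η x : ℂ) with hχdef
        have hχ : IsTestFun χ := ⟨Complex.ofRealCLM.contDiff.comp hη,
          hηc.comp_left (g := Complex.ofReal) Complex.ofReal_zero⟩
        -- The factor `|x|²` cancels the singular coefficient `xᵢ/|x|²`. Pairing a gradient
        -- component with `U` then equals pairing `φ` itself with the test function `V`.
        set U : EuclideanSpace ℝ (Fin n) → ℂ := fun x => ((‖x‖ ^ 2 : ℝ) : ℂ) * χ x with hUdef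
        have hU : IsTestFun U := hχ.mul_left
          (Complex.ofRealCLM.contDiff.comp (contDiff_norm_sq ℝ))
        set V : EuclideanSpace ℝ (Fin n) → ℂ := fun x =>
          ((hardyC n * x i : ℝ) : ℂ) * χ x - fderiv ℝ U x (EuclideanSpace.single i 1) with hVdef
        have hV : IsTestFun V := (hχ.mul_left (Complex.ofRealCLM.contDiff.comp
          (contDiff_const.mul (EuclideanSpace.proj (𝕜 := ℝ) i).contDiff))).sub (hU.fderiv_apply _)
        have hUc : ∀ x, conj (U x) = U x := fun x => by simp [hUdef, hχdef]
        have hkey : ∀ (φ : EuclideanSpace ℝ (Fin n) → ℂ) (hφ : IsTestFun φ),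
            inner ℂ ((hU.memLp 2).toLp : L2 n) (formEmb hn hφ (some i)) =
            inner ℂ ((hV.memLp 2).toLp : L2 n) (formEmb hn hφ none) := fun φ hφ => by
          rw [formEmb_some, formEmb_none, inner_toLp_toLp, inner_toLp_toLp]
          have hUd : ∀ x v, conj (fderiv ℝ U x v) = fderiv ℝ U x v := fun x v => by
            rw [← hU.fderiv_conj]
            simp_rw [hUc]
          have hI1 : Integrable fun x => U x * fderiv ℝ φ x (EuclideanSpace.single i 1) :=
            ((hφ.fderiv_apply _).mul_left hU.1).integrable
          have hI2 : Integrable fun x => fderiv ℝ U x (EuclideanSpace.single i 1) * φ x :=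
            (hφ.mul_left (hU.fderiv_apply _).1).integrable
          have hI3 : Integrable fun x => ((hardyC n * x i : ℝ) : ℂ) * χ x * φ x :=
            (hφ.mul_left (hχ.mul_left (Complex.ofRealCLM.contDiff.comp
              (contDiff_const.mul (EuclideanSpace.proj (𝕜 := ℝ) i).contDiff))).1).integrable
          have hibp := integral_mul_fderiv_eq_neg_fderiv_mul_of_integrable hI2 hI1
            (hφ.mul_left hU.1).integrable (fun x _ => hU.differentiable x)
            fun x _ => hφ.differentiable x
          calc ∫ x, conj (U x) * hardyGrad φ i x
              = ∫ x, (U x * fderiv ℝ φ x (EuclideanSpace.single i 1) +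
                ((hardyC n * x i : ℝ) : ℂ) * χ x * φ x) := by
                refine integral_congr_ae ?_
                filter_upwards [ae_ne_zero hn] with x hx
                have h1 : (‖x‖ : ℂ) ≠ 0 := by simpa using hx
                rw [hUc, hardyGrad]
                simp only [hUdef]
                push_cast
                field_simp
            _ = ∫ x, (((hardyC n * x i : ℝ) : ℂ) * χ x * φ x -
                fderiv ℝ U x (EuclideanSpace.single i 1) * φ x) := by
                rw [integral_add hI1 hI3, integral_sub hI3 hI2, hibp]
                ring
            _ = ∫ x, conj (V x) * φ x := by
                refine integral_congr_ae (ae_of_all _ fun x => ?_)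
                simp only [hVdef, map_sub, hUd, map_mul, Complex.conj_ofReal, hχdef]
                ring
        -- The identity `hkey` is continuous in the graph norm, so it survives in the closure. When
        -- the `L²` component vanishes, `|x|²` times each gradient component is orthogonal to all
        -- test functions.
        have hclosed : inner ℂ ((hU.memLp 2).toLp : L2 n) ((g : GraphSpace n) (some i)) =
            inner ℂ ((hV.memLp 2).toLp : L2 n) ((g : GraphSpace n) none) := by
          obtain ⟨φ, hφ, hlim⟩ := exists_tendsto_formEmb hn g
          refine tendsto_nhds_unique (tendsto_const_nhds.inner (tendsto_none hlim (some i))) ?_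
          simp_rw [hkey]
          exact tendsto_const_nhds.inner (tendsto_none hlim none)
        rw [← formIncl_apply, hg, inner_zero_right, L2.inner_def] at hclosed
        rw [← hclosed]
        refine integral_congr_ae ?_
        filter_upwards [(hU.memLp 2).coeFn_toLp] with x hx
        rw [hx, RCLike.inner_apply, hUc]
        simp only [hUdef, hχdef, Complex.real_smul]
        ring
    rw [Lp.eq_zero_iff_ae_eq_zero]
    filter_upwards [h0, ae_ne_zero hn] with x hx hx0
    have : ‖x‖ ^ 2 ≠ 0 := by positivity
    exact (smul_eq_zero.1 hx).resolve_left this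
  ext1
  ext1 o
  rcases o with _ | i
  · exact hg
  · exact hi i

/-- `(H₀ + 1)⁻¹ = J J*` with `J` the inclusion of the form domain. -/
lemma mem_hardyGraph_iff (hn : 3 ≤ n) (f u : L2 n) :
    (u, f - u) ∈ hardyGraph n ↔ formIncl hn ((formIncl hn).adjoint f) = u := by
  have hdom : ∀ g : formSpace hn, MemFormDomain (formIncl hn g) := fun g => by
    obtain ⟨φ, hφ, hlim⟩ := exists_tendsto_formEmb hn g
    exact ⟨φ, formApprox_of_tendsto hn hφ hlim⟩
  constructor
  · rintro ⟨⟨φ, hφ⟩, h⟩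
    obtain ⟨g, rfl, -⟩ := hφ.exists_tendsto hn
    congr 1
    refine ext_inner_left ℂ fun k => ?_
    obtain ⟨χ, ψ, hχ, hψ, hlim⟩ := h (formIncl hn k) (hdom k)
    obtain ⟨k', hk', hk⟩ := hχ.exists_tendsto hn
    obtain ⟨g', hg', hg⟩ := hψ.exists_tendsto hn
    -- By injectivity of `J`, the approximating sequences supplied by `ClosedFormEq` converge to the
    -- already chosen lifts. The equation for the form then reads `⟨k, g⟩ = ⟨J k, f⟩`, that is, `g =
    -- J* f`.
    obtain rfl := formIncl_injective hn hk'
    obtain rfl := formIncl_injective hn hg'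
    have h1 := tendsto_nhds_unique hlim (tendsto_hardyForm hn hχ.1 hψ.1 hk hg)
    simp only [inner_sub_right] at h1
    rw [ContinuousLinearMap.adjoint_inner_right]
    have h2 := sub_left_injective h1
    rw [h2, Submodule.coe_inner]
  · rintro rfl
    refine ⟨hdom _, ?_⟩
    rintro v ⟨χ, hχ⟩
    obtain ⟨k, rfl, hk⟩ := hχ.exists_tendsto hn
    obtain ⟨φ, hφ, hlim⟩ := exists_tendsto_formEmb hn ((formIncl hn).adjoint f)
    refine ⟨χ, φ, hχ, formApprox_of_tendsto hn hφ hlim, ?_⟩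
    convert tendsto_hardyForm hn hχ.1 hφ hk hlim using 2
    rw [inner_sub_right]
    exact congrArg (· - _) (ContinuousLinearMap.adjoint_inner_right (formIncl hn) k f).symm

lemma exists_isPositive_mul_self {H : Type*} [NormedAddCommGroup H] [InnerProductSpace ℂ H]
    [CompleteSpace H] {A : H →L[ℂ] H} (hA : A.IsPositive) :
    ∃ S : H →L[ℂ] H, S.IsPositive ∧ ∀ f, S (S f) = A f := by
  rw [← ContinuousLinearMap.nonneg_iff_isPositive] at hA
  refine ⟨CFC.sqrt A, (ContinuousLinearMap.nonneg_iff_isPositive _).1 (CFC.sqrt_nonneg A),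
    fun f => ?_⟩
  exact congrArg (fun T : H →L[ℂ] H => T f) (CFC.sqrt_mul_sqrt_self A hA)

lemma exists_isInvSqrtAddOne_of_adjoint {H K : Type*} [NormedAddCommGroup H]
    [InnerProductSpace ℂ H] [CompleteSpace H] [NormedAddCommGroup K] [InnerProductSpace ℂ K]
    [CompleteSpace K] (J : K →L[ℂ] H) {G : Set (H × H)}
    (hG : ∀ f u, (u, f - u) ∈ G ↔ J (J.adjoint f) = u) :
    ∃ S : H →L[ℂ] H, IsInvSqrtAddOne G S ∧ ∀ f, S (S f) = J (J.adjoint f) := by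
  obtain ⟨S, hS, hSS⟩ :=
    exists_isPositive_mul_self (ContinuousLinearMap.isPositive_self_comp_adjoint J)
  exact ⟨S, ⟨hS, fun f u => by rw [hG, hSS]; rfl⟩, hSS⟩

/-- The operator `(H₀ + 1)^{-1/2}` exists. -/
lemma exists_isInvSqrtAddOne_hardyGraph (hn : 3 ≤ n) :
    ∃ S : L2 n →L[ℂ] L2 n, IsInvSqrtAddOne (hardyGraph n) S ∧
      ∀ f, S (S f) = formIncl hn ((formIncl hn).adjoint f) :=
  exists_isInvSqrtAddOne_of_adjoint (formIncl hn) (mem_hardyGraph_iff hn)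

end FormSpace

/-! ### The weighted estimate for test functions -/

section WeightedEstimate

variable {n : ℕ}

lemma norm_sq_toLp {f : EuclideanSpace ℝ (Fin n) → ℂ} (hf : MemLp f 2 volume) :
    ‖(hf.toLp : L2 n)‖ ^ 2 = ∫ x, ‖f x‖ ^ 2 := by
  rw [norm_sq_eq_integral]
  refine integral_congr_ae ?_
  filter_upwards [hf.coeFn_toLp] with x hx
  rw [hx]

/-- Duality between `H¹` and `H⁻¹`. -/
lemma IsTestFun.norm_inner_sq_le {η : EuclideanSpace ℝ (Fin n) → ℂ} (hη : IsTestFun η) (f : L2 n) :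
    ‖inner ℂ ((hη.memLp 2).toLp : L2 n) f‖ ^ 2 ≤
      ((∫ x, ‖η x‖ ^ 2) + ∑ i, ∫ x, ‖fderiv ℝ η x (EuclideanSpace.single i 1)‖ ^ 2) *
        ‖japaneseD n 1 f‖ ^ 2 := by
  set u : 𝓢(EuclideanSpace ℝ (Fin n), ℂ) := hη.2.toSchwartzMap hη.1 with hu
  set U : L2 n := (hη.memLp 2).toLp with hU
  have hUu : U = u.toLp 2 := rfl
  -- With `g = (1 - Δ)η` one has `⟨D⟩^{-2} g = η`. Hence `⟨η, f⟩ = ⟨⟨D⟩^{-1} g, ⟨D⟩^{-1} f⟩`, and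
  -- `‖⟨D⟩^{-1} g‖² = ⟨g, η⟩` is the squared `H¹` norm of `η`.
  set g : L2 n := U - (Δ u).toLp 2 with hg
  obtain ⟨hpos, hinv⟩ := isInvSqrtAddOne_japaneseD (n := n)
  have h1 : japaneseD n 1 (japaneseD n 1 g) = U := by
    rw [hinv]
    change Lp.toTemperedDistribution (g - U) = -Δ (Lp.toTemperedDistribution U)
    rw [hg, sub_sub_cancel_left, hUu, Lp.toTemperedDistribution_toLp_eq,
      TemperedDistribution.laplacian_toTemperedDistributionCLM_eq,
      ← Lp.toTemperedDistribution_toLp_eq (p := 2)]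
    exact map_neg (Lp.toTemperedDistributionCLM ℂ volume 2) _
  have hsym : ∀ a b : L2 n, inner ℂ (japaneseD n 1 a) b = inner ℂ a (japaneseD n 1 b) :=
    hpos.isSymmetric
  have h2 : inner ℂ U f = inner ℂ (japaneseD n 1 g) (japaneseD n 1 f) := by
    rw [← h1, hsym]
  have hd : ∀ i : Fin n, IsTestFun fun x => fderiv ℝ η x (EuclideanSpace.single i 1) :=
    fun i => hη.fderiv_apply _
  have hΔ : ∀ x, (Δ u) x = ∑ i : Fin n, fderiv ℝ (fun y => fderiv ℝ η y (EuclideanSpace.single i 1))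
      x (EuclideanSpace.single i 1) := fun x => by
    rw [SchwartzMap.laplacian_eq_sum (EuclideanSpace.basisFun (Fin n) ℝ), sum_apply]
    refine Finset.sum_congr rfl fun i _ => ?_
    rw [EuclideanSpace.basisFun_apply, SchwartzMap.lineDerivOp_apply_eq_fderiv]
    rfl
  have hibp : ∀ i : Fin n, ∫ x, conj (η x) * fderiv ℝ (fun y => fderiv ℝ η y
      (EuclideanSpace.single i 1)) x (EuclideanSpace.single i 1) =
      -((∫ x, ‖fderiv ℝ η x (EuclideanSpace.single i 1)‖ ^ 2 : ℝ) : ℂ) := fun i => by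
    have h3 : Integrable fun x => fderiv ℝ (fun x => conj (η x)) x (EuclideanSpace.single i 1) *
        fderiv ℝ η x (EuclideanSpace.single i 1) :=
      ((hd i).mul_left (hη.conj.fderiv_apply _).1).integrable
    rw [integral_mul_fderiv_eq_neg_fderiv_mul_of_integrable h3
      (hη.conj_mul ((hd i).fderiv_apply _)).integrable (hη.conj_mul (hd i)).integrable
      (fun x _ => hη.conj.differentiable x) fun x _ => (hd i).differentiable x]
    refine congrArg Neg.neg (Eq.trans ?_ (integral_ofReal (𝕜 := ℂ)))
    refine integral_congr_ae (ae_of_all _ fun x => ?_)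
    simp only [hη.fderiv_conj]
    rw [Complex.conj_mul']
    push_cast
    rfl
  have h3 : ‖japaneseD n 1 g‖ ^ 2 =
      (∫ x, ‖η x‖ ^ 2) + ∑ i, ∫ x, ‖fderiv ℝ η x (EuclideanSpace.single i 1)‖ ^ 2 := by
    have h4 : inner ℂ U ((Δ u).toLp 2) =
        -((∑ i, ∫ x, ‖fderiv ℝ η x (EuclideanSpace.single i 1)‖ ^ 2 : ℝ) : ℂ) := by
      rw [hU, SchwartzMap.toLp, inner_toLp_toLp]
      simp_rw [hΔ, Finset.mul_sum]
      rw [integral_finsetSum _ fun i _ => (hη.conj_mul ((hd i).fderiv_apply _)).integrable]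
      simp_rw [hibp]
      push_cast
      rw [Finset.sum_neg_distrib]
    have h5 : inner ℂ (japaneseD n 1 g) (japaneseD n 1 g) = inner ℂ U U +
        ((∑ i, ∫ x, ‖fderiv ℝ η x (EuclideanSpace.single i 1)‖ ^ 2 : ℝ) : ℂ) := by
      rw [← hsym, h1, ← sub_neg_eq_add, ← h4, ← inner_sub_right]
    have h6 := congrArg Complex.re h5
    rw [Complex.add_re, Complex.ofReal_re] at h6
    rw [← norm_sq_toLp (hη.memLp 2), ← inner_self_eq_norm_sq (𝕜 := ℂ) (japaneseD n 1 g),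
      ← inner_self_eq_norm_sq (𝕜 := ℂ) U]
    exact h6
  rw [h2, ← h3, ← mul_pow]
  gcongr
  exact norm_inner_le_norm _ _

lemma norm_sq_formEmb_eq (hn : 3 ≤ n) {φ : EuclideanSpace ℝ (Fin n) → ℂ} (hφ : IsTestFun φ) :
    ‖formEmb hn hφ‖ ^ 2 = ∫ x, (‖φ x‖ ^ 2 + ∑ i, ‖hardyGrad φ i x‖ ^ 2) := by
  rw [PiLp.norm_sq_eq_of_L2, Fintype.sum_option, formEmb_none, norm_sq_toLp, integral_add
    ((memLp_two_iff_integrable_sq_norm (hφ.memLp 2).1).1 (hφ.memLp 2))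
    (integrable_finsetSum _ fun i _ => (memLp_two_iff_integrable_sq_norm
      (memLp_hardyGrad hn hφ i).1).1 (memLp_hardyGrad hn hφ i)), integral_finsetSum _ fun i _ =>
    (memLp_two_iff_integrable_sq_norm (memLp_hardyGrad hn hφ i).1).1 (memLp_hardyGrad hn hφ i)]
  congr 1
  exact Finset.sum_congr rfl fun i _ => norm_sq_toLp (memLp_hardyGrad hn hφ i)

lemma integrable_formEmb (hn : 3 ≤ n) {φ : EuclideanSpace ℝ (Fin n) → ℂ} (hφ : IsTestFun φ) :
    Integrable fun x => ‖φ x‖ ^ 2 + ∑ i, ‖hardyGrad φ i x‖ ^ 2 :=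
  ((memLp_two_iff_integrable_sq_norm (hφ.memLp 2).1).1 (hφ.memLp 2)).add
    (integrable_finsetSum _ fun i _ => (memLp_two_iff_integrable_sq_norm
      (memLp_hardyGrad hn hφ i).1).1 (memLp_hardyGrad hn hφ i))

lemma integrable_zfun_div_mul_norm_sq (hn : 3 ≤ n) {ε : ℝ} (hε : 0 ≤ ε)
    {φ : EuclideanSpace ℝ (Fin n) → ℂ} (hφ : IsTestFun φ) :
    Integrable fun x => zfun ε (‖x‖ ^ 2) / ‖x‖ ^ 2 * ‖φ x‖ ^ 2 := by
  have hz := measurable_zfun ε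
  have h := (integrable_smul_of_le_inv_norm_sq hn (hφ.conj_mul hφ).continuous (hφ.conj_mul hφ).2
    (k := fun x => zfun ε (‖x‖ ^ 2) / ‖x‖ ^ 2) (by fun_prop) (M := 1) fun x hx => by
      rw [abs_of_nonneg (div_nonneg (zfun_nonneg (by positivity)) (by positivity)), one_mul,
        inv_eq_one_div]
      gcongr
      exact zfun_le_one hε (by positivity)).norm
  refine h.congr (ae_of_all _ fun x => ?_)
  simp only
  rw [norm_smul, norm_mul, RCLike.norm_conj, Real.norm_of_nonneg
    (div_nonneg (zfun_nonneg (by positivity)) (by positivity)), sq ‖φ x‖]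

lemma two_mul_re_conj_mul_ge {ε : ℝ} (hε : 0 < ε) (a b : ℂ) (p : ℝ) :
    -(ε * p ^ 2 * ‖a‖ ^ 2 + ‖b‖ ^ 2 / ε) ≤ 2 * (p * (conj a * b).re) := by
  have h1 : |(conj a * b).re| ≤ ‖a‖ * ‖b‖ := by
    rw [← RCLike.norm_conj a, ← norm_mul]
    exact Complex.abs_re_le_norm _
  have h2 : |p * (conj a * b).re| ≤ |p| * (‖a‖ * ‖b‖) := by
    rw [abs_mul]; gcongr
  have h3 : 0 ≤ (ε * (|p| * ‖a‖) - ‖b‖) ^ 2 / ε := by positivity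
  have h4 : (ε * (|p| * ‖a‖) - ‖b‖) ^ 2 / ε =
      ε * p ^ 2 * ‖a‖ ^ 2 + ‖b‖ ^ 2 / ε - 2 * (|p| * (‖a‖ * ‖b‖)) := by
    rw [← sq_abs p]; field_simp; ring
  have := neg_abs_le (p * (conj a * b).re)
  linarith

/-- Hardy's inequality with a weight that vanishes at the origin. -/
lemma integral_zfun_div_mul_norm_sq_le (hn : 3 ≤ n) {ε : ℝ} (hε : 0 < ε) (hε1 : ε ≤ 1)
    {φ : EuclideanSpace ℝ (Fin n) → ℂ} (hφ : IsTestFun φ) :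
    ∫ x, zfun ε (‖x‖ ^ 2) / ‖x‖ ^ 2 * ‖φ x‖ ^ 2 ≤ 2 / ε ^ 2 * ‖formEmb hn hφ‖ ^ 2 := by
  have hz := measurable_zfun ε
  set F : EuclideanSpace ℝ (Fin n) → ℂ := fun x => conj (φ x) * φ x with hFdef
  have hF : IsTestFun F := hφ.conj_mul hφ
  have hcont : Continuous fun x => fderiv ℝ F x x :=
    (hF.1.continuous_fderiv (by simp)).clm_apply continuous_id
  have hcs : HasCompactSupport fun x => fderiv ℝ F x x := by
    refine (hF.2.fderiv ℝ).mono fun x hx h0 => hx ?_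
    simp [h0]
  have hz1 : ∀ x : EuclideanSpace ℝ (Fin n), |zfun ε (‖x‖ ^ 2) / ‖x‖ ^ 2| ≤ (‖x‖ ^ 2)⁻¹ := fun x => by
    rw [abs_of_nonneg (div_nonneg (zfun_nonneg (by positivity)) (by positivity)), inv_eq_one_div]
    gcongr
    exact zfun_le_one hε.le (by positivity)
  have hint1 : Integrable fun x => (zfun ε (‖x‖ ^ 2) / ‖x‖ ^ 2) • fderiv ℝ F x x :=
    integrable_smul_of_le_inv_norm_sq hn hcont hcs (by fun_prop) (M := 1) fun x _ => by
      simpa using hz1 x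
  have hint2 : Integrable fun x =>
      ((zfun ε (‖x‖ ^ 2) / ‖x‖ ^ 2) * (n - 2 + 2 * ε / (1 + ‖x‖ ^ 2))) • F x :=
    integrable_smul_of_le_inv_norm_sq hn hF.continuous hF.2 (by fun_prop) (M := n + 2 * ε)
      fun x _ => by
        have h1 : 0 ≤ 2 * ε / (1 + ‖x‖ ^ 2) := by positivity
        have h2 : 2 * ε / (1 + ‖x‖ ^ 2) ≤ 2 * ε :=
          div_le_self (by positivity) (by nlinarith [sq_nonneg ‖x‖])
        have h3 : (3 : ℝ) ≤ n := by exact_mod_cast hn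
        rw [abs_mul, mul_comm]
        refine mul_le_mul ?_ (hz1 x) (abs_nonneg _) (by positivity)
        rw [abs_of_nonneg (by linarith)]
        linarith
  have hzero : ∫ x, ((zfun ε (‖x‖ ^ 2) / ‖x‖ ^ 2) • fderiv ℝ F x x +
      ((zfun ε (‖x‖ ^ 2) / ‖x‖ ^ 2) * (n - 2 + 2 * ε / (1 + ‖x‖ ^ 2))) • F x) = 0 := by
    rw [integral_add hint1 hint2, integral_radial_ibp hn hε.le hF, neg_add_cancel]
  set A : EuclideanSpace ℝ (Fin n) → ℝ := fun x =>
    ((zfun ε (‖x‖ ^ 2) / ‖x‖ ^ 2) • fderiv ℝ F x x +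
      ((zfun ε (‖x‖ ^ 2) / ‖x‖ ^ 2) * (n - 2 + 2 * ε / (1 + ‖x‖ ^ 2))) • F x).re with hA
  have hreI : Integrable A := (hint1.add hint2).re
  have hre : ∫ x, A x = 0 := by
    have h : ∫ x, A x = _ := integral_re (hint1.add hint2)
    rw [h]
    simp only [Pi.add_apply]
    rw [hzero]
    rfl
  -- Adding `ε⁻¹` times the vanishing integral of `A` to the right-hand side reduces the claim to a
  -- pointwise inequality.
  rw [norm_sq_formEmb_eq, ← integral_const_mul, ← add_zero (∫ x, 2 / ε ^ 2 * _),
    ← mul_zero ε⁻¹, ← hre, ← integral_const_mul,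
    ← integral_add ((integrable_formEmb hn hφ).const_mul _) (hreI.const_mul _)]
  refine integral_mono_ae (integrable_zfun_div_mul_norm_sq hn hε.le hφ)
    (((integrable_formEmb hn hφ).const_mul _).add (hreI.const_mul _)) ?_
  filter_upwards [ae_ne_zero hn] with x hx
  have ht : 0 < ‖x‖ ^ 2 := by positivity
  have hxr := EuclideanSpace.real_norm_sq_eq x
  set t := ‖x‖ ^ 2 with htdef
  set z := zfun ε t with hzdef
  have hz0 : 0 ≤ z := zfun_nonneg ht.le
  have hzle : z ≤ 1 := zfun_le_one hε.le ht.le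
  have h3 : fderiv ℝ F x x = ∑ i, (x i : ℂ) * (conj (fderiv ℝ φ x (EuclideanSpace.single i 1)) * φ x
      + conj (φ x) * fderiv ℝ φ x (EuclideanSpace.single i 1)) := by
    rw [fderiv_apply_self]
    refine Finset.sum_congr rfl fun i _ => ?_
    rw [hφ.fderiv_conj_mul hφ, Complex.real_smul]
  have hφx : F x = ((‖φ x‖ ^ 2 : ℝ) : ℂ) := by
    simp only [hFdef]
    rw [Complex.conj_mul']
    push_cast
    rfl
  -- In terms of `hardyGrad` the radial derivative of `|φ|²` produces `-(n-2)|φ|²`. It cancels the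
  -- `n - 2` from the divergence, and only the positive term coming from the weight `z` is left.
  have h4 : (fderiv ℝ F x x).re =
      ∑ i, 2 * (x i * (conj (φ x) * hardyGrad φ i x).re) - (n - 2) * ‖φ x‖ ^ 2 := by
    have h5 : ∀ i : Fin n, ((x i : ℂ) * (conj (fderiv ℝ φ x (EuclideanSpace.single i 1)) * φ x
      + conj (φ x) * fderiv ℝ φ x (EuclideanSpace.single i 1))).re =
      2 * (x i * (conj (φ x) * hardyGrad φ i x).re) - x i ^ 2 * ((n - 2) * ‖φ x‖ ^ 2 / t) :=
      fun i => by
        have h6 : (conj (φ x) * (((hardyC n * x i / t : ℝ) : ℂ) * φ x)).re =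
            hardyC n * x i / t * ‖φ x‖ ^ 2 := by
          rw [mul_left_comm, Complex.re_ofReal_mul]
          exact congrArg _ ((congrArg Complex.re hφx).trans (Complex.ofReal_re _))
        have h7 : (conj (fderiv ℝ φ x (EuclideanSpace.single i 1)) * φ x).re =
            (conj (φ x) * fderiv ℝ φ x (EuclideanSpace.single i 1)).re := by
          simp; ring
        rw [Complex.re_ofReal_mul, Complex.add_re, h7, hardyGrad, mul_add (conj (φ x)),
          Complex.add_re, h6, hardyC]
        field_simp
        ring
    rw [h3, Complex.re_sum, Finset.sum_congr rfl fun i _ => h5 i, Finset.sum_sub_distrib,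
      ← Finset.sum_mul, ← hxr]
    field_simp
  have h5 : (z / t) * ∑ i, 2 * (x i * (conj (φ x) * hardyGrad φ i x).re) ≥
      -(ε * (z / t) * ‖φ x‖ ^ 2 + z / ε * ∑ i, ‖hardyGrad φ i x‖ ^ 2) := by
    have h6 : ∀ i : Fin n, (z / t) * (2 * (x i * (conj (φ x) * hardyGrad φ i x).re)) ≥
        -(x i ^ 2 * (ε * z / t ^ 2 * ‖φ x‖ ^ 2) + z / ε * ‖hardyGrad φ i x‖ ^ 2) := fun i => by
      have h7 := mul_le_mul_of_nonneg_left
        (two_mul_re_conj_mul_ge hε (φ x) (hardyGrad φ i x) (x i / t)) hz0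
      refine le_trans (le_of_eq ?_) (h7.trans (le_of_eq ?_)) <;> · field_simp
    rw [Finset.mul_sum]
    refine le_trans (le_of_eq ?_) (Finset.sum_le_sum fun i _ => h6 i)
    rw [Finset.sum_neg_distrib, Finset.sum_add_distrib, ← Finset.sum_mul, ← Finset.mul_sum, ← hxr]
    field_simp
  set a := ‖φ x‖ ^ 2 with ha
  set b := ∑ i, ‖hardyGrad φ i x‖ ^ 2 with hb
  have ha0 : 0 ≤ a := by positivity
  have hb0 : 0 ≤ b := Finset.sum_nonneg fun i _ => by positivity
  simp only [hA, Complex.add_re, Complex.real_smul, Complex.re_ofReal_mul, h4, hφx,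
    Complex.ofReal_re]
  set s := ∑ i, 2 * (x i * (conj (φ x) * hardyGrad φ i x).re) with hs
  -- The partial fraction `1/(t(1+t)) = 1/t - 1/(1+t)` yields twice the wanted quantity, up to an
  -- `L²` term. Young's inequality `h5` spends one copy, leaving one.
  have e1 : z / t * a = 2 * (z / (t * (1 + t)) * a) + 2 * (z / (1 + t) * a) - z / t * a := by
    field_simp; ring
  have e2 : ε⁻¹ * (z / t * (s - (n - 2) * a) + z / t * (n - 2 + 2 * ε / (1 + t)) * a) =
      ε⁻¹ * (z / t * s) + 2 * (z / (t * (1 + t)) * a) := by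
    field_simp; ring
  have e3 : z / (1 + t) * a ≤ a :=
    mul_le_of_le_one_left ha0 ((div_le_one (by positivity)).2 (by linarith))
  have e4 : ε⁻¹ * (z / t * s) ≥ -(z / t * a) - z / ε ^ 2 * b := by
    refine le_trans (le_of_eq ?_) (mul_le_mul_of_nonneg_left h5 (inv_nonneg.2 hε.le))
    field_simp
    ring
  have e5 : z / ε ^ 2 * b ≤ 2 / ε ^ 2 * b := by gcongr; linarith
  have e6 : 2 * a ≤ 2 / ε ^ 2 * a := by
    gcongr
    rw [le_div_iff₀ (by positivity)]
    nlinarith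
  rw [e2]
  linarith

end WeightedEstimate

/-! ### Cutting off the origin -/

section Cutoff

variable {n : ℕ}

/-- The derivative `∂ᵢ((t / (1 + t))^(ε/2) φ)`, with `t = |x|² + δ`. -/
def cutGrad (ε δ : ℝ) (φ : EuclideanSpace ℝ (Fin n) → ℂ) (i : Fin n)
    (x : EuclideanSpace ℝ (Fin n)) : ℂ :=
  zfun (ε / 2) (‖x‖ ^ 2 + δ) • fderiv ℝ φ x (EuclideanSpace.single i 1) +
    (ε * zfun (ε / 2) (‖x‖ ^ 2 + δ) * x i / ((‖x‖ ^ 2 + δ) * (1 + (‖x‖ ^ 2 + δ)))) • φ x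

lemma IsTestFun.zfun_smul {φ : EuclideanSpace ℝ (Fin n) → ℂ} (hφ : IsTestFun φ) (ε : ℝ) {δ : ℝ}
    (hδ : 0 < δ) : IsTestFun fun x => zfun (ε / 2) (‖x‖ ^ 2 + δ) • φ x := by
  have h : ContDiff ℝ (⊤ : ℕ∞) fun x : EuclideanSpace ℝ (Fin n) => zfun (ε / 2) (‖x‖ ^ 2 + δ) :=
    contDiff_iff_contDiffAt.2 fun x => by
      have h1 : ContDiffAt ℝ (⊤ : ℕ∞) (fun x : EuclideanSpace ℝ (Fin n) => ‖x‖ ^ 2 + δ) x :=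
        ((contDiff_norm_sq ℝ).add contDiff_const).contDiffAt
      have h2 : 0 < ‖x‖ ^ 2 + δ := by positivity
      exact ContDiffAt.comp x (contDiffAt_zfun (ε / 2) h2) h1
  refine ⟨h.smul hφ.1, hφ.2.mono fun x hx h0 => hx ?_⟩
  simp only [h0, smul_zero]

lemma IsTestFun.fderiv_zfun_smul {φ : EuclideanSpace ℝ (Fin n) → ℂ} (hφ : IsTestFun φ) (ε : ℝ)
    {δ : ℝ} (hδ : 0 < δ) (i : Fin n) (x : EuclideanSpace ℝ (Fin n)) :
    fderiv ℝ (fun x => zfun (ε / 2) (‖x‖ ^ 2 + δ) • φ x) x (EuclideanSpace.single i 1) =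
      cutGrad ε δ φ i x := by
  have h1 : HasFDerivAt (fun x : EuclideanSpace ℝ (Fin n) => ‖x‖ ^ 2 + δ)
      (2 • (innerSL ℝ x)) x := (hasStrictFDerivAt_norm_sq x).hasFDerivAt.add_const δ
  have h2 := (hasDerivAt_zfun (ε / 2) (by positivity : 0 < ‖x‖ ^ 2 + δ)).comp_hasFDerivAt x h1
  have h3 : HasFDerivAt (fun x => zfun (ε / 2) (‖x‖ ^ 2 + δ) • φ x) _ x :=
    h2.smul (hφ.differentiable x).hasFDerivAt
  rw [h3.fderiv]
  have h4 : inner ℝ x (EuclideanSpace.single i (1 : ℝ)) = x i := by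
    simp [EuclideanSpace.inner_single_right]
  simp only [cutGrad, Function.comp_apply, add_apply, smul_apply, ContinuousLinearMap.smulRight_apply,
    innerSL_apply_apply, h4]
  congr 2
  simp only [smul_eq_mul, nsmul_eq_mul]
  push_cast
  ring

/-- The bound does not involve `δ`; it is the majorant for the limit `δ → 0`. -/
lemma norm_cutGrad_le {ε δ : ℝ} (hε : 0 ≤ ε) (hδ : 0 ≤ δ) (φ : EuclideanSpace ℝ (Fin n) → ℂ)
    (i : Fin n) {x : EuclideanSpace ℝ (Fin n)} (hx : x ≠ 0) :
    ‖cutGrad ε δ φ i x‖ ^ 2 ≤ 2 * ‖fderiv ℝ φ x (EuclideanSpace.single i 1)‖ ^ 2 +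
      2 * ε ^ 2 * ((‖x‖ ^ 2)⁻¹ * ‖φ x‖ ^ 2) := by
  have hr : 0 < ‖x‖ := norm_pos_iff.2 hx
  have hz0 : 0 ≤ zfun (ε / 2) (‖x‖ ^ 2 + δ) := zfun_nonneg (by positivity)
  have hz1 : zfun (ε / 2) (‖x‖ ^ 2 + δ) ≤ 1 := zfun_le_one (by positivity) (by positivity)
  have h1 : ‖cutGrad ε δ φ i x‖ ≤ ‖fderiv ℝ φ x (EuclideanSpace.single i 1)‖ +
      ε * (‖x‖⁻¹ * ‖φ x‖) := by
    refine (norm_add_le _ _).trans (add_le_add ?_ ?_)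
    · rw [norm_smul, Real.norm_of_nonneg hz0]
      exact mul_le_of_le_one_left (norm_nonneg _) hz1
    · rw [norm_smul, ← mul_assoc]
      refine mul_le_mul_of_nonneg_right ?_ (norm_nonneg _)
      rw [Real.norm_eq_abs, abs_div, abs_mul, abs_mul, abs_of_nonneg hε, abs_of_nonneg hz0,
        abs_of_nonneg (by positivity : 0 ≤ (‖x‖ ^ 2 + δ) * (1 + (‖x‖ ^ 2 + δ))),
        div_le_iff₀ (by positivity)]
      have h2 : ‖x‖ ≤ ‖x‖⁻¹ * ((‖x‖ ^ 2 + δ) * (1 + (‖x‖ ^ 2 + δ))) := by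
        rw [le_inv_mul_iff₀ hr]
        nlinarith [sq_nonneg (‖x‖ ^ 2 + δ)]
      calc ε * zfun (ε / 2) (‖x‖ ^ 2 + δ) * |x i| ≤ ε * 1 * ‖x‖ := by
            gcongr
            exact abs_coord_le x i
        _ ≤ _ := by
            rw [mul_one, mul_assoc]
            exact mul_le_mul_of_nonneg_left h2 hε
  calc ‖cutGrad ε δ φ i x‖ ^ 2 ≤ (‖fderiv ℝ φ x (EuclideanSpace.single i 1)‖ +
      ε * (‖x‖⁻¹ * ‖φ x‖)) ^ 2 := by gcongr
    _ ≤ 2 * (‖fderiv ℝ φ x (EuclideanSpace.single i 1)‖ ^ 2 + (ε * (‖x‖⁻¹ * ‖φ x‖)) ^ 2) :=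
      add_sq_le
    _ = _ := by rw [mul_pow, mul_pow, inv_pow]; ring

lemma integrable_cutGrad_bound (hn : 3 ≤ n) {φ : EuclideanSpace ℝ (Fin n) → ℂ} (hφ : IsTestFun φ)
    (ε : ℝ) (i : Fin n) : Integrable fun x =>
      2 * ‖fderiv ℝ φ x (EuclideanSpace.single i 1)‖ ^ 2 +
        2 * ε ^ 2 * ((‖x‖ ^ 2)⁻¹ * ‖φ x‖ ^ 2) := by
  have hG := hφ.conj_mul hφ
  refine Integrable.add ?_ (Integrable.const_mul ?_ _)
  · exact ((memLp_two_iff_integrable_sq_norm ((hφ.fderiv_apply _).memLp 2).1).1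
      ((hφ.fderiv_apply _).memLp 2)).const_mul 2
  · refine (integrable_inv_norm_sq_mul hn hG.continuous hG.2).congr (ae_of_all _ fun x => ?_)
    simp only
    rw [norm_mul, RCLike.norm_conj, sq ‖φ x‖]

lemma measurable_cutGrad {φ : EuclideanSpace ℝ (Fin n) → ℂ} (hφ : IsTestFun φ) (ε δ : ℝ)
    (i : Fin n) : Measurable (cutGrad ε δ φ i) := by
  have h1 := hφ.continuous.measurable
  have h2 := (hφ.fderiv_apply (EuclideanSpace.single i 1)).continuous.measurable
  have h3 := measurable_zfun (ε / 2)
  have h4 := measurable_coord i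
  unfold cutGrad
  fun_prop

lemma zfun_half_sq {ε t : ℝ} (ht : 0 ≤ t) : zfun (ε / 2) t ^ 2 = zfun ε t := by
  rw [zfun, zfun, ← Real.rpow_natCast, ← Real.rpow_mul (by positivity)]
  norm_num

/-- Writing `∂ᵢφ` through `hardyGrad` leaves a zero-order term with coefficient `(ε/(1+t) - c)
xᵢ/t`, at most `c + ε` times `|xᵢ|/t`. Its square carries the weight `χ²|x|⁻²` controlled by the
weighted Hardy inequality. -/
lemma sum_norm_cutGrad_sq_le {ε : ℝ} (hε : 0 ≤ ε) (hc : 0 ≤ hardyC n)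
    (φ : EuclideanSpace ℝ (Fin n) → ℂ) {x : EuclideanSpace ℝ (Fin n)} (hx : x ≠ 0) :
    ∑ i, ‖cutGrad ε 0 φ i x‖ ^ 2 ≤ 2 * ∑ i, ‖hardyGrad φ i x‖ ^ 2 +
      2 * (hardyC n + ε) ^ 2 * (zfun ε (‖x‖ ^ 2) / ‖x‖ ^ 2 * ‖φ x‖ ^ 2) := by
  have ht : 0 < ‖x‖ ^ 2 := by positivity
  have hxr := EuclideanSpace.real_norm_sq_eq x
  set t := ‖x‖ ^ 2 with htdef
  have hz0 : 0 ≤ zfun ε t := zfun_nonneg ht.le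
  have hz1 : zfun ε t ≤ 1 := zfun_le_one hε ht.le
  have h1 : ∀ i, ‖cutGrad ε 0 φ i x‖ ^ 2 ≤ 2 * ‖hardyGrad φ i x‖ ^ 2 +
      x i ^ 2 * (2 * (hardyC n + ε) ^ 2 * (zfun ε t / t ^ 2 * ‖φ x‖ ^ 2)) := fun i => by
    have h2 : cutGrad ε 0 φ i x = zfun (ε / 2) t • (hardyGrad φ i x +
        (((ε / (1 + t) - hardyC n) * (x i / t) : ℝ) : ℂ) * φ x) := by
      simp only [cutGrad, hardyGrad, Complex.real_smul, add_zero, ← htdef]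
      push_cast
      have h3 : (t : ℂ) ≠ 0 := by exact_mod_cast ht.ne'
      have h4 : (1 + t : ℂ) ≠ 0 := by exact_mod_cast (by positivity : 1 + t ≠ 0)
      field_simp
      ring
    have h5 : (ε / (1 + t) - hardyC n) ^ 2 ≤ (hardyC n + ε) ^ 2 := by
      have h6 : ε / (1 + t) ≤ ε := div_le_self hε (by linarith)
      have h7 : 0 ≤ ε / (1 + t) := by positivity
      exact sq_le_sq' (by linarith) (by linarith)
    rw [h2, norm_smul, mul_pow, Real.norm_eq_abs, sq_abs, zfun_half_sq ht.le]
    calc zfun ε t * ‖hardyGrad φ i x + (((ε / (1 + t) - hardyC n) * (x i / t) : ℝ) : ℂ) * φ x‖ ^ 2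
        ≤ zfun ε t * (2 * (‖hardyGrad φ i x‖ ^ 2 +
          ‖(((ε / (1 + t) - hardyC n) * (x i / t) : ℝ) : ℂ) * φ x‖ ^ 2)) := by
          gcongr
          refine le_trans ?_ add_sq_le
          gcongr
          exact norm_add_le _ _
      _ = zfun ε t * (2 * ‖hardyGrad φ i x‖ ^ 2) + x i ^ 2 * (2 * (ε / (1 + t) - hardyC n) ^ 2 *
          (zfun ε t / t ^ 2 * ‖φ x‖ ^ 2)) := by
          rw [norm_mul, Complex.norm_real, Real.norm_eq_abs, mul_pow, sq_abs]
          field_simp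
      _ ≤ _ := by
          refine add_le_add (mul_le_of_le_one_left (by positivity) hz1) ?_
          gcongr
  refine (Finset.sum_le_sum fun i _ => h1 i).trans (le_of_eq ?_)
  rw [Finset.sum_add_distrib, ← Finset.mul_sum, ← Finset.sum_mul, ← hxr]
  field_simp

/-- The multiplier `(|x|² / (1 + |x|²))^(ε/2)`. -/
def cutoff (n : ℕ) (ε : ℝ) (x : EuclideanSpace ℝ (Fin n)) : ℂ :=
  ((zfun (ε / 2) (‖x‖ ^ 2) : ℝ) : ℂ)

lemma memLp_cutoff {ε : ℝ} (hε : 0 ≤ ε) : MemLp (cutoff n ε) ∞ volume := by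
  have hz := measurable_zfun (ε / 2)
  refine memLp_top_of_bound (Measurable.aestronglyMeasurable (by unfold cutoff; fun_prop)) 1
    (ae_of_all _ fun x => ?_)
  rw [cutoff, Complex.norm_real, Real.norm_of_nonneg (zfun_nonneg (by positivity))]
  exact zfun_le_one (by positivity) (by positivity)

lemma integrable_norm_sq_cutGrad (hn : 3 ≤ n) {ε δ : ℝ} (hε : 0 ≤ ε) (hδ : 0 ≤ δ)
    {φ : EuclideanSpace ℝ (Fin n) → ℂ} (hφ : IsTestFun φ) (i : Fin n) :
    Integrable fun x => ‖cutGrad ε δ φ i x‖ ^ 2 := by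
  refine (integrable_cutGrad_bound hn hφ ε i).mono'
    ((measurable_cutGrad hφ ε δ i).norm.pow_const 2).aestronglyMeasurable ?_
  filter_upwards [ae_ne_zero hn] with x hx
  rw [Real.norm_of_nonneg (by positivity)]
  exact norm_cutGrad_le hε hδ φ i hx

/-- The cut-off operator maps the form domain to `H¹`. -/
lemma integral_cutGrad_le (hn : 3 ≤ n) {ε : ℝ} (hε : 0 < ε) (hε1 : ε ≤ 1)
    {φ : EuclideanSpace ℝ (Fin n) → ℂ} (hφ : IsTestFun φ) :
    (∫ x, ‖zfun (ε / 2) (‖x‖ ^ 2) • φ x‖ ^ 2) + ∑ i, ∫ x, ‖cutGrad ε 0 φ i x‖ ^ 2 ≤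
      (2 + 2 * (hardyC n + ε) ^ 2 * (2 / ε ^ 2)) * ‖formEmb hn hφ‖ ^ 2 := by
  have hc : 0 ≤ hardyC n := by
    have : (3 : ℝ) ≤ n := by exact_mod_cast hn
    unfold hardyC; linarith
  have hz := measurable_zfun (ε / 2)
  have hφ2 := (memLp_two_iff_integrable_sq_norm (hφ.memLp 2).1).1 (hφ.memLp 2)
  have hle : ∀ x, ‖zfun (ε / 2) (‖x‖ ^ 2) • φ x‖ ^ 2 ≤ ‖φ x‖ ^ 2 := fun x => by
    rw [norm_smul, Real.norm_of_nonneg (zfun_nonneg (by positivity))]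
    exact pow_le_pow_left₀ (mul_nonneg (zfun_nonneg (by positivity)) (norm_nonneg _))
      (mul_le_of_le_one_left (norm_nonneg _) (zfun_le_one (by positivity) (by positivity))) 2
  have hint : Integrable fun x => ‖zfun (ε / 2) (‖x‖ ^ 2) • φ x‖ ^ 2 := by
    refine hφ2.mono' (Measurable.aestronglyMeasurable ?_) (ae_of_all _ fun x => ?_)
    · have := hφ.continuous.measurable
      fun_prop
    · rw [Real.norm_of_nonneg (by positivity)]
      exact hle x
  have hintg : ∀ i ∈ Finset.univ, Integrable fun x => ‖cutGrad ε 0 φ i x‖ ^ 2 :=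
    fun i _ => integrable_norm_sq_cutGrad hn hε.le le_rfl hφ i
  have hI := integrable_zfun_div_mul_norm_sq hn hε.le hφ
  calc _ = ∫ x, (‖zfun (ε / 2) (‖x‖ ^ 2) • φ x‖ ^ 2 + ∑ i, ‖cutGrad ε 0 φ i x‖ ^ 2) := by
        rw [integral_add hint (integrable_finsetSum _ hintg), integral_finsetSum _ hintg]
    _ ≤ ∫ x, (2 * (‖φ x‖ ^ 2 + ∑ i, ‖hardyGrad φ i x‖ ^ 2) +
          2 * (hardyC n + ε) ^ 2 * (zfun ε (‖x‖ ^ 2) / ‖x‖ ^ 2 * ‖φ x‖ ^ 2)) := by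
        refine integral_mono_ae (hint.add (integrable_finsetSum _ hintg))
          (((integrable_formEmb hn hφ).const_mul 2).add (hI.const_mul _)) ?_
        filter_upwards [ae_ne_zero hn] with x hx
        have h1 := sum_norm_cutGrad_sq_le hε.le hc φ hx
        have h2 := hle x
        have h3 : 0 ≤ ‖φ x‖ ^ 2 := by positivity
        linarith
    _ = 2 * ‖formEmb hn hφ‖ ^ 2 + 2 * (hardyC n + ε) ^ 2 *
          ∫ x, zfun ε (‖x‖ ^ 2) / ‖x‖ ^ 2 * ‖φ x‖ ^ 2 := by
        rw [integral_add ((integrable_formEmb hn hφ).const_mul 2) (hI.const_mul _),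
          integral_const_mul, integral_const_mul, ← norm_sq_formEmb_eq hn hφ]
    _ ≤ 2 * ‖formEmb hn hφ‖ ^ 2 + 2 * (hardyC n + ε) ^ 2 *
          (2 / ε ^ 2 * ‖formEmb hn hφ‖ ^ 2) := by
        gcongr
        exact integral_zfun_div_mul_norm_sq_le hn hε hε1 hφ
    _ = _ := by ring

lemma tendsto_zfun_add {δ : ℕ → ℝ} (hδ : Tendsto δ atTop (𝓝 0)) (ε : ℝ) {t : ℝ} (ht : 0 < t) :
    Tendsto (fun j => zfun ε (t + δ j)) atTop (𝓝 (zfun ε t)) := by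
  have h : Tendsto (fun j => t + δ j) atTop (𝓝 t) := by simpa using hδ.const_add t
  exact (hasDerivAt_zfun ε ht).continuousAt.tendsto.comp h

lemma tendsto_cutGrad {δ : ℕ → ℝ} (hδ : Tendsto δ atTop (𝓝 0)) (ε : ℝ)
    (φ : EuclideanSpace ℝ (Fin n) → ℂ) (i : Fin n) {x : EuclideanSpace ℝ (Fin n)} (hx : x ≠ 0) :
    Tendsto (fun j => cutGrad ε (δ j) φ i x) atTop (𝓝 (cutGrad ε 0 φ i x)) := by
  have ht : 0 < ‖x‖ ^ 2 := by positivity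
  have h1 := tendsto_zfun_add hδ (ε / 2) ht
  have h2 : Tendsto (fun j => ‖x‖ ^ 2 + δ j) atTop (𝓝 (‖x‖ ^ 2)) := by
    simpa using hδ.const_add (‖x‖ ^ 2)
  unfold cutGrad
  rw [add_zero]
  exact (h1.smul_const _).add ((((h1.const_mul ε).mul_const (x i)).div
    (h2.mul (h2.const_add 1)) (by positivity)).smul_const _)

/-- The cutoff is real and moves to the side of `φ`, but `χ φ` need not be smooth at the origin. The
`H¹` duality estimate is applied with `|x|² + δ` in place of `|x|²`, and then `δ → 0`. -/
lemma norm_inner_mulL2_cutoff_sq_le (hn : 3 ≤ n) {ε : ℝ} (hε : 0 < ε)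
    {φ : EuclideanSpace ℝ (Fin n) → ℂ} (hφ : IsTestFun φ) (f : L2 n) :
    ‖inner ℂ (formEmb hn hφ none) (mulL2 (cutoff n ε) (memLp_cutoff hε.le) f)‖ ^ 2 ≤
      ((∫ x, ‖zfun (ε / 2) (‖x‖ ^ 2) • φ x‖ ^ 2) + ∑ i, ∫ x, ‖cutGrad ε 0 φ i x‖ ^ 2) *
        ‖japaneseD n 1 f‖ ^ 2 := by
  set δ : ℕ → ℝ := fun j => 1 / ((j : ℝ) + 1) with hδ
  have hδ0 : ∀ j, 0 < δ j := fun j => by positivity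
  have hδlim : Tendsto δ atTop (𝓝 0) := tendsto_one_div_add_atTop_nhds_zero_nat
  have hz := measurable_zfun (ε / 2)
  have hφm := hφ.continuous.measurable
  have hle : ∀ j x, ‖zfun (ε / 2) (‖x‖ ^ 2 + δ j) • φ x‖ ≤ ‖φ x‖ := fun j x => by
    have := hδ0 j
    rw [norm_smul, Real.norm_of_nonneg (zfun_nonneg (by positivity))]
    exact mul_le_of_le_one_left (norm_nonneg _) (zfun_le_one (by positivity) (by positivity))
  have h1 := fun j => (hφ.zfun_smul ε (hδ0 j)).norm_inner_sq_le f
  simp only [hφ.fderiv_zfun_smul ε (hδ0 _)] at h1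
  have L0 : Tendsto (fun j => inner ℂ (((hφ.zfun_smul ε (hδ0 j)).memLp 2).toLp : L2 n) f) atTop
      (𝓝 (inner ℂ (formEmb hn hφ none) (mulL2 (cutoff n ε) (memLp_cutoff hε.le) f))) := by
    have e1 : inner ℂ (formEmb hn hφ none) (mulL2 (cutoff n ε) (memLp_cutoff hε.le) f) =
        ∫ x, conj (zfun (ε / 2) (‖x‖ ^ 2) • φ x) * f x := by
      rw [L2.inner_def]
      refine integral_congr_ae ?_
      filter_upwards [(hφ.memLp 2).coeFn_toLp, coeFn_mulL2 _ (memLp_cutoff hε.le) f] with x h2 h3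
      rw [formEmb_none, h2, h3, RCLike.inner_apply, cutoff, Complex.real_smul, map_mul,
        Complex.conj_ofReal]
      ring
    have e2 : ∀ j, inner ℂ (((hφ.zfun_smul ε (hδ0 j)).memLp 2).toLp : L2 n) f =
        ∫ x, conj (zfun (ε / 2) (‖x‖ ^ 2 + δ j) • φ x) * f x := fun j => by
      rw [L2.inner_def]
      refine integral_congr_ae ?_
      filter_upwards [((hφ.zfun_smul ε (hδ0 j)).memLp 2).coeFn_toLp] with x h2
      rw [h2, RCLike.inner_apply, mul_comm]
    rw [e1]
    simp_rw [e2]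
    have hfm := (Lp.memLp f).1
    refine tendsto_integral_of_dominated_convergence (fun x => ‖conj (φ x) * f x‖) (fun j => ?_)
      (integrable_mul_of_memLp (hφ.memLp 2) (Lp.memLp f)).norm (fun j => ae_of_all _ fun x => ?_) ?_
    · exact (hφ.zfun_smul ε (hδ0 j)).conj.continuous.aestronglyMeasurable.mul hfm
    · rw [norm_mul, norm_mul, RCLike.norm_conj, RCLike.norm_conj]
      exact mul_le_mul_of_nonneg_right (hle j x) (norm_nonneg _)
    · filter_upwards [ae_ne_zero hn] with x hx
      exact (((Complex.continuous_conj.tendsto _).comp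
        ((tendsto_zfun_add hδlim (ε / 2) (by positivity)).smul_const _))).mul_const _
  have L1 : Tendsto (fun j => ∫ x, ‖zfun (ε / 2) (‖x‖ ^ 2 + δ j) • φ x‖ ^ 2) atTop
      (𝓝 (∫ x, ‖zfun (ε / 2) (‖x‖ ^ 2) • φ x‖ ^ 2)) := by
    refine tendsto_integral_of_dominated_convergence (fun x => ‖φ x‖ ^ 2) (fun j => ?_)
      ((memLp_two_iff_integrable_sq_norm (hφ.memLp 2).1).1 (hφ.memLp 2))
      (fun j => ae_of_all _ fun x => ?_) ?_
    · exact Measurable.aestronglyMeasurable (by fun_prop)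
    · rw [Real.norm_of_nonneg (by positivity)]
      have := hle j x
      gcongr
    · filter_upwards [ae_ne_zero hn] with x hx
      exact ((tendsto_zfun_add hδlim (ε / 2) (by positivity)).smul_const _).norm.pow 2
  have L2 : ∀ i : Fin n, Tendsto (fun j => ∫ x, ‖cutGrad ε (δ j) φ i x‖ ^ 2) atTop
      (𝓝 (∫ x, ‖cutGrad ε 0 φ i x‖ ^ 2)) := fun i => by
    refine tendsto_integral_of_dominated_convergence _ (fun j => ?_)
      (integrable_cutGrad_bound hn hφ ε i) (fun j => ?_) ?_
    · exact ((measurable_cutGrad hφ ε (δ j) i).norm.pow_const 2).aestronglyMeasurable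
    · filter_upwards [ae_ne_zero hn] with x hx
      rw [Real.norm_of_nonneg (by positivity)]
      exact norm_cutGrad_le hε.le (hδ0 j).le φ i hx
    · filter_upwards [ae_ne_zero hn] with x hx
      exact (tendsto_cutGrad hδlim ε φ i hx).norm.pow 2
  exact le_of_tendsto_of_tendsto' (L0.norm.pow 2)
    ((L1.add (tendsto_finsetSum _ fun i _ => L2 i)).mul_const _) h1

/-- This is the dual form of the boundedness of `χ` from the form domain to `H¹`. The bound on `⟨J
g, χ f⟩` extends from test functions by density and is then tested on `g = J* χ f`. -/
lemma exists_norm_adjoint_mulL2_cutoff_le (hn : 3 ≤ n) {ε : ℝ} (hε : 0 < ε) (hε1 : ε ≤ 1) :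
    ∃ C : ℝ, 0 ≤ C ∧ ∀ f : L2 n,
      ‖(formIncl hn).adjoint (mulL2 (cutoff n ε) (memLp_cutoff hε.le) f)‖ ≤
        C * ‖japaneseD n 1 f‖ := by
  set B : ℝ := 2 + 2 * (hardyC n + ε) ^ 2 * (2 / ε ^ 2) with hB
  have hB0 : 0 ≤ B := by positivity
  refine ⟨√B, Real.sqrt_nonneg _, fun f => ?_⟩
  set h := mulL2 (cutoff n ε) (memLp_cutoff hε.le) f with hh
  have h1 : ∀ (φ : EuclideanSpace ℝ (Fin n) → ℂ) (hφ : IsTestFun φ),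
      ‖inner ℂ (formEmb hn hφ none) h‖ ≤ √B * ‖japaneseD n 1 f‖ * ‖formEmb hn hφ‖ :=
    fun φ hφ => by
      refine abs_le_of_sq_le_sq' ?_ (by positivity) |>.2
      refine (norm_inner_mulL2_cutoff_sq_le hn hε hφ f).trans ?_
      refine (mul_le_mul_of_nonneg_right (integral_cutGrad_le hn hε hε1 hφ) (by positivity)).trans
        (le_of_eq ?_)
      rw [mul_pow, mul_pow, Real.sq_sqrt hB0]
      ring
  have h2 : ∀ g : formSpace hn, ‖inner ℂ (formIncl hn g) h‖ ≤ √B * ‖japaneseD n 1 f‖ * ‖g‖ :=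
    fun g => by
      obtain ⟨φ, hφ, hlim⟩ := exists_tendsto_formEmb hn g
      exact le_of_tendsto_of_tendsto' ((tendsto_none hlim none).inner tendsto_const_nhds).norm
        (hlim.norm.const_mul _) fun k => h1 (φ k) (hφ k)
  set k := (formIncl hn).adjoint h with hk
  have h3 := h2 k
  rw [← ContinuousLinearMap.adjoint_inner_right (formIncl hn) k h, ← hk,
    inner_self_eq_norm_sq_to_K, norm_pow] at h3
  simp only [RCLike.norm_ofReal, abs_norm] at h3
  rcases (norm_nonneg k).eq_or_lt with h0 | h0
  · rw [← h0]; positivity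
  · nlinarith

end Cutoff

/-! ### Compactness -/

section Compactness

variable {n : ℕ}

/-- If `‖S M f‖ ≤ C ‖D f‖` with `S, M, D` symmetric and `D` injective, then the range of `M S` is
contained in the range of `D`. -/
lemma exists_comp_eq_of_norm_le {H : Type*} [NormedAddCommGroup H] [InnerProductSpace ℂ H]
    [CompleteSpace H] {S M D : H →L[ℂ] H} (hS : ∀ a b, inner ℂ (S a) b = inner ℂ a (S b))
    (hM : ∀ a b, inner ℂ (M a) b = inner ℂ a (M b)) (hD : ∀ a b, inner ℂ (D a) b = inner ℂ a (D b))
    (hinj : ∀ a, D a = 0 → a = 0) {C : ℝ} (h : ∀ f, ‖S (M f)‖ ≤ C * ‖D f‖) :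
    ∃ T : H →L[ℂ] H, ∀ f, M (S f) = D (T f) := by
  have hdense : DenseRange (D : H →ₗ[ℂ] H) := by
    have h1 : (LinearMap.range (D : H →ₗ[ℂ] H)).topologicalClosure = ⊤ := by
      rw [Submodule.topologicalClosure_eq_top_iff, Submodule.eq_bot_iff]
      intro x hx
      refine hinj x (ext_inner_left ℂ fun a => ?_)
      rw [← hD, inner_zero_right]
      exact (Submodule.mem_orthogonal _ _).1 hx _ (LinearMap.mem_range_self _ a)
    have h2 := Submodule.dense_iff_topologicalClosure_eq_top.2 h1
    rwa [LinearMap.coe_range] at h2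
  -- The hypothesis makes `D f ↦ S M f` well defined and bounded on the dense range of `D`. Taking
  -- adjoints in `S M = E D` gives `M S = D E*`.
  set E : H →L[ℂ] H := ((S ∘L M : H →L[ℂ] H) : H →ₗ[ℂ] H).extendOfNorm (D : H →ₗ[ℂ] H) with hE
  have hED : ∀ f, E (D f) = S (M f) := fun f =>
    LinearMap.extendOfNorm_eq (f := ((S ∘L M : H →L[ℂ] H) : H →ₗ[ℂ] H)) hdense ⟨C, h⟩ f
  refine ⟨E.adjoint, fun f => ext_inner_right ℂ fun g => ?_⟩
  rw [hM, hS, hD, ContinuousLinearMap.adjoint_inner_left, hED]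

/-- Since `S² = J J*`, bounds proved for `J*` transfer to the square root. -/
lemma norm_apply_eq_of_sq_eq {H K : Type*} [NormedAddCommGroup H] [InnerProductSpace ℂ H]
    [CompleteSpace H] [NormedAddCommGroup K] [InnerProductSpace ℂ K] [CompleteSpace K]
    {J : K →L[ℂ] H} {S : H →L[ℂ] H} (hS : ∀ a b, inner ℂ (S a) b = inner ℂ a (S b))
    (h : ∀ f, S (S f) = J (J.adjoint f)) (f : H) : ‖S f‖ = ‖J.adjoint f‖ := by
  have h1 : inner ℂ (S f) (S f) = inner ℂ (J.adjoint f) (J.adjoint f) := by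
    rw [hS, h, ← ContinuousLinearMap.adjoint_inner_left]
  rw [inner_self_eq_norm_sq_to_K, inner_self_eq_norm_sq_to_K] at h1
  have h2 : ‖S f‖ ^ 2 = ‖J.adjoint f‖ ^ 2 := by exact_mod_cast h1
  exact (sq_eq_sq₀ (norm_nonneg _) (norm_nonneg _)).1 h2

lemma cutoff_ne_zero (ε : ℝ) {x : EuclideanSpace ℝ (Fin n)} (hx : x ≠ 0) : cutoff n ε x ≠ 0 := by
  rw [cutoff, Complex.ofReal_ne_zero]
  exact (zfun_pos (by positivity)).ne'

/-- Near the origin `χ⁻¹` behaves like `|x|^{-ε}`, so its high level sets lie in balls of radius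
comparable to `l^{-1/ε}`. -/
lemma exists_volume_inv_cutoff_le {ε : ℝ} (hε : 0 < ε) (hε1 : ε ≤ 1) :
    ∃ C : ℝ, 0 ≤ C ∧ ∀ l : ℝ, 2 ≤ l →
      volume {x : EuclideanSpace ℝ (Fin n) | l < ‖(cutoff n ε x)⁻¹‖} ≤
        ENNReal.ofReal (C * l ^ (-((n : ℝ) / ε))) := by
  have hfin : volume (Metric.ball (0 : EuclideanSpace ℝ (Fin n)) 1) ≠ ∞ := measure_ball_lt_top.ne
  refine ⟨√2 ^ n * (volume (Metric.ball (0 : EuclideanSpace ℝ (Fin n)) 1)).toReal, by positivity,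
    fun l hl => ?_⟩
  have hl0 : 0 < l := by linarith
  have hr : 0 < √2 * l ^ (-(1 / ε)) := by positivity
  have hsub : {x : EuclideanSpace ℝ (Fin n) | l < ‖(cutoff n ε x)⁻¹‖} ⊆
      Metric.ball 0 (√2 * l ^ (-(1 / ε))) := fun x hx => by
    have hx' : l < ‖(cutoff n ε x)⁻¹‖ := hx
    rw [norm_inv, cutoff, Complex.norm_real, Real.norm_of_nonneg (zfun_nonneg (by positivity)),
      zfun, ← Real.inv_rpow (by positivity), inv_div] at hx'
    have hx0 : x ≠ 0 := fun h0 => by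
      rw [h0, norm_zero] at hx'
      norm_num at hx'
      rw [Real.zero_rpow (by positivity)] at hx'
      linarith
    have ht : 0 < ‖x‖ ^ 2 := by positivity
    have h1 : l ^ (2 / ε) < (1 + ‖x‖ ^ 2) / ‖x‖ ^ 2 := by
      have h2 := Real.rpow_lt_rpow hl0.le hx' (by positivity : 0 < 2 / ε)
      rwa [← Real.rpow_mul (by positivity), div_mul_div_cancel₀ (by positivity), div_self hε.ne',
        Real.rpow_one] at h2
    -- Here `ε ≤ 1` makes the exponent at least `1`. The bound absorbs the `|x|²` in the numerator
    -- of `h1`, at the price of the factor `2` in `h4`.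
    have h3 : 2 ≤ l ^ (2 / ε) := by
      refine hl.trans (Real.self_le_rpow_of_one_le (by linarith) ?_)
      rw [le_div_iff₀ hε]; linarith
    have h4 : ‖x‖ ^ 2 < 2 / l ^ (2 / ε) := by
      rw [lt_div_iff₀ ht] at h1
      rw [lt_div_iff₀ (by positivity)]
      nlinarith
    have h5 : 2 / l ^ (2 / ε) = (√2 * l ^ (-(1 / ε))) ^ 2 := by
      rw [mul_pow, Real.sq_sqrt (by norm_num), ← Real.rpow_natCast, ← Real.rpow_mul hl0.le,
        div_eq_mul_inv, ← Real.rpow_neg hl0.le]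
      congr 2
      push_cast
      ring
    rw [mem_ball_zero_iff]
    rw [h5] at h4
    exact lt_of_pow_lt_pow_left₀ 2 hr.le h4
  refine (measure_mono hsub).trans (le_of_eq ?_)
  rw [Measure.addHaar_ball_of_pos _ _ hr, finrank_euclideanSpace_fin, ← ENNReal.ofReal_toReal hfin,
    ← ENNReal.ofReal_mul (by positivity), ENNReal.toReal_ofReal (by positivity)]
  congr 1
  rw [mul_pow, ← Real.rpow_natCast (l ^ _), ← Real.rpow_mul hl0.le]
  have h6 : -(1 / ε) * (n : ℝ) = -((n : ℝ) / ε) := by ring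
  rw [h6]
  ring

/-- The graph of `-Δ` is single valued, and both `(0, f)` and `(0, 0)` would lie on it. -/
lemma japaneseD_eq_zero {f : L2 n} (h : japaneseD n 1 f = 0) : f = 0 := by
  obtain ⟨-, hinv⟩ := isInvSqrtAddOne_japaneseD (n := n)
  have h1 : ((0 : L2 n), f - 0) ∈ negLaplacianGraph n := (hinv f 0).1 (by rw [h, map_zero])
  have h2 : japaneseD n 1 (japaneseD n 1 0) = 0 := by rw [map_zero, map_zero]
  have h3 : ((0 : L2 n), (0 : L2 n) - 0) ∈ negLaplacianGraph n := (hinv 0 0).1 h2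
  have h4 : Lp.toTemperedDistribution (f - 0) = Lp.toTemperedDistribution ((0 : L2 n) - 0) :=
    Eq.trans h1 (Eq.symm h3)
  simpa using toTemperedDistribution_injective h4

theorem isCompactMulInvSqrt_negLaplacianGraph (hn : 3 ≤ n) {q : ℝ} (hq : (n : ℝ) < q)
    {w : EuclideanSpace ℝ (Fin n) → ℂ} (hw : WeakDecay q w) :
    IsCompactMulInvSqrt w (negLaplacianGraph n) := by
  have hn' : (3 : ℝ) ≤ n := by exact_mod_cast hn
  refine ⟨japaneseD n 1, isInvSqrtAddOne_japaneseD, isCompactMulComp_japaneseD (by linarith) ?_ hw⟩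
  rw [NNReal.coe_one, div_lt_one (by linarith)]
  exact hq

/-- Inserting `χ⁻¹ χ` factors the operator as `(w χ⁻¹ ⟨D⟩^{-1}) T`, a compact operator composed with
a bounded one. -/
theorem isCompactMulInvSqrt_hardyGraph (hn : 3 ≤ n) {q : ℝ} (hq : (n : ℝ) < q)
    {w : EuclideanSpace ℝ (Fin n) → ℂ} (hw : WeakDecay q w) :
    IsCompactMulInvSqrt w (hardyGraph n) := by
  have hn' : (3 : ℝ) ≤ n := by exact_mod_cast hn
  obtain ⟨q', hq', hqq'⟩ := exists_between hq
  have hq'0 : 0 < q' := by linarith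
  have hα : 0 < 1 - q' / q := by
    rw [sub_pos, div_lt_one (by linarith)]
    exact hqq'
  -- The inverse cutoff has decay exponent `n/ε`; this is the size of `ε` for which `w χ⁻¹` keeps
  -- the exponent `q' > n`.
  set ε : ℝ := min 1 (n * (1 - q' / q) / q') with hεdef
  have hε : 0 < ε := lt_min one_pos (by positivity)
  have hε1 : ε ≤ 1 := min_le_left _ _
  have hQ : q' ≤ (n : ℝ) / ε * (1 - q' / q) := by
    have h1 : ε ≤ n * (1 - q' / q) / q' := min_le_right _ _
    rw [le_div_iff₀ hq'0] at h1
    rw [div_mul_eq_mul_div, le_div_iff₀ hε]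
    linarith
  obtain ⟨C, hC, hCv⟩ := exists_volume_inv_cutoff_le (n := n) hε hε1
  have hwv : WeakDecay q' fun x => w x * (cutoff n ε x)⁻¹ :=
    hw.mul hq'0 hqq' hQ one_le_two hC (memLp_cutoff hε.le).1.inv₀ hCv
  obtain ⟨K, hK, hKw⟩ := isCompactMulComp_japaneseD (s := 1) (by linarith) (by
    rw [NNReal.coe_one, div_lt_one hq'0]; exact hq') hwv
  obtain ⟨S, hS, hSS⟩ := exists_isInvSqrtAddOne_hardyGraph hn
  have hSsym : ∀ a b : L2 n, inner ℂ (S a) b = inner ℂ a (S b) := hS.1.isSymmetric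
  have hDsym : ∀ a b : L2 n, inner ℂ (japaneseD n 1 a) b = inner ℂ a (japaneseD n 1 b) :=
    isInvSqrtAddOne_japaneseD.1.isSymmetric
  obtain ⟨B, -, hBle⟩ := exists_norm_adjoint_mulL2_cutoff_le hn hε hε1
  obtain ⟨T, hT⟩ := exists_comp_eq_of_norm_le (C := B) hSsym
    (inner_mulL2_left (memLp_cutoff hε.le) fun x => Complex.conj_ofReal _) hDsym
    (fun a => japaneseD_eq_zero) fun f => by
      rw [norm_apply_eq_of_sq_eq hSsym hSS]
      exact hBle f
  refine ⟨S, hS, K ∘L T, hK.comp_clm T, fun f => ?_⟩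
  filter_upwards [hKw (T f), coeFn_mulL2 _ (memLp_cutoff hε.le) (S f), ae_ne_zero hn]
    with x h1 h2 hx
  rw [ContinuousLinearMap.comp_apply, h1, ← hT, h2, mul_assoc,
    inv_mul_cancel_left₀ (cutoff_ne_zero ε hx)]

lemma exists_real_between {a : ℝ} {p : ℝ≥0∞} (h : ENNReal.ofReal a < p) :
    ∃ q : ℝ, a < q ∧ ENNReal.ofReal q ≤ p := by
  obtain ⟨r, h1, h2⟩ := ENNReal.lt_iff_exists_nnreal_btwn.1 h
  refine ⟨r, ?_, by simpa using h2.le⟩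
  by_contra hc
  exact absurd h1 (not_lt.2 (by simpa using ENNReal.ofReal_le_ofReal (not_lt.1 hc)))

end Compactness

end RelFormCompact

end

/-! ### Choice of the decay exponent and conclusion. -/

theorem mainTheorem9 (n : ℕ) (hn : 3 ≤ n) :
    (∀ (p : ℝ≥0∞) (w : EuclideanSpace ℝ (Fin n) → ℂ), (n : ℝ≥0∞) < p →
      RelFormCompact.MemWeakLpZeroAddLinftyZero p w →
        (∀ s : ℝ≥0, (n : ℝ≥0∞) / p < s →
          RelFormCompact.IsCompactMulComp w (RelFormCompact.japaneseD n s)) ∧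
        RelFormCompact.IsCompactMulInvSqrt w (RelFormCompact.negLaplacianGraph n) ∧
        RelFormCompact.IsCompactMulInvSqrt w (RelFormCompact.hardyGraph n)) ∧
    (∀ (p : ℝ≥0∞) (V : EuclideanSpace ℝ (Fin n) → ℂ), (n : ℝ≥0∞) / 2 < p →
      RelFormCompact.MemWeakLpZeroAddLinftyZero p V →
        RelFormCompact.IsCompactMulInvSqrt (fun x => ((√‖V x‖ : ℝ) : ℂ))
          (RelFormCompact.negLaplacianGraph n) ∧
        RelFormCompact.IsCompactMulInvSqrt (fun x => ((√‖V x‖ : ℝ) : ℂ))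
          (RelFormCompact.hardyGraph n)) := by
  have hn' : (3 : ℝ) ≤ n := by exact_mod_cast hn
  refine ⟨fun p w hp hw => ⟨fun s hs => ?_, ?_⟩, fun p V hp hV => ?_⟩
  · have hp0 : p ≠ 0 := (bot_le.trans_lt hp).ne'
    -- The exponent must exceed `n/s` for the dyadic sum to converge and `2` for the truncated
    -- weight to be square integrable; the latter is possible since `p > n ≥ 3`.
    have h1 : ENNReal.ofReal (max 2 ((n : ℝ) / s)) < p := by
      rw [ENNReal.ofReal_max, max_lt_iff]
      refine ⟨lt_of_le_of_lt ?_ hp, ?_⟩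
      · rw [ENNReal.ofReal_ofNat]
        exact_mod_cast (by omega : 2 ≤ n)
      · have hs0 : 0 < s := ENNReal.coe_pos.1 (pos_of_gt hs)
        rw [ENNReal.ofReal_div_of_pos (by exact_mod_cast hs0), ENNReal.ofReal_natCast,
          ENNReal.ofReal_coe_nnreal]
        exact ENNReal.div_lt_of_lt_mul' (by
          rwa [ENNReal.div_lt_iff (Or.inl hp0) (Or.inr (ENNReal.natCast_ne_top n))] at hs)
    obtain ⟨q, hq, hqp⟩ := RelFormCompact.exists_real_between h1
    have hq2 : 2 < q := (le_max_left _ _).trans_lt hq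
    have hqs : (n : ℝ) / s < q := (le_max_right _ _).trans_lt hq
    have hs0 : (0 : ℝ) < s := NNReal.coe_pos.2 (ENNReal.coe_pos.1 (pos_of_gt hs))
    refine RelFormCompact.isCompactMulComp_japaneseD hq2 ?_ (hw.weakDecay (by linarith) hqp)
    rw [div_lt_iff₀ (by linarith)]
    rw [div_lt_iff₀ hs0] at hqs
    linarith
  · obtain ⟨q, hq, hqp⟩ := RelFormCompact.exists_real_between (a := n) (p := p) (by simpa using hp)
    have hd := hw.weakDecay (by linarith) hqp
    exact ⟨RelFormCompact.isCompactMulInvSqrt_negLaplacianGraph hn hq hd,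
      RelFormCompact.isCompactMulInvSqrt_hardyGraph hn hq hd⟩
  · obtain ⟨q, hq, hqp⟩ := RelFormCompact.exists_real_between (a := (n : ℝ) / 2) (p := p) (by
      rwa [ENNReal.ofReal_div_of_pos two_pos, ENNReal.ofReal_natCast, ENNReal.ofReal_ofNat])
    have hd := (hV.weakDecay (by linarith) hqp).sqrt_norm
    have hq2 : (n : ℝ) < 2 * q := by linarith
    exact ⟨RelFormCompact.isCompactMulInvSqrt_negLaplacianGraph hn hq2 hd,
      RelFormCompact.isCompactMulInvSqrt_hardyGraph hn hq2 hd⟩
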